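/- **Language.** Let $D\subset\mathbb Q$ be finite. There are countably many *domain variables* $x$ (with values in $D$) and *real variables* $r$. Let $q\in\mathbb Q$, $d\in D$, $a\in\mathbb Q^{>0}$ and $\sim\;\in\{=,\neq,<,\le,>,\ge\}$. Real expressions, Boolean expressions and statements are $$R ::= r \mid qR \mid R+R \mid R+q,\qquad B ::= R\sim R\mid R\sim x\mid x\sim x,$$ $$S ::= x\gets d\mid r\gets \mathcal N(x,\tfrac a\epsilon)\mid r\gets \mathrm{Lap}(x,\tfrac a\epsilon)\mid r\gets R\mid \mathsf{if}\ B\ \mathsf{then}\ S\ \mathsf{else}\ S\mid \mathsf{skip}\mid S;S .$$ Here $\mathcal N(\mu,\sigma)$ is the Gaussian law with mean $\mu$ and standard deviation $\sigma$, and $\mathrm{Lap}(\mu,b)$ has density $\frac1{2b}e^{-|y-\mu|/b}$. A *DiPGauss program* over $D$ is a triple $P=(\mathcal I,\mathcal O,S)$ where $\mathcal I,\mathcal O$ are disjoint finite sets of domain variables (inputs and outputs) and $S$ is a statement such that, along every control path, each real variable is assigned at most once and every reference to a non-input variable is preceded by an assignment to it. **Semantics.** Fix a rational $\epsilon>0$.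 A state is a triple $(\alpha,\beta,G)$: $\alpha$ is a partial map from domain variables to $D$; $\beta$ is a partial map sending a real variable either to a distribution with its parameters ("sampled" variable) or to a real expression ("dependent" variable); $G$ is a finite set of Boolean expressions. The set of final states of a statement from a given state is defined by recursion: - $\mathsf{skip}$ changes nothing, and $x\gets d$ sets $\alpha(x)=d$; - a sampling statement sets $\beta(r)$ to the distribution with mean $\alpha(x)$ and scale $a/\epsilon$; - $r\gets R$ sets $\beta(r)$ to the expression obtained from $R$ by replacing every dependent variable $r'$ by $\beta(r')$; - $\mathsf{if}\ B\ \mathsf{then}\ S_1\ \mathsf{else}\ S_2$ gives the union of the final states of $S_1$ after adding $B$ to $G$ and of $S_2$ after adding the negated comparison $\neg B$ to $G$; - $S_1;S_2$ gives the union of the final states of $S_2$ from all final states of $S_1$. For $u:\mathcal I\to D$ and $o:\mathcal O\to D$, let $\mathrm{Run}_\epsilon(u,o,P)$ be the set of final states $(\alpha,\beta,G)$ of $S$ from the state $(u,\emptyset,\emptyset)$ with $\alpha(y)=o(y)$ for all $y\in\mathcal O$. For a state $\tau=(\alpha,\beta,G)$, let $(X_r)$ be independent random variables, $X_r$ having law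 $\beta(r)$, for the sampled variables $r$. Let $\Pr(\epsilon,\tau)$ be the probability that all expressions in $G$ are true when each domain variable $x$ takes the value $\alpha(x)$, each sampled variable $r$ the value $X_r$, and each dependent variable $r$ the value of the expression $\beta(r)$ at the $X$'s. (In particular $\Pr(\epsilon,\tau)=0$ if a comparison $x\sim x'$ in $G$ is false under $\alpha$.) Define $$\Pr(\epsilon,u,o,P)=\sum_{\tau\in \mathrm{Run}_\epsilon(u,o,P)}\Pr(\epsilon,\tau).$$ **Theorem.** The output probabilities are effectively approximable: there is a single algorithm which, given a precision $\varrho\in\mathbb N$, a rational $\epsilon>0$, a DiPGauss program $P=(\mathcal I,\mathcal O,S)$ over a finite set $D\subset\mathbb Q$, an input $u:\mathcal I\to D$ and an output $o:\mathcal O\to D$, halts and returns rational numbers $L,U$ with $$L\le \Pr(\epsilon,u,o,P)\le U\qquad\text{and}\qquad U-L\le 2^{-\varrho}.$$ -/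

import Mathlib

namespace DiPGauss

/-! ### Syntax

Domain variables and real variables are both named by natural numbers; `D` is the finite
domain of rationals. -/

/-- The comparison symbols. -/
inductive Cmp where
  | eq | le | lt | ge | gt | ne

/-- The flipped comparison. -/
def Cmp.neg : Cmp → Cmp
  | .eq => .ne
  | .le => .gt
  | .lt => .ge
  | .ge => .lt
  | .gt => .le
  | .ne => .eq

/-- The relation on reals denoted by a comparison symbol. -/
def Cmp.holds : Cmp → ℝ → ℝ → Prop
  | .eq, a, b => a = b
  | .le, a, b => a ≤ b
  | .lt, a, b => a < b
  | .ge, a, b => a ≥ b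
  | .gt, a, b => a > b
  | .ne, a, b => a ≠ b

/-- Real expressions `R ::= r | q R | R + R | R + q`. -/
inductive RExp where
  | var (r : ℕ)
  | smul (q : ℚ) (R : RExp)
  | add (R₁ R₂ : RExp)
  | addConst (R : RExp) (q : ℚ)

/-- Boolean expressions `B ::= R ~ R | R ~ x | x ~ x`. -/
inductive BExp where
  | realReal (c : Cmp) (R₁ R₂ : RExp)
  | realDom (c : Cmp) (R : RExp) (x : ℕ)
  | domDom (c : Cmp) (x₁ x₂ : ℕ)

/-- The flipped Boolean expression. -/
def BExp.neg : BExp → BExp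
  | .realReal c R₁ R₂ => .realReal c.neg R₁ R₂
  | .realDom c R x => .realDom c.neg R x
  | .domDom c x₁ x₂ => .domDom c.neg x₁ x₂

/-- Program statements: `x ← d`, `r ← N(x, a/ε)`, `r ← Lap(x, a/ε)`, `r ← R`,
`if B then S₁ else S₂`, `skip`, `S₁; S₂`. -/
inductive Stmt (D : Finset ℚ) where
  | skip
  | assign (x : ℕ) (d : D)
  | gauss (r x : ℕ) (a : {a : ℚ // 0 < a})
  | lap (r x : ℕ) (a : {a : ℚ // 0 < a})
  | real (r : ℕ) (R : RExp)
  | ite (B : BExp) (S₁ S₂ : Stmt D)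
  | seq (S₁ S₂ : Stmt D)

/-- A program: input variables, output variables and a statement. -/
structure Program (D : Finset ℚ) where
  inputs : Finset ℕ
  outputs : Finset ℕ
  disjoint : Disjoint inputs outputs
  body : Stmt D

/-! ### Standing assumptions on programs -/

/-- Real variables occurring in a real expression. -/
def RExp.vars : RExp → Finset ℕ
  | .var r => {r}
  | .smul _ R => R.vars
  | .add R₁ R₂ => R₁.vars ∪ R₂.vars
  | .addConst R _ => R.vars

/-- Real variables occurring in a Boolean expression. -/
def BExp.realVars : BExp → Finset ℕ
  | .realReal _ R₁ R₂ => R₁.vars ∪ R₂.vars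
  | .realDom _ R _ => R.vars
  | .domDom _ _ _ => ∅

/-- Domain variables occurring in a Boolean expression. -/
def BExp.domVars : BExp → Finset ℕ
  | .realReal _ _ _ => ∅
  | .realDom _ _ x => {x}
  | .domDom _ x₁ x₂ => {x₁, x₂}

namespace Stmt

variable {D : Finset ℚ}

/-- Domain variables that are assigned on every control path. -/
def surelyDom : Stmt D → Finset ℕ
  | .assign x _ => {x}
  | .ite _ S₁ S₂ => S₁.surelyDom ∩ S₂.surelyDom
  | .seq S₁ S₂ => S₁.surelyDom ∪ S₂.surelyDom
  | _ => ∅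

/-- Real variables that are assigned on every control path. -/
def surelyReal : Stmt D → Finset ℕ
  | .gauss r _ _ => {r}
  | .lap r _ _ => {r}
  | .real r _ => {r}
  | .ite _ S₁ S₂ => S₁.surelyReal ∩ S₂.surelyReal
  | .seq S₁ S₂ => S₁.surelyReal ∪ S₂.surelyReal
  | _ => ∅

/-- Real variables that are assigned on some control path. -/
def maybeReal : Stmt D → Finset ℕ
  | .gauss r _ _ => {r}
  | .lap r _ _ => {r}
  | .real r _ => {r}
  | .ite _ S₁ S₂ => S₁.maybeReal ∪ S₂.maybeReal
  | .seq S₁ S₂ => S₁.maybeReal ∪ S₂.maybeReal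
  | _ => ∅

/-- Each real variable is assigned at most once along every control path. -/
def SingleAssignment : Stmt D → Prop
  | .ite _ S₁ S₂ => S₁.SingleAssignment ∧ S₂.SingleAssignment
  | .seq S₁ S₂ =>
      S₁.SingleAssignment ∧ S₂.SingleAssignment ∧ Disjoint S₁.maybeReal S₂.maybeReal
  | _ => True

/-- Along every control path, each reference to a variable is preceded by an assignment to it,
where the domain variables in `X` and the real variables in `V` are assigned at the start. -/
def ReferencesAssigned : Stmt D → Finset ℕ → Finset ℕ → Prop
  | .skip, _, _ => True
  | .assign _ _, _, _ => True
  | .gauss _ x _, X, _ => x ∈ X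
  | .lap _ x _, X, _ => x ∈ X
  | .real _ R, _, V => R.vars ⊆ V
  | .ite B S₁ S₂, X, V =>
      B.domVars ⊆ X ∧ B.realVars ⊆ V ∧ S₁.ReferencesAssigned X V ∧ S₂.ReferencesAssigned X V
  | .seq S₁ S₂, X, V =>
      S₁.ReferencesAssigned X V ∧ S₂.ReferencesAssigned (X ∪ S₁.surelyDom) (V ∪ S₁.surelyReal)

end Stmt

/-- The standing assumptions: single assignment of real variables along every control path, and
every reference to a non-input variable is preceded by an assignment. -/
def Program.WellFormed {D : Finset ℚ} (P : Program D) : Prop :=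
  P.body.SingleAssignment ∧ P.body.ReferencesAssigned P.inputs ∅

/-! ### Distributions -/

inductive DistrKind where
  | gaussian | laplace

/-- A symbolic distribution; `scale` is the standard deviation of a Gaussian and the scaling
parameter of a Laplace distribution. -/
structure Distr where
  kind : DistrKind
  mean : ℚ
  scale : {b : ℚ // 0 < b}

/-- The Laplace distribution, with density `exp (-|x - μ| / b) / (2 b)`. -/
noncomputable def laplaceReal (μ b : ℝ) : MeasureTheory.Measure ℝ :=
  MeasureTheory.volume.withDensity
    (fun x => ENNReal.ofReal (1 / (2 * b) * Real.exp (-|x - μ| / b)))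

/-- The law denoted by a symbolic distribution (`gaussianReal` takes the variance). -/
noncomputable def Distr.law (d : Distr) : MeasureTheory.Measure ℝ :=
  match d.kind with
  | .gaussian => ProbabilityTheory.gaussianReal (d.mean : ℝ) (Real.toNNReal ((d.scale.1 : ℝ) ^ 2))
  | .laplace => laplaceReal (d.mean : ℝ) (d.scale.1 : ℝ)

/-! ### Symbolic states and final states -/

/-- A state: values of domain variables, the distribution or the expression recorded for each
real variable, and the set of guards assumed so far. -/
structure State (D : Finset ℚ) where
  α : ℕ → Option D
  β : ℕ → Option (Distr ⊕ RExp)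
  G : Finset BExp

/-- Replace every dependent variable by the expression recorded for it. -/
def RExp.subst (β : ℕ → Option (Distr ⊕ RExp)) : RExp → RExp
  | .var r =>
      match β r with
      | some (.inr R) => R
      | _ => .var r
  | .smul q R => .smul q (R.subst β)
  | .add R₁ R₂ => .add (R₁.subst β) (R₂.subst β)
  | .addConst R q => .addConst (R.subst β) q

namespace State

variable {D : Finset ℚ}

def setDom (st : State D) (x : ℕ) (d : D) : State D :=
  { st with α := Function.update st.α x (some d) }

def setReal (st : State D) (r : ℕ) (v : Distr ⊕ RExp) : State D :=
  { st with β := Function.update st.β r (some v) }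

open Classical in
noncomputable def assume (st : State D) (B : BExp) : State D :=
  { st with G := insert B st.G }

/-- Record that `r` is sampled from the distribution of the given kind with mean the current
value of `x` and scale `a / ε`. (No state results if `x` has no value, which does not happen in a
well-formed program.) -/
noncomputable def sample (st : State D) (ε : {ε : ℚ // 0 < ε}) (k : DistrKind) (r x : ℕ)
    (a : {a : ℚ // 0 < a}) : Finset (State D) :=
  match st.α x with
  | some d => {st.setReal r (.inl ⟨k, d, ⟨a / ε, div_pos a.2 ε.2⟩⟩)}
  | none => ∅

end State

open Classical in
/-- The set of final states reached when a statement is executed from a state. -/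
noncomputable def Stmt.finalStates {D : Finset ℚ} (ε : {ε : ℚ // 0 < ε}) :
    Stmt D → State D → Finset (State D)
  | .skip, st => {st}
  | .assign x d, st => {st.setDom x d}
  | .gauss r x a, st => st.sample ε .gaussian r x a
  | .lap r x a, st => st.sample ε .laplace r x a
  | .real r R, st => {st.setReal r (.inr (R.subst st.β))}
  | .ite B S₁ S₂, st =>
      S₁.finalStates ε (st.assume B) ∪ S₂.finalStates ε (st.assume B.neg)
  | .seq S₁ S₂, st => (S₁.finalStates ε st).biUnion (fun st₁ => S₂.finalStates ε st₁)

/-- The initial state on input `u`. -/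
def Program.initState {D : Finset ℚ} (P : Program D) (u : P.inputs → D) : State D where
  α := fun x => if h : x ∈ P.inputs then some (u ⟨x, h⟩) else none
  β := fun _ => none
  G := ∅

open Classical in
/-- The final states on input `u` with output `o`. -/
noncomputable def Program.runs {D : Finset ℚ} (P : Program D) (ε : {ε : ℚ // 0 < ε})
    (u : P.inputs → D) (o : P.outputs → D) : Finset (State D) :=
  (P.body.finalStates ε (P.initState u)).filter (fun τ => ∀ y : P.outputs, τ.α y = some (o y))

/-! ### Probabilities -/

/-- The value of a real expression when `v r` is the value of the real variable `r`. -/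
noncomputable def RExp.eval (v : ℕ → ℝ) : RExp → ℝ
  | .var r => v r
  | .smul q R => (q : ℝ) * R.eval v
  | .add R₁ R₂ => R₁.eval v + R₂.eval v
  | .addConst R q => R.eval v + (q : ℝ)

namespace State

variable {D : Finset ℚ}

/-- The value of the real variable `r`, where `ω s` is the value of the sampled random variable
`X_s`. (Variables without a recorded value do not occur in guards of well-formed programs.) -/
noncomputable def rand (τ : State D) (ω : ℕ → ℝ) (r : ℕ) : ℝ :=
  match τ.β r with
  | some (.inl _) => ω r
  | some (.inr R) => R.eval ω
  | none => 0

/-- All guards that compare two domain variables hold. -/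
def evalConst (τ : State D) : Prop :=
  ∀ (c : Cmp) (x₁ x₂ : ℕ), BExp.domDom c x₁ x₂ ∈ τ.G →
    ∃ d₁ d₂ : D, τ.α x₁ = some d₁ ∧ τ.α x₂ = some d₂ ∧ c.holds ((d₁ : ℚ) : ℝ) ((d₂ : ℚ) : ℝ)

/-- All guards that involve real variables hold, for the values `ω` of the random variables. -/
def evalRand (τ : State D) (ω : ℕ → ℝ) : Prop :=
  (∀ (c : Cmp) (R₁ R₂ : RExp), BExp.realReal c R₁ R₂ ∈ τ.G →
    c.holds (R₁.eval (τ.rand ω)) (R₂.eval (τ.rand ω))) ∧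
  (∀ (c : Cmp) (R : RExp) (x : ℕ), BExp.realDom c R x ∈ τ.G →
    ∃ d : D, τ.α x = some d ∧ c.holds (R.eval (τ.rand ω)) ((d : ℚ) : ℝ))

/-- The law of the random variable `X_r`. Variables that are not sampled get an irrelevant law,
since `rand` does not use their coordinate. -/
noncomputable def law (τ : State D) (r : ℕ) : MeasureTheory.Measure ℝ :=
  match τ.β r with
  | some (.inl d) => d.law
  | _ => MeasureTheory.Measure.dirac 0

open Classical in
/-- The probability of a state; the random variables `X_r` are independent. -/
noncomputable def prob (τ : State D) : ℝ :=
  if τ.evalConst then (MeasureTheory.Measure.infinitePi τ.law).real {ω | τ.evalRand ω} else 0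

end State

/-- The probability that the program outputs `o` on input `u`. -/
noncomputable def Program.prob {D : Finset ℚ} (P : Program D) (ε : {ε : ℚ // 0 < ε})
    (u : P.inputs → D) (o : P.outputs → D) : ℝ :=
  ∑ τ ∈ P.runs ε u o, τ.prob

/-! ### The laws are probability measures -/

theorem lintegral_laplace (μ b : ℝ) (hb : 0 < b) :
    ∫⁻ x, ENNReal.ofReal (1 / (2 * b) * Real.exp (-|x - μ| / b)) = 1 := by
  have h1 : ∫⁻ x, ENNReal.ofReal (1 / (2 * b) * Real.exp (-|x - μ| / b)) =
      ∫⁻ x, ENNReal.ofReal (1 / (2 * b) * Real.exp (-|x| / b)) :=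
    MeasureTheory.lintegral_sub_right_eq_self
      (fun x : ℝ => ENNReal.ofReal (1 / (2 * b) * Real.exp (-|x| / b))) μ
  have hI : ∫ x : ℝ, Real.exp (-|x| / b) = 2 * b := by
    have h2 : ∫ x : ℝ, Real.exp (-|x| / b) = 2 * ∫ x in Set.Ioi (0 : ℝ), Real.exp (-x / b) :=
      integral_comp_abs (f := fun x => Real.exp (-x / b))
    have h3 : ∫ x in Set.Ioi (0 : ℝ), Real.exp (-x / b) = b := by
      have := integral_exp_mul_Ioi (a := -(1 / b)) (by simpa using hb) 0
      simp only [mul_zero, Real.exp_zero] at this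
      have e : ∀ x : ℝ, -x / b = -(1 / b) * x := fun x => by ring
      simp only [e, this]
      field_simp
    rw [h2, h3]
  have hint : MeasureTheory.Integrable (fun x : ℝ => Real.exp (-|x| / b)) := by
    by_contra h
    rw [MeasureTheory.integral_undef h] at hI
    linarith
  rw [h1, ← MeasureTheory.ofReal_integral_eq_lintegral_ofReal (hint.const_mul _)
    (Filter.Eventually.of_forall fun x => by positivity), MeasureTheory.integral_const_mul, hI]
  rw [one_div_mul_cancel (by positivity), ENNReal.ofReal_one]

instance (d : Distr) : MeasureTheory.IsProbabilityMeasure d.law := by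
  obtain ⟨k, m, b, hb⟩ := d
  cases k with
  | gaussian => unfold Distr.law; infer_instance
  | laplace =>
    refine ⟨?_⟩
    simp only [Distr.law, laplaceReal, MeasureTheory.withDensity_apply _ MeasurableSet.univ,
      MeasureTheory.Measure.restrict_univ]
    exact lintegral_laplace _ _ (by exact_mod_cast hb)

instance {D : Finset ℚ} (τ : State D) (r : ℕ) :
    MeasureTheory.IsProbabilityMeasure (τ.law r) := by
  unfold State.law
  split <;> infer_instance

/-! ### Codes of programs and valuations, as inputs of algorithms -/

/-- A rational number as the pair of its numerator and its denominator in lowest terms. -/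
def ratCode (q : ℚ) : ℤ × ℕ := (q.num, q.den)

def Cmp.code : Cmp → ℕ
  | .eq => 0
  | .le => 1
  | .lt => 2
  | .ge => 3
  | .gt => 4
  | .ne => 5

/-- Goedel numbers of real expressions: a tag paired with the numbers of the components. -/
def RExp.code : RExp → ℕ
  | .var r => Nat.pair 0 r
  | .smul q R => Nat.pair 1 (Nat.pair (Encodable.encode (ratCode q)) R.code)
  | .add R₁ R₂ => Nat.pair 2 (Nat.pair R₁.code R₂.code)
  | .addConst R q => Nat.pair 3 (Nat.pair (Encodable.encode (ratCode q)) R.code)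

/-- Goedel numbers of Boolean expressions. -/
def BExp.code : BExp → ℕ
  | .realReal c R₁ R₂ => Nat.pair 0 (Nat.pair c.code (Nat.pair R₁.code R₂.code))
  | .realDom c R x => Nat.pair 1 (Nat.pair c.code (Nat.pair R.code x))
  | .domDom c x₁ x₂ => Nat.pair 2 (Nat.pair c.code (Nat.pair x₁ x₂))

/-- Goedel numbers of statements. -/
def Stmt.code {D : Finset ℚ} : Stmt D → ℕ
  | .skip => Nat.pair 0 0
  | .assign x d => Nat.pair 1 (Nat.pair x (Encodable.encode (ratCode d)))
  | .gauss r x a => Nat.pair 2 (Nat.pair r (Nat.pair x (Encodable.encode (ratCode a))))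
  | .lap r x a => Nat.pair 3 (Nat.pair r (Nat.pair x (Encodable.encode (ratCode a))))
  | .real r R => Nat.pair 4 (Nat.pair r R.code)
  | .ite B S₁ S₂ => Nat.pair 5 (Nat.pair B.code (Nat.pair S₁.code S₂.code))
  | .seq S₁ S₂ => Nat.pair 6 (Nat.pair S₁.code S₂.code)

/-- A program is presented by its lists of inputs and of outputs and the number of its body. -/
def Program.code {D : Finset ℚ} (P : Program D) : List ℕ × List ℕ × ℕ :=
  (P.inputs.sort (· ≤ ·), P.outputs.sort (· ≤ ·), P.body.code)

/-- A valuation is presented by the list of its variables with their values. -/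
def valCode {D : Finset ℚ} (s : Finset ℕ) (u : s → D) : List (ℕ × (ℤ × ℕ)) :=
  (s.sort (· ≤ ·)).attach.map fun x =>
    (x.1, ratCode (u ⟨x.1, (Finset.mem_sort (· ≤ ·)).1 x.2⟩))

end DiPGauss

namespace DiPGauss

open Encodable

-- The probability of an output is a finite sum over control paths (`Program.prob_eq_sum`). Final
-- states form a set, so two paths ending in the same state are counted once there; but different
-- paths assume some guard and its negation (`paths_pairwise`), so a state reached twice has
-- probability zero and the sum over the list of paths is the same number.
--
-- On one path the guards are comparisons of affine functions of finitely many independent Gaussian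
-- and Laplace variables with zero. At precision `N` each variable's line is cut, out to `N` scales
-- on both sides of the mean, into half-open cells of length one `N`-th of the scale. Each cell gets
-- a rational weight not exceeding its probability (`cellWeight_le_law`): the density at the far
-- end, with `exp` replaced by a power `(1 - x) ^ m` and `1 / √(2π)` by a central binomial
-- coefficient, which lies below it by Wallis' product. Products of cells are boxes. The variation
-- of an affine function over a box is bounded by the sum of its variations along the edges at a
-- corner, so rational arithmetic certifies some boxes as inside the event and others as outside.
-- The weight of the former is a lower bound, and one minus the weight of the latter an upper bound
-- (`PathEnd.bounds`).
--
-- The bounds converge because the total weight tends to one (`tendsto_sum_cells`) and the undecided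
-- boxes become negligible. Indeed an affine function that depends on a sampled variable is almost
-- surely nonzero (`ae_ne_zero`), hence its sign is eventually decided on every small box around the
-- point; one that depends on none is constant there and is decided exactly (`ae_eventually_slack`).
-- Almost everywhere convergence of indicators turns this into convergence of measures
-- (`exists_tendsto_le_sum_weight`).
--
-- The algorithm searches for the first precision at which upper and lower bounds are close enough.
-- The bounds are primitive recursive in the codes and the precision, and the search is partial
-- recursive (`partrec_search`).

attribute [fun_prop] Primrec
attribute [fun_prop] Primrec.id Primrec.const Primrec.comp Primrec.fst Primrec.snd Primrec.pair

/-! ### Primitive recursive operations on naturals, lists, integers and rationals, as `fun_prop`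
rules. -/

section Primrec

variable {α β γ σ : Type*} [Primcodable α] [Primcodable β] [Primcodable γ] [Primcodable σ]

@[fun_prop] theorem primrec_natAdd {f g : α → ℕ} (hf : Primrec f) (hg : Primrec g) :
    Primrec fun a => f a + g a := Primrec.nat_add.comp hf hg

@[fun_prop] theorem primrec_natSub {f g : α → ℕ} (hf : Primrec f) (hg : Primrec g) :
    Primrec fun a => f a - g a := Primrec.nat_sub.comp hf hg

@[fun_prop] theorem primrec_natMul {f g : α → ℕ} (hf : Primrec f) (hg : Primrec g) :
    Primrec fun a => f a * g a := Primrec.nat_mul.comp hf hg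

@[fun_prop] theorem primrec_natDiv {f g : α → ℕ} (hf : Primrec f) (hg : Primrec g) :
    Primrec fun a => f a / g a := Primrec.nat_div.comp hf hg

@[fun_prop] theorem primrec_natPow {f g : α → ℕ} (hf : Primrec f) (hg : Primrec g) :
    Primrec fun a => f a ^ g a :=
  (Primrec₂.unpaired'.1 Nat.Primrec.pow).comp hf hg

@[fun_prop] theorem primrec_unpair {f : α → ℕ} (hf : Primrec f) :
    Primrec fun a => (f a).unpair := Primrec.unpair.comp hf

@[fun_prop] theorem primrec_natPair {f g : α → ℕ} (hf : Primrec f) (hg : Primrec g) :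
    Primrec fun a => Nat.pair (f a) (g a) := Primrec₂.natPair.comp hf hg

@[fun_prop] theorem primrec_decode {f : α → ℕ} (hf : Primrec f) :
    Primrec fun a => (decode (f a) : Option β) := Primrec.decode.comp hf

@[fun_prop] theorem primrec_encode {f : α → β} (hf : Primrec f) :
    Primrec fun a => encode (f a) := Primrec.encode.comp hf

@[fun_prop] theorem primrec_cond {c : α → Bool} {f g : α → σ} (hc : Primrec c) (hf : Primrec f)
    (hg : Primrec g) : Primrec fun a => cond (c a) (f a) (g a) := Primrec.cond hc hf hg

@[fun_prop] theorem primrec_and {f g : α → Bool} (hf : Primrec f) (hg : Primrec g) :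
    Primrec fun a => (f a && g a) := Primrec.and.comp hf hg

@[fun_prop] theorem primrec_or {f g : α → Bool} (hf : Primrec f) (hg : Primrec g) :
    Primrec fun a => (f a || g a) := Primrec.or.comp hf hg

@[fun_prop] theorem primrec_not {f : α → Bool} (hf : Primrec f) :
    Primrec fun a => !f a := Primrec.not.comp hf

@[fun_prop] theorem primrec_decide_natLe {f g : α → ℕ} (hf : Primrec f) (hg : Primrec g) :
    Primrec fun a => decide (f a ≤ g a) :=
  (primrecRel_iff_primrec_decide.1 Primrec.nat_le).comp hf hg

@[fun_prop] theorem primrec_decide_eq [DecidableEq β] {f g : α → β} (hf : Primrec f)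
    (hg : Primrec g) : Primrec fun a => decide (f a = g a) :=
  (primrecRel_iff_primrec_decide.1 Primrec.eq).comp hf hg

@[fun_prop] theorem primrec_some {f : α → β} (hf : Primrec f) :
    Primrec fun a => some (f a) := Primrec.option_some.comp hf

@[fun_prop] theorem primrec_optionBind {f : α → Option β} {g : α → β → Option σ} (hf : Primrec f)
    (hg : Primrec fun p : α × β => g p.1 p.2) : Primrec fun a => (f a).bind (g a) :=
  Primrec.option_bind hf hg

@[fun_prop] theorem primrec_optionMap {f : α → Option β} {g : α → β → σ} (hf : Primrec f)
    (hg : Primrec fun p : α × β => g p.1 p.2) : Primrec fun a => (f a).map (g a) :=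
  Primrec.option_map hf hg

@[fun_prop] theorem primrec_optionGetD {f : α → Option β} {g : α → β} (hf : Primrec f)
    (hg : Primrec g) : Primrec fun a => (f a).getD (g a) :=
  Primrec.option_getD.comp hf hg

@[fun_prop] theorem primrec_optionIsSome {f : α → Option β} (hf : Primrec f) :
    Primrec fun a => (f a).isSome := Primrec.option_isSome.comp hf

@[fun_prop] theorem primrec_cons {f : α → β} {g : α → List β} (hf : Primrec f) (hg : Primrec g) :
    Primrec fun a => f a :: g a := Primrec.list_cons.comp hf hg

@[fun_prop] theorem primrec_append {f g : α → List β} (hf : Primrec f) (hg : Primrec g) :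
    Primrec fun a => f a ++ g a := Primrec.list_append.comp hf hg

@[fun_prop] theorem primrec_range {f : α → ℕ} (hf : Primrec f) :
    Primrec fun a => List.range (f a) := Primrec.list_range.comp hf

@[fun_prop] theorem primrec_length {f : α → List β} (hf : Primrec f) :
    Primrec fun a => (f a).length := Primrec.list_length.comp hf

@[fun_prop] theorem primrec_getD {f : α → List β} {g : α → ℕ} (d : β) (hf : Primrec f)
    (hg : Primrec g) : Primrec fun a => (f a).getD (g a) d := (Primrec.list_getD d).comp hf hg

@[fun_prop] theorem primrec_lookup [DecidableEq β] {f : α → β} {g : α → List (β × γ)}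
    (hf : Primrec f) (hg : Primrec g) : Primrec fun a => (g a).lookup (f a) :=
  Primrec.listLookup.comp hf hg

@[fun_prop] theorem primrec_map {f : α → List β} {g : α → β → σ} (hf : Primrec f)
    (hg : Primrec fun p : α × β => g p.1 p.2) : Primrec fun a => (f a).map (g a) :=
  Primrec.list_map hf hg

@[fun_prop] theorem primrec_flatMap {f : α → List β} {g : α → β → List σ} (hf : Primrec f)
    (hg : Primrec fun p : α × β => g p.1 p.2) : Primrec fun a => (f a).flatMap (g a) :=
  Primrec.list_flatMap hf hg

@[fun_prop] theorem primrec_filterMap {f : α → List β} {g : α → β → Option σ} (hf : Primrec f)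
    (hg : Primrec fun p : α × β => g p.1 p.2) : Primrec fun a => (f a).filterMap (g a) :=
  Primrec.listFilterMap hf hg

@[fun_prop] theorem primrec_foldl {f : α → List β} {g : α → σ} {h : α → σ → β → σ}
    (hf : Primrec f) (hg : Primrec g) (hh : Primrec fun p : α × σ × β => h p.1 p.2.1 p.2.2) :
    Primrec fun a => (f a).foldl (h a) (g a) :=
  Primrec.list_foldl hf hg (h := fun a p => h a p.1 p.2) hh

@[fun_prop] theorem primrec_foldr {f : α → List β} {g : α → σ} {h : α → β → σ → σ}
    (hf : Primrec f) (hg : Primrec g) (hh : Primrec fun p : α × β × σ => h p.1 p.2.1 p.2.2) :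
    Primrec fun a => (f a).foldr (h a) (g a) :=
  Primrec.list_foldr hf hg (h := fun a p => h a p.1 p.2) hh

@[fun_prop] theorem primrec_all {f : α → List β} {g : α → β → Bool} (hf : Primrec f)
    (hg : Primrec fun p : α × β => g p.1 p.2) : Primrec fun a => (f a).all (g a) := by
  have : Primrec fun a => (f a).foldr (fun b r => g a b && r) true := by fun_prop
  refine this.of_eq fun a => ?_
  induction f a with
  | nil => rfl
  | cons b l ih => simp [ih]

@[fun_prop] theorem primrec_any {f : α → List β} {g : α → β → Bool} (hf : Primrec f)
    (hg : Primrec fun p : α × β => g p.1 p.2) : Primrec fun a => (f a).any (g a) := by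
  have : Primrec fun a => (f a).foldr (fun b r => g a b || r) false := by fun_prop
  refine this.of_eq fun a => ?_
  induction f a with
  | nil => rfl
  | cons b l ih => simp [ih]

@[fun_prop] theorem primrec_filter {f : α → List β} {g : α → β → Bool} (hf : Primrec f)
    (hg : Primrec fun p : α × β => g p.1 p.2) : Primrec fun a => (f a).filter (g a) := by
  have : Primrec fun a => (f a).foldr (fun b r => cond (g a b) (b :: r) r) [] := by fun_prop
  refine this.of_eq fun a => ?_
  induction f a with
  | nil => rfl
  | cons b l ih => cases h : g a b <;> simp [ih, h]

@[fun_prop] theorem primrec_factorial {f : α → ℕ} (hf : Primrec f) :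
    Primrec fun a => (f a).factorial := by
  refine Primrec.comp (f := Nat.factorial) ?_ hf
  have : Primrec (Nat.rec 1 fun n r => (n + 1) * r) :=
    Primrec.nat_rec₁ 1 (f := fun n r => (n + 1) * r)
      (Primrec₂.mk (by fun_prop))
  refine this.of_eq fun n => ?_
  induction n with
  | zero => rfl
  | succ n ih => simp [Nat.factorial_succ, ih]

-- The gcd is the greatest common divisor found by bounded search up to the sum of the arguments. If
-- both arguments vanish the bound is `0`, which is also the value of `Nat.gcd 0 0`.
@[fun_prop] theorem primrec_gcd {f g : α → ℕ} (hf : Primrec f) (hg : Primrec g) :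
    Primrec fun a => (f a).gcd (g a) := by
  have hp : PrimrecRel fun (a : α) (k : ℕ) => f a % k = 0 ∧ g a % k = 0 :=
    PrimrecPred.and
      (Primrec.eq.comp (Primrec.nat_mod.comp (hf.comp .fst) .snd) (.const 0))
      (Primrec.eq.comp (Primrec.nat_mod.comp (hg.comp .fst) .snd) (.const 0))
  refine (Primrec.nat_findGreatest (f := fun a => f a + g a) (by fun_prop) hp).of_eq fun a => ?_
  rw [Nat.findGreatest_eq_iff]
  refine ⟨?_, fun _ => ⟨Nat.mod_eq_zero_of_dvd (Nat.gcd_dvd_left _ _),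
    Nat.mod_eq_zero_of_dvd (Nat.gcd_dvd_right _ _)⟩, fun n hn _ h => ?_⟩
  · rcases Nat.eq_zero_or_pos (f a) with h | h
    · simp [h]
    · exact (Nat.gcd_le_left _ h).trans (Nat.le_add_right _ _)
  · have hd := Nat.dvd_gcd (Nat.dvd_of_mod_eq_zero h.1) (Nat.dvd_of_mod_eq_zero h.2)
    rcases Nat.eq_zero_or_pos ((f a).gcd (g a)) with h0 | h0
    · rw [Nat.gcd_eq_zero_iff] at h0
      omega
    · exact absurd (Nat.le_of_dvd h0 hd) (by omega)

/-! ### Integers and rationals -/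

theorem encode_natCast_int (n : ℕ) : encode (n : ℤ) = 2 * n := by
  rfl

theorem encode_negSucc_int (n : ℕ) : encode (Int.negSucc n) = 2 * n + 1 := by
  rfl

-- Nonnegative integers have even codes and negative ones odd codes, so a difference of naturals has
-- an explicit code. Together with `Int.toNat` of a number and of its negative, this reduces integer
-- arithmetic to naturals through positive and negative parts.
@[fun_prop] theorem primrec_intSubNatNat {f g : α → ℕ} (hf : Primrec f) (hg : Primrec g) :
    Primrec fun a => ((f a : ℤ) - (g a : ℤ)) := by
  refine Primrec.encode_iff.1 ?_
  have : Primrec fun a => cond (decide (g a ≤ f a)) (2 * (f a - g a)) (2 * (g a - f a - 1) + 1) := by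
    fun_prop
  refine this.of_eq fun a => ?_
  by_cases h : g a ≤ f a
  · simp only [h, decide_true, cond_true]
    rw [← Nat.cast_sub h, encode_natCast_int]
  · simp only [h, decide_false, cond_false]
    rw [← encode_negSucc_int]
    congr 1
    omega

@[fun_prop] theorem primrec_toNat {f : α → ℤ} (hf : Primrec f) : Primrec fun a => (f a).toNat := by
  have : Primrec fun a => cond (decide (encode (f a) = 2 * (encode (f a) / 2)))
    (encode (f a) / 2) 0 := by fun_prop
  refine this.of_eq fun a => ?_
  cases h : f a with
  | ofNat n =>
    rw [Int.ofNat_eq_natCast, encode_natCast_int]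
    simp
  | negSucc n =>
    rw [encode_negSucc_int]
    have : 2 * n + 1 ≠ 2 * ((2 * n + 1) / 2) := by omega
    simp [this]

@[fun_prop] theorem primrec_toNat_neg {f : α → ℤ} (hf : Primrec f) :
    Primrec fun a => (-f a).toNat := by
  have : Primrec fun a => cond (decide (encode (f a) = 2 * (encode (f a) / 2)))
    0 (encode (f a) / 2 + 1) := by fun_prop
  refine this.of_eq fun a => ?_
  cases h : f a with
  | ofNat n =>
    rw [Int.ofNat_eq_natCast, encode_natCast_int]
    simp
  | negSucc n =>
    rw [encode_negSucc_int]
    have : 2 * n + 1 ≠ 2 * ((2 * n + 1) / 2) := by omega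
    simp only [this, decide_false, cond_false]
    omega

@[fun_prop] theorem primrec_natAbs {f : α → ℤ} (hf : Primrec f) :
    Primrec fun a => (f a).natAbs := by
  have : Primrec fun a => (f a).toNat + (-f a).toNat := by fun_prop
  exact this.of_eq fun a => by omega

@[fun_prop] theorem primrec_intCast {f : α → ℕ} (hf : Primrec f) :
    Primrec fun a => (f a : ℤ) := by
  have : Primrec fun a => ((f a : ℤ) - ((0 : ℕ) : ℤ)) := by fun_prop
  exact this.of_eq fun a => by simp

@[fun_prop] theorem primrec_intAdd {f g : α → ℤ} (hf : Primrec f) (hg : Primrec g) :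
    Primrec fun a => f a + g a := by
  have : Primrec fun a => ((((f a).toNat + (g a).toNat : ℕ) : ℤ) -
    (((-f a).toNat + (-g a).toNat : ℕ) : ℤ)) := by fun_prop
  exact this.of_eq fun a => by omega

@[fun_prop] theorem primrec_intNeg {f : α → ℤ} (hf : Primrec f) :
    Primrec fun a => -f a := by
  have : Primrec fun a => (((-f a).toNat : ℤ) - ((f a).toNat : ℤ)) := by fun_prop
  exact this.of_eq fun a => by omega

@[fun_prop] theorem primrec_intMul {f g : α → ℤ} (hf : Primrec f) (hg : Primrec g) :
    Primrec fun a => f a * g a := by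
  have : Primrec fun a =>
    ((((f a).toNat * (g a).toNat + (-f a).toNat * (-g a).toNat : ℕ) : ℤ) -
    (((-f a).toNat * (g a).toNat + (f a).toNat * (-g a).toNat : ℕ) : ℤ)) := by fun_prop
  refine this.of_eq fun a => ?_
  have h (z : ℤ) : z = z.toNat - (-z).toNat := by omega
  conv_rhs => rw [h (f a), h (g a)]
  push_cast
  ring

@[fun_prop] theorem primrec_decide_intLe {f g : α → ℤ} (hf : Primrec f) (hg : Primrec g) :
    Primrec fun a => decide (f a ≤ g a) := by
  have : Primrec fun a => decide ((f a).toNat + (-g a).toNat ≤ (g a).toNat + (-f a).toNat) := by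
    fun_prop
  exact this.of_eq fun a => decide_eq_decide.2 (by omega)

theorem primrecPred_reduced :
    PrimrecPred fun p : ℤ × ℕ => p.2 ≠ 0 ∧ p.1.natAbs.gcd p.2 = 1 := by
  rw [primrecPred_iff_primrec_decide]
  have : Primrec fun p : ℤ × ℕ => !decide (p.2 = 0) && decide (p.1.natAbs.gcd p.2 = 1) := by
    fun_prop
  exact this.of_eq fun p => by simp

/-- Rationals as reduced fractions. -/
def ratEquiv : ℚ ≃ {p : ℤ × ℕ // p.2 ≠ 0 ∧ p.1.natAbs.gcd p.2 = 1} where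
  toFun q := ⟨ratCode q, q.den_nz, q.reduced⟩
  invFun p := ⟨p.1.1, p.1.2, p.2.1, p.2.2⟩
  left_inv _ := rfl
  right_inv _ := rfl

instance : Primcodable ℚ :=
  letI := Primcodable.subtype primrecPred_reduced
  Primcodable.ofEquiv _ ratEquiv

@[fun_prop] theorem primrec_ratCode {f : α → ℚ} (hf : Primrec f) :
    Primrec fun a => ratCode (f a) := by
  let := Primcodable.subtype primrecPred_reduced
  have h1 : Primrec ratEquiv := Primrec.of_equiv
  have h2 : Primrec fun p : {p : ℤ × ℕ // p.2 ≠ 0 ∧ p.1.natAbs.gcd p.2 = 1} => p.1 :=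
    Primrec.subtype_val (hp := primrecPred_reduced)
  exact h2.comp (h1.comp hf)

@[fun_prop] theorem primrec_num {f : α → ℚ} (hf : Primrec f) : Primrec fun a => (f a).num :=
  Primrec.fst.comp (primrec_ratCode hf)

@[fun_prop] theorem primrec_den {f : α → ℚ} (hf : Primrec f) : Primrec fun a => (f a).den :=
  Primrec.snd.comp (primrec_ratCode hf)

/-- The integer quotient by a positive natural, rounded towards zero. -/
@[fun_prop] theorem primrec_intDiv_natAbs {f : α → ℤ} {g : α → ℕ} (hf : Primrec f)
    (hg : Primrec g) : Primrec fun a => (f a).tdiv (g a : ℤ) := by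
  have : Primrec fun a => (((f a).toNat / g a : ℕ) : ℤ) - (((-f a).toNat / g a : ℕ) : ℤ) := by
    fun_prop
  refine this.of_eq fun a => ?_
  rcases Int.eq_nat_or_neg (f a) with ⟨n, h | h⟩
  · simp [h]
  · simp [h]

@[fun_prop] theorem primrec_ratDiv {f : α → ℤ} {g : α → ℕ} (hf : Primrec f) (hg : Primrec g) :
    Primrec fun a => (f a : ℚ) / (g a : ℚ) := by
  let := Primcodable.subtype primrecPred_reduced
  suffices h : Primrec fun a => ratEquiv ((f a : ℚ) / (g a : ℚ)) by
    exact ((Primrec.of_equiv_symm (e := ratEquiv)).comp h).of_eq fun a => by simp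
  refine (Primrec.subtype_val_iff (hp := primrecPred_reduced)).1 ?_
  -- The reduced fraction is obtained by dividing out the gcd; denominator zero has to give `0 / 1`,
  -- in accordance with division by zero in `ℚ`.
  have : Primrec fun a => cond (decide (g a = 0)) ((0 : ℤ), 1)
    ((f a).tdiv ((f a).natAbs.gcd (g a) : ℕ), g a / (f a).natAbs.gcd (g a)) := by fun_prop
  refine this.of_eq fun a => ?_
  change _ = ratCode _
  by_cases h : g a = 0
  · simp [h, ratCode]
  · have := Rat.normalize_eq (num := f a) h
    rw [show (f a : ℚ) / (g a : ℚ) = Rat.normalize (f a) (g a) h by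
      rw [Rat.normalize_eq_mkRat, Rat.mkRat_eq_div]]
    rw [this]
    simp only [h, decide_false, cond_false, ratCode]
    rw [Prod.mk.injEq]
    refine ⟨?_, rfl⟩
    rw [Int.tdiv_eq_ediv_of_dvd]
    exact Int.ofNat_dvd_left.2 (Nat.gcd_dvd_left _ _)

@[fun_prop] theorem primrec_ratCast {f : α → ℕ} (hf : Primrec f) :
    Primrec fun a => (f a : ℚ) := by
  have : Primrec fun a => (((f a : ℤ) : ℚ) / ((1 : ℕ) : ℚ)) := by fun_prop
  exact this.of_eq fun a => by simp

@[fun_prop] theorem primrec_ratAdd {f g : α → ℚ} (hf : Primrec f) (hg : Primrec g) :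
    Primrec fun a => f a + g a := by
  have : Primrec fun a => (((f a).num * (g a).den + (g a).num * (f a).den : ℤ) : ℚ) /
    (((f a).den * (g a).den : ℕ) : ℚ) := by fun_prop
  refine this.of_eq fun a => ?_
  conv_rhs => rw [← Rat.num_div_den (f a), ← Rat.num_div_den (g a)]
  push_cast
  rw [div_add_div _ _ (by simp) (by simp)]
  ring

@[fun_prop] theorem primrec_ratNeg {f : α → ℚ} (hf : Primrec f) :
    Primrec fun a => -f a := by
  have : Primrec fun a => ((-(f a).num : ℤ) : ℚ) / ((f a).den : ℚ) := by fun_prop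
  refine this.of_eq fun a => ?_
  conv_rhs => rw [← Rat.num_div_den (f a)]
  push_cast
  ring

@[fun_prop] theorem primrec_ratSub {f g : α → ℚ} (hf : Primrec f) (hg : Primrec g) :
    Primrec fun a => f a - g a := by
  have : Primrec fun a => f a + -g a := by fun_prop
  exact this.of_eq fun a => by ring

@[fun_prop] theorem primrec_ratMul {f g : α → ℚ} (hf : Primrec f) (hg : Primrec g) :
    Primrec fun a => f a * g a := by
  have : Primrec fun a => (((f a).num * (g a).num : ℤ) : ℚ) /
    (((f a).den * (g a).den : ℕ) : ℚ) := by fun_prop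
  refine this.of_eq fun a => ?_
  conv_rhs => rw [← Rat.num_div_den (f a), ← Rat.num_div_den (g a)]
  push_cast
  rw [div_mul_div_comm]

@[fun_prop] theorem primrec_ratInv {f : α → ℚ} (hf : Primrec f) :
    Primrec fun a => (f a)⁻¹ := by
  -- Writing the inverse of `n / d` as `n * d / n ^ 2` keeps the sign in the numerator and the
  -- denominator natural, and it gives `0` for `n = 0`.
  have : Primrec fun a => (((f a).num * (f a).den : ℤ) : ℚ) /
    (((f a).num.natAbs * (f a).num.natAbs : ℕ) : ℚ) := by fun_prop
  refine this.of_eq fun a => ?_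
  conv_rhs => rw [← Rat.num_div_den (f a)]
  have h : (((f a).num.natAbs * (f a).num.natAbs : ℕ) : ℚ) = ((f a).num : ℚ) * (f a).num := by
    rw [← Int.cast_mul, ← Int.natAbs_mul_self, Int.cast_natCast]
  rw [h, inv_div]
  push_cast
  by_cases h0 : ((f a).num : ℚ) = 0
  · simp [h0]
  · field_simp

@[fun_prop] theorem primrec_ratDivRat {f g : α → ℚ} (hf : Primrec f) (hg : Primrec g) :
    Primrec fun a => f a / g a := by
  have : Primrec fun a => f a * (g a)⁻¹ := by fun_prop
  exact this.of_eq fun a => by rw [div_eq_mul_inv]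

@[fun_prop] theorem primrec_ratPow {f : α → ℚ} {g : α → ℕ} (hf : Primrec f) (hg : Primrec g) :
    Primrec fun a => f a ^ g a := by
  have : Primrec fun a => (List.range (g a)).foldl (fun r _ => r * f a) 1 := by fun_prop
  refine this.of_eq fun a => ?_
  induction g a with
  | zero => simp
  | succ n ih => simp [List.range_succ, List.foldl_append, ih, pow_succ]

@[fun_prop] theorem primrec_ratAbs {f : α → ℚ} (hf : Primrec f) : Primrec fun a => |f a| := by
  have : Primrec fun a => (((f a).num.natAbs : ℕ) : ℚ) / ((f a).den : ℚ) := by fun_prop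
  refine this.of_eq fun a => ?_
  rw [Rat.abs_def, Rat.divInt_eq_div]
  simp only [Int.cast_natCast]

@[fun_prop] theorem primrec_decide_ratLe {f g : α → ℚ} (hf : Primrec f) (hg : Primrec g) :
    Primrec fun a => decide (f a ≤ g a) := by
  have : Primrec fun a => decide ((f a).num * (g a).den ≤ (g a).num * (f a).den) := by fun_prop
  exact this.of_eq fun a => decide_eq_decide.2 (Rat.le_iff _ _).symm

@[fun_prop] theorem primrec_decide_ratLt {f g : α → ℚ} (hf : Primrec f) (hg : Primrec g) :
    Primrec fun a => decide (f a < g a) := by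
  have : Primrec fun a => !decide (g a ≤ f a) := by fun_prop
  exact this.of_eq fun a => by simp [← not_le]

@[fun_prop] theorem primrec_ratSum {f : α → List ℚ} (hf : Primrec f) :
    Primrec fun a => (f a).sum := by
  have : Primrec fun a => (f a).foldr (fun x r => x + r) 0 := by fun_prop
  exact this.of_eq fun a => by simp [List.sum]

/-! ### Course-of-values recursion -/

/-- The list of the first `n` values of the function defined by course-of-values recursion. -/
def history {α σ : Type*} (g : α → List σ → σ) (a : α) (n : ℕ) : List σ :=
  (List.range n).foldl (fun l _ => l ++ [g a l]) []

/-- Course-of-values recursion: `g` receives the list of the earlier values. -/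
def courseOfValues {α σ : Type*} (g : α → List σ → σ) (a : α) (n : ℕ) : σ := g a (history g a n)

theorem history_eq {α σ : Type*} (g : α → List σ → σ) (a : α) (n : ℕ) :
    history g a n = (List.range n).map (courseOfValues g a) := by
  induction n with
  | zero => rfl
  | succ n ih =>
    rw [List.range_succ, List.map_append, ← ih]
    simp [history, List.range_succ, List.foldl_append, courseOfValues]

theorem courseOfValues_eq {α σ : Type*} (g : α → List σ → σ) (a : α) (n : ℕ) :
    courseOfValues g a n = g a ((List.range n).map (courseOfValues g a)) := by
  rw [← history_eq]; rfl

-- The history is a fold that appends one value at a time, and such folds are primitive recursive.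
@[fun_prop] theorem primrec_courseOfValues {g : α → List σ → σ}
    (hg : Primrec fun p : α × List σ => g p.1 p.2) {f : β → α} {n : β → ℕ} (hf : Primrec f)
    (hn : Primrec n) : Primrec fun b => courseOfValues g (f b) (n b) := by
  have : Primrec fun b => g (f b)
      ((List.range (n b)).foldl (fun l _ => l ++ [g (f b) l]) []) := by
    refine hg.comp (hf.pair (primrec_foldl (by fun_prop) (by fun_prop) ?_))
    refine primrec_append (by fun_prop) (primrec_cons ?_ (by fun_prop))
    exact hg.comp ((hf.comp Primrec.fst).pair (Primrec.fst.comp Primrec.snd))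
  exact this

end Primrec

end DiPGauss

namespace DiPGauss

open Encodable

/-! ### The algorithm -/

def ratOfPair (p : ℤ × ℕ) : ℚ := (p.1 : ℚ) / (p.2 : ℚ)

/-- The rational with a given code. -/
def decodeRat (n : ℕ) : ℚ := ratOfPair ((decode n : Option (ℤ × ℕ)).getD (0, 1))

/-- The value recorded for `r` in an association list, zero by default. -/
def valueAt (v : List (ℕ × ℚ)) (r : ℕ) : ℚ := (v.lookup r).getD 0

/-- The list holds the values for all smaller codes, so its length is the code being evaluated. Its
tag selects the case as in `RExp.code`, and components are looked up in the list. -/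
def evalStep (v : List (ℕ × ℚ)) (l : List ℚ) : ℚ :=
  cond (decide (l.length.unpair.1 = 0)) (valueAt v l.length.unpair.2) <|
  cond (decide (l.length.unpair.1 = 1))
    (decodeRat l.length.unpair.2.unpair.1 * l.getD l.length.unpair.2.unpair.2 0) <|
  cond (decide (l.length.unpair.1 = 2))
    (l.getD l.length.unpair.2.unpair.1 0 + l.getD l.length.unpair.2.unpair.2 0)
    (l.getD l.length.unpair.2.unpair.2 0 + decodeRat l.length.unpair.2.unpair.1)

/-- The value of the real expression with code `n`. -/
def evalCode (v : List (ℕ × ℚ)) (n : ℕ) : ℚ := courseOfValues evalStep v n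

/-- As in `evalStep`, the current code is the length of the list. Conditionals and sequences combine
the paths of their components; any other statement is a single instruction. -/
def pathsStep (_ : Unit) (l : List (List (List ℕ))) : List (List ℕ) :=
  cond (decide (l.length.unpair.1 = 5))
    (((l.getD l.length.unpair.2.unpair.2.unpair.1 []).map fun p =>
        Nat.pair 7 l.length.unpair.2.unpair.1 :: p) ++
      (l.getD l.length.unpair.2.unpair.2.unpair.2 []).map fun p =>
        Nat.pair 8 l.length.unpair.2.unpair.1 :: p) <|
  cond (decide (l.length.unpair.1 = 6))
    ((l.getD l.length.unpair.2.unpair.1 []).flatMap fun p =>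
      (l.getD l.length.unpair.2.unpair.2 []).map fun q => p ++ q)
    [[l.length]]

/-- The control paths of the statement with code `n`, as lists of codes of instructions. The
instructions with tags `7` and `8` assume a Boolean expression and its negation. -/
def pathsCode (n : ℕ) : List (List ℕ) := courseOfValues pathsStep () n

/-- Values of domain variables, and the sampled variables, each with a flag that is true for the
Laplace distribution, the mean and the scale. -/
abbrev SymState := List (ℕ × ℚ) × List (ℕ × Bool × ℚ × ℚ)

/-- A real assignment first deletes an earlier entry of the variable, so each key occurs at most
once among the sampled variables. A sampling whose mean has no value yields no state. -/
def symStep (ε : ℚ) (st : SymState) (i : ℕ) : Option SymState :=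
  cond (decide (i.unpair.1 = 1))
    (some ((i.unpair.2.unpair.1, decodeRat i.unpair.2.unpair.2) :: st.1, st.2)) <|
  cond (decide (i.unpair.1 = 2) || decide (i.unpair.1 = 3))
    ((st.1.lookup i.unpair.2.unpair.2.unpair.1).map fun d =>
      (st.1, (i.unpair.2.unpair.1, decide (i.unpair.1 = 3), d,
        decodeRat i.unpair.2.unpair.2.unpair.2 / ε) ::
          st.2.filter fun e => !decide (e.1 = i.unpair.2.unpair.1))) <|
  cond (decide (i.unpair.1 = 4))
    (some (st.1, st.2.filter fun e => !decide (e.1 = i.unpair.2.unpair.1)))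
    (some st)

def symExec (ε : ℚ) (st : SymState) (path : List ℕ) : Option SymState :=
  path.foldl (fun o i => o.bind fun s => symStep ε s i) (some st)

/-- Sampling resets a variable to its value in `z`, while a dependent variable is evaluated at the
current values. Evaluating along the path replaces the substitution of expressions in the semantics.
-/
def valueStep (z v : List (ℕ × ℚ)) (i : ℕ) : List (ℕ × ℚ) :=
  cond (decide (i.unpair.1 = 2) || decide (i.unpair.1 = 3))
    ((i.unpair.2.unpair.1, valueAt z i.unpair.2.unpair.1) :: v) <|
  cond (decide (i.unpair.1 = 4))
    ((i.unpair.2.unpair.1, evalCode v i.unpair.2.unpair.2) :: v) v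

/-- The values of the real variables at the end of a path, when the sampled variables have the
values `z`. -/
def pathValues (path : List ℕ) (z : List (ℕ × ℚ)) : List (ℕ × ℚ) :=
  path.foldl (valueStep z) z

/-- The difference of the two sides of the comparison with code `B`. -/
def guardValue (α v : List (ℕ × ℚ)) (B : ℕ) : Option ℚ :=
  cond (decide (B.unpair.1 = 0))
    (some (evalCode v B.unpair.2.unpair.2.unpair.1 - evalCode v B.unpair.2.unpair.2.unpair.2)) <|
  cond (decide (B.unpair.1 = 1))
    ((α.lookup B.unpair.2.unpair.2.unpair.2).map fun d =>
      evalCode v B.unpair.2.unpair.2.unpair.1 - d) <|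
  (α.lookup B.unpair.2.unpair.2.unpair.1).bind fun d₁ =>
    (α.lookup B.unpair.2.unpair.2.unpair.2).map fun d₂ => d₁ - d₂

/-- The guards assumed on a path: the code of the comparison symbol, and the code of the Boolean
expression. -/
def pathGuards (path : List ℕ) : List (ℕ × ℕ) :=
  path.filterMap fun i =>
    cond (decide (i.unpair.1 = 7)) (some (i.unpair.2.unpair.2.unpair.1, i.unpair.2)) <|
    -- The codes of comparisons are arranged so that negation is `c ↦ 5 - c`.
    cond (decide (i.unpair.1 = 8)) (some (5 - i.unpair.2.unpair.2.unpair.1, i.unpair.2)) none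

/-- The comparison with code `c` holds for `0` and all numbers at distance at most `s` from `v`. -/
def surely (c : ℕ) (v s : ℚ) : Bool :=
  cond (decide (c = 0)) (decide (v = 0) && decide (s = 0)) <|
  cond (decide (c = 1)) (decide (v + s ≤ 0)) <|
  cond (decide (c = 2)) (decide (v + s < 0)) <|
  cond (decide (c = 3)) (decide (0 ≤ v - s)) <|
  cond (decide (c = 4)) (decide (0 < v - s)) (decide (v + s < 0) || decide (0 < v - s))

/-- A box: for each variable the lower end and the length of an interval. -/
abbrev Box := List (ℕ × ℚ × ℚ)

def corner (b : Box) : List (ℕ × ℚ) := b.map fun e => (e.1, e.2.1)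

/-- The default makes this a total affine function of `z`; whether the comparison is defined is
tested separately. -/
def guardValueD (path : List ℕ) (α : List (ℕ × ℚ)) (B : ℕ) (z : List (ℕ × ℚ)) : ℚ :=
  (guardValue α (pathValues path z) B).getD 0

/-- A bound for the variation of a guard over a box. -/
def guardSlack (path : List ℕ) (α : List (ℕ × ℚ)) (B : ℕ) (b : Box) : ℚ :=
  (b.map fun e => |guardValueD path α B ((e.1, e.2.1 + e.2.2) :: corner b) -
    guardValueD path α B (corner b)|).sum

/-- One certificate for a whole box, from the value at its lower corner and the slack. Here and in
`surelyFalse`, a comparison with an undefined side counts as false. -/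
def surelyTrue (path : List ℕ) (α : List (ℕ × ℚ)) (out : Bool) (b : Box) : Bool :=
  out && (pathGuards path).all fun g =>
    (guardValue α (pathValues path (corner b)) g.2).isSome &&
      surely g.1 (guardValueD path α g.2 (corner b)) (guardSlack path α g.2 b)

def surelyFalse (path : List ℕ) (α : List (ℕ × ℚ)) (out : Bool) (b : Box) : Bool :=
  !out || (pathGuards path).any fun g =>
    !(guardValue α (pathValues path (corner b)) g.2).isSome ||
      surely (5 - g.1) (guardValueD path α g.2 (corner b)) (guardSlack path α g.2 b)

/-- A lower bound for `1 / √(2π)`. -/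
def gaussConst (N : ℕ) : ℚ :=
  -- With `n = 2 * N ^ 2` this is `N * C(2n, n) / 4 ^ n`. Since `C(2n, n) / 4 ^ n` is asymptotic to
  -- `1 / √(π n)` from below and `√(π n) = N * √(2π)`, this choice of `n` avoids irrational factors.
  N * ((4 * N ^ 2).factorial : ℚ) / (((2 * N ^ 2).factorial ^ 2 * 16 ^ N ^ 2 : ℕ) : ℚ)

/-- A lower bound for the probability of the interval from `(j - 1) / N` to `j / N` under the
standard Laplace or Gaussian distribution. -/
def cellWeight (lap : Bool) (N j : ℕ) : ℚ :=
  -- By `(1 - x) ^ m ≤ exp (-m x)`, the powers lie below `exp (-t)` and `exp (-t ^ 2 / 2)` at the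
  -- far end `t = j / N`; the products `m x` are exactly `j / N` and `(j / N) ^ 2 / 2`.
  cond lap (1 / 2 * (1 - 1 / (N ^ 2 : ℕ)) ^ (j * N) / N)
    (gaussConst N * (1 - 1 / (2 * N ^ 3 : ℕ)) ^ (j ^ 2 * N) / N)

/-- Disjoint intervals, given by a weight, the lower end and the length. -/
def cells (N : ℕ) (e : Bool × ℚ × ℚ) : List (ℚ × ℚ × ℚ) :=
  (List.range (N ^ 2)).flatMap fun j =>
    [(cellWeight e.1 N (j + 1), e.2.1 + e.2.2 * j / N, e.2.2 / N),
      (cellWeight e.1 N (j + 1), e.2.1 - e.2.2 * (j + 1 : ℕ) / N, e.2.2 / N)]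

/-- Disjoint boxes with weights. -/
def boxes (N : ℕ) (V : List (ℕ × Bool × ℚ × ℚ)) : List (ℚ × Box) :=
  V.foldr (fun e acc => acc.flatMap fun wb =>
    (cells N e.2).map fun c => (wb.1 * c.1, (e.1, c.2) :: wb.2)) [(1, [])]

def outputMatches (oc α : List (ℕ × ℚ)) : Bool :=
  oc.all fun y => decide (α.lookup y.1 = some y.2)

/-- Bounds for the probability of a path. -/
def pathBounds (N : ℕ) (ε : ℚ) (uc oc : List (ℕ × ℚ)) (path : List ℕ) : ℚ × ℚ :=
  ((symExec ε (uc, []) path).map fun st =>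
    (((boxes N st.2).map fun wb =>
        cond (surelyTrue path st.1 (outputMatches oc st.1) wb.2) wb.1 0).sum,
      1 - ((boxes N st.2).map fun wb =>
        cond (surelyFalse path st.1 (outputMatches oc st.1) wb.2) wb.1 0).sum)).getD (0, 0)

abbrev AlgInput := ℕ × (ℤ × ℕ) × List (ℕ × (ℤ × ℕ)) × List (ℕ × (ℤ × ℕ)) × (List ℕ × List ℕ × ℕ)

def decodeVal (l : List (ℕ × (ℤ × ℕ))) : List (ℕ × ℚ) :=
  l.map fun p => (p.1, ratOfPair p.2)

/-- The bounds of all paths, at precision `N + 1`. -/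
def allPathBounds (a : AlgInput) (N : ℕ) : List (ℚ × ℚ) :=
  (pathsCode a.2.2.2.2.2.2).map
    (pathBounds (N + 1) (ratOfPair a.2.1) (decodeVal a.2.2.1) (decodeVal a.2.2.2.1))

def lowerBound (a : AlgInput) (N : ℕ) : ℚ := ((allPathBounds a N).map fun p => p.1).sum

def upperBound (a : AlgInput) (N : ℕ) : ℚ := ((allPathBounds a N).map fun p => p.2).sum

/-- The bounds are close enough. -/
def accurate (a : AlgInput) (N : ℕ) : Bool :=
  decide (upperBound a N - lowerBound a N ≤ 1 / (2 ^ a.1 : ℕ))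

/-- Search for a precision at which the bounds are close enough. -/
def search (a : AlgInput) : Part ((ℤ × ℕ) × (ℤ × ℕ)) :=
  (Nat.rfind fun N => Part.some (accurate a N)).map fun N =>
    (ratCode (lowerBound a N), ratCode (upperBound a N))

/-! ### The algorithm is computable -/

section Computability

variable {ι : Type*} [Primcodable ι]

@[fun_prop] theorem primrec_ratOfPair {f : ι → ℤ × ℕ} (hf : Primrec f) :
    Primrec fun a => ratOfPair (f a) :=
  primrec_ratDiv (Primrec.fst.comp hf) (Primrec.snd.comp hf)

@[fun_prop] theorem primrec_decodeRat {f : ι → ℕ} (hf : Primrec f) :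
    Primrec fun a => decodeRat (f a) :=
  primrec_ratOfPair (primrec_optionGetD (primrec_decode hf) (.const _))

@[fun_prop] theorem primrec_valueAt {f : ι → List (ℕ × ℚ)} {g : ι → ℕ} (hf : Primrec f)
    (hg : Primrec g) : Primrec fun a => valueAt (f a) (g a) := by
  unfold valueAt; fun_prop

@[fun_prop] theorem primrec_evalCode {f : ι → List (ℕ × ℚ)} {g : ι → ℕ} (hf : Primrec f)
    (hg : Primrec g) : Primrec fun a => evalCode (f a) (g a) := by
  unfold evalCode
  refine primrec_courseOfValues ?_ hf hg
  unfold evalStep; fun_prop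

@[fun_prop] theorem primrec_pathsCode {f : ι → ℕ} (hf : Primrec f) :
    Primrec fun a => pathsCode (f a) := by
  unfold pathsCode
  refine primrec_courseOfValues ?_ (.const _) hf
  unfold pathsStep; fun_prop

@[fun_prop] theorem primrec_symStep {e : ι → ℚ} {s : ι → SymState} {i : ι → ℕ}
    (he : Primrec e) (hs : Primrec s) (hi : Primrec i) :
    Primrec fun a => symStep (e a) (s a) (i a) := by
  unfold symStep
  refine primrec_cond (by fun_prop) (by fun_prop) (primrec_cond (by fun_prop) ?_ (by fun_prop))
  refine primrec_optionMap (by fun_prop) ?_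
  fun_prop

@[fun_prop] theorem primrec_symExec {e : ι → ℚ} {s : ι → SymState} {p : ι → List ℕ}
    (he : Primrec e) (hs : Primrec s) (hp : Primrec p) :
    Primrec fun a => symExec (e a) (s a) (p a) := by
  unfold symExec; fun_prop

@[fun_prop] theorem primrec_pathValues {p : ι → List ℕ} {z : ι → List (ℕ × ℚ)}
    (hp : Primrec p) (hz : Primrec z) : Primrec fun a => pathValues (p a) (z a) := by
  unfold pathValues valueStep; fun_prop

@[fun_prop] theorem primrec_guardValue {f g : ι → List (ℕ × ℚ)} {h : ι → ℕ} (hf : Primrec f)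
    (hg : Primrec g) (hh : Primrec h) : Primrec fun a => guardValue (f a) (g a) (h a) := by
  unfold guardValue; fun_prop

@[fun_prop] theorem primrec_pathGuards {p : ι → List ℕ} (hp : Primrec p) :
    Primrec fun a => pathGuards (p a) := by
  unfold pathGuards; fun_prop

@[fun_prop] theorem primrec_surely {c : ι → ℕ} {v s : ι → ℚ} (hc : Primrec c) (hv : Primrec v)
    (hs : Primrec s) : Primrec fun a => surely (c a) (v a) (s a) := by
  unfold surely; fun_prop

@[fun_prop] theorem primrec_corner {b : ι → Box} (hb : Primrec b) :
    Primrec fun a => corner (b a) := by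
  unfold corner; fun_prop

@[fun_prop] theorem primrec_guardValueD {p : ι → List ℕ} {f : ι → List (ℕ × ℚ)} {g : ι → ℕ}
    {z : ι → List (ℕ × ℚ)} (hp : Primrec p) (hf : Primrec f) (hg : Primrec g) (hz : Primrec z) :
    Primrec fun a => guardValueD (p a) (f a) (g a) (z a) := by
  unfold guardValueD; fun_prop

@[fun_prop] theorem primrec_guardSlack {p : ι → List ℕ} {f : ι → List (ℕ × ℚ)} {g : ι → ℕ}
    {b : ι → Box} (hp : Primrec p) (hf : Primrec f) (hg : Primrec g) (hb : Primrec b) :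
    Primrec fun a => guardSlack (p a) (f a) (g a) (b a) := by
  unfold guardSlack; fun_prop

@[fun_prop] theorem primrec_surelyTrue {p : ι → List ℕ} {f : ι → List (ℕ × ℚ)} {o : ι → Bool}
    {b : ι → Box} (hp : Primrec p) (hf : Primrec f) (ho : Primrec o) (hb : Primrec b) :
    Primrec fun a => surelyTrue (p a) (f a) (o a) (b a) := by
  unfold surelyTrue; fun_prop

@[fun_prop] theorem primrec_surelyFalse {p : ι → List ℕ} {f : ι → List (ℕ × ℚ)} {o : ι → Bool}
    {b : ι → Box} (hp : Primrec p) (hf : Primrec f) (ho : Primrec o) (hb : Primrec b) :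
    Primrec fun a => surelyFalse (p a) (f a) (o a) (b a) := by
  unfold surelyFalse; fun_prop

@[fun_prop] theorem primrec_cells {n : ι → ℕ} {e : ι → Bool × ℚ × ℚ} (hn : Primrec n)
    (he : Primrec e) : Primrec fun a => cells (n a) (e a) := by
  unfold cells cellWeight gaussConst; fun_prop

@[fun_prop] theorem primrec_boxes {n : ι → ℕ} {V : ι → List (ℕ × Bool × ℚ × ℚ)} (hn : Primrec n)
    (hV : Primrec V) : Primrec fun a => boxes (n a) (V a) := by
  unfold boxes; fun_prop

@[fun_prop] theorem primrec_outputMatches {f g : ι → List (ℕ × ℚ)} (hf : Primrec f)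
    (hg : Primrec g) : Primrec fun a => outputMatches (f a) (g a) := by
  unfold outputMatches; fun_prop

@[fun_prop] theorem primrec_pathBounds {n : ι → ℕ} {e : ι → ℚ} {u o : ι → List (ℕ × ℚ)}
    {p : ι → List ℕ} (hn : Primrec n) (he : Primrec e) (hu : Primrec u) (ho : Primrec o)
    (hp : Primrec p) : Primrec fun a => pathBounds (n a) (e a) (u a) (o a) (p a) := by
  unfold pathBounds; fun_prop

@[fun_prop] theorem primrec_decodeVal {l : ι → List (ℕ × (ℤ × ℕ))} (hl : Primrec l) :
    Primrec fun a => decodeVal (l a) := by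
  unfold decodeVal; fun_prop

@[fun_prop] theorem primrec_allPathBounds {a : ι → AlgInput} {n : ι → ℕ} (ha : Primrec a)
    (hn : Primrec n) : Primrec fun i => allPathBounds (a i) (n i) := by
  unfold allPathBounds; fun_prop

@[fun_prop] theorem primrec_lowerBound {a : ι → AlgInput} {n : ι → ℕ} (ha : Primrec a)
    (hn : Primrec n) : Primrec fun i => lowerBound (a i) (n i) := by
  unfold lowerBound; fun_prop

@[fun_prop] theorem primrec_upperBound {a : ι → AlgInput} {n : ι → ℕ} (ha : Primrec a)
    (hn : Primrec n) : Primrec fun i => upperBound (a i) (n i) := by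
  unfold upperBound; fun_prop

@[fun_prop] theorem primrec_accurate {a : ι → AlgInput} {n : ι → ℕ} (ha : Primrec a)
    (hn : Primrec n) : Primrec fun i => accurate (a i) (n i) := by
  unfold accurate; fun_prop

/-- The test and the output are primitive recursive; unbounded minimisation then gives a partial
recursive function. -/
theorem partrec_search : Partrec search := by
  have h1 : Primrec fun p : AlgInput × ℕ => accurate p.1 p.2 :=
    primrec_accurate Primrec.fst Primrec.snd
  have h2 : Primrec fun p : AlgInput × ℕ =>
      (ratCode (lowerBound p.1 p.2), ratCode (upperBound p.1 p.2)) :=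
    (primrec_ratCode (primrec_lowerBound Primrec.fst Primrec.snd)).pair
      (primrec_ratCode (primrec_upperBound Primrec.fst Primrec.snd))
  exact (Partrec.rfind (p := fun a N => Part.some (accurate a N)) h1.to_comp.partrec).map
    h2.to_comp.to₂

end Computability

end DiPGauss

namespace DiPGauss

open MeasureTheory Filter Topology

/-! ### The weights of the cells -/

theorem gaussConst_nonneg (N : ℕ) : 0 ≤ gaussConst N := by
  unfold gaussConst; positivity

/-- Squaring removes the square root and expresses the constant by the partial Wallis product, whose
bounds and limit are known. -/
theorem gaussConst_sq (N : ℕ) :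
    ((gaussConst N : ℚ) : ℝ) ^ 2 = N ^ 2 / ((4 * N ^ 2 + 1) * Real.Wallis.W (2 * N ^ 2)) := by
  rw [Real.Wallis.W_eq_factorial_ratio]
  have h16 : (16 : ℝ) ^ N ^ 2 * (16 : ℝ) ^ N ^ 2 = 2 ^ (4 * (2 * N ^ 2)) := by
    rw [← pow_add, show (16 : ℝ) = 2 ^ 4 by norm_num, ← pow_mul]; congr 1; ring
  unfold gaussConst
  rw [← h16, show 2 * (2 * N ^ 2) = 4 * N ^ 2 by ring]
  push_cast
  have h1 : ((4 * N ^ 2).factorial : ℝ) ≠ 0 := by positivity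
  have h2 : ((2 * N ^ 2).factorial : ℝ) ≠ 0 := by positivity
  field_simp
  ring

theorem gaussConst_le (N : ℕ) : ((gaussConst N : ℚ) : ℝ) ≤ (√(2 * Real.pi))⁻¹ := by
  have hW := Real.Wallis.le_W (2 * N ^ 2)
  have hWpos := Real.Wallis.W_pos (2 * N ^ 2)
  have hpi := Real.pi_pos
  rw [← Real.sqrt_inv]
  refine Real.le_sqrt_of_sq_le ?_
  rw [gaussConst_sq, div_le_iff₀ (by positivity), ← div_eq_inv_mul, le_div_iff₀ (by positivity)]
  push_cast at hW
  have h3 : (0 : ℝ) < 2 * (2 * N ^ 2) + 2 := by positivity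
  rw [div_mul_eq_mul_div, div_le_iff₀ h3] at hW
  have hN : (0 : ℝ) ≤ (N : ℝ) ^ 2 := by positivity
  generalize (N : ℝ) ^ 2 = x at *
  have hx : (0 : ℝ) < 4 * x + 1 := by positivity
  have e1 : (4 * x + 1) * ((4 * x + 1) * Real.pi) ≤
      (4 * x + 1) * (Real.Wallis.W (2 * N ^ 2) * (4 * x + 2) * 2) :=
    mul_le_mul_of_nonneg_left (by nlinarith) hx.le
  -- The lower bound for Wallis' product is strong enough because `4x (4x + 2) ≤ (4x + 1) ^ 2`.
  have e2 : 4 * x * (4 * x + 2) * Real.pi ≤ (4 * x + 1) * ((4 * x + 1) * Real.pi) := by nlinarith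
  have e3 : (4 * x + 2) * (2 * x * Real.pi) ≤
      (4 * x + 2) * ((4 * x + 1) * Real.Wallis.W (2 * N ^ 2)) := by nlinarith
  have := le_of_mul_le_mul_left e3 (by positivity)
  linarith

theorem tendsto_gaussConst :
    Tendsto (fun N => ((gaussConst N : ℚ) : ℝ)) atTop (𝓝 (√(2 * Real.pi))⁻¹) := by
  have hpi := Real.pi_pos
  have h1 : Tendsto (fun N : ℕ => Real.Wallis.W (2 * N ^ 2)) atTop (𝓝 (Real.pi / 2)) := by
    refine Real.Wallis.tendsto_W_nhds_pi_div_two.comp ?_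
    exact tendsto_atTop_mono (fun n => by
      simp only [id]; nlinarith [n.le_mul_self, sq n]) tendsto_id
  have h2 : Tendsto (fun N : ℕ => (N : ℝ) ^ 2 / (4 * N ^ 2 + 1)) atTop (𝓝 (1 / 4)) := by
    have h : Tendsto (fun N : ℕ => 1 / (4 + ((N : ℝ)⁻¹) ^ 2)) atTop (𝓝 (1 / (4 + 0 ^ 2))) :=
      tendsto_const_nhds.div (tendsto_const_nhds.add (tendsto_inv_atTop_nhds_zero_nat.pow 2))
        (by norm_num)
    simp only [zero_pow two_ne_zero, add_zero] at h
    refine h.congr' ?_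
    filter_upwards [eventually_ne_atTop 0] with N hN
    field_simp
  have h3 := (h2.div h1 (by positivity)).sqrt
  rw [show 1 / 4 / (Real.pi / 2) = (2 * Real.pi)⁻¹ by field_simp; norm_num, Real.sqrt_inv] at h3
  refine h3.congr fun N => ?_
  rw [← Real.sqrt_sq (show (0 : ℝ) ≤ (gaussConst N : ℚ) from mod_cast gaussConst_nonneg N),
    gaussConst_sq]
  congr 1
  simp only [Pi.div_apply]
  rw [div_div]

/-- The density at `t ≥ 0` of the standard distributions. -/
noncomputable def stdDensity (lap : Bool) (t : ℝ) : ℝ :=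
  cond lap (1 / 2 * Real.exp (-t)) ((√(2 * Real.pi))⁻¹ * Real.exp (-t ^ 2 / 2))

theorem stdDensity_anti (lap : Bool) {s t : ℝ} (hs : 0 ≤ s) (h : s ≤ t) :
    stdDensity lap t ≤ stdDensity lap s := by
  cases lap
  · simp only [stdDensity, cond_false]
    have : s ^ 2 ≤ t ^ 2 := by gcongr
    gcongr
  · simp only [stdDensity, cond_true]
    gcongr

theorem stdDensity_nonneg (lap : Bool) (t : ℝ) : 0 ≤ stdDensity lap t := by
  cases lap <;> simp only [stdDensity, cond_false, cond_true] <;> positivity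

theorem one_sub_pow_le_exp {x : ℝ} (hx : x ≤ 1) (m : ℕ) :
    (1 - x) ^ m ≤ Real.exp (-(m * x)) := by
  rw [show -(m * x) = (m : ℝ) * (-x) by ring, Real.exp_nat_mul]
  exact pow_le_pow_left₀ (by linarith) (Real.one_sub_le_exp_neg x) m

/-- Taking reciprocals, this is `1 + y ≤ exp y` at `y = x / (1 - x)`. It controls the loss in
replacing the exponential by a power. -/
theorem exp_le_one_sub_pow {x : ℝ} (hx : x < 1) (m : ℕ) :
    Real.exp (-(m * (x / (1 - x)))) ≤ (1 - x) ^ m := by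
  have h1 : 0 < 1 - x := by linarith
  rw [show -(m * (x / (1 - x))) = (m : ℝ) * (-(x / (1 - x))) by ring, Real.exp_nat_mul]
  refine pow_le_pow_left₀ (Real.exp_nonneg _) ?_ m
  rw [Real.exp_neg, inv_le_comm₀ (Real.exp_pos _) h1]
  have := Real.add_one_le_exp (x / (1 - x))
  calc (1 - x)⁻¹ = x / (1 - x) + 1 := by field_simp; ring
    _ ≤ _ := this

theorem cellWeight_nonneg (lap : Bool) {N : ℕ} (hN : 1 ≤ N) (j : ℕ) : 0 ≤ cellWeight lap N j := by
  have h2 : (1 : ℚ) / (N ^ 2 : ℕ) ≤ 1 := by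
    rw [div_le_one (by positivity)]; exact_mod_cast Nat.one_le_pow _ _ hN
  have h3 : (1 : ℚ) / (2 * N ^ 3 : ℕ) ≤ 1 := by
    rw [div_le_one (by positivity)]; exact_mod_cast (by have := Nat.one_le_pow 3 _ hN; omega)
  have := gaussConst_nonneg N
  have h2' := sub_nonneg.2 h2
  have h3' := sub_nonneg.2 h3
  cases lap <;> simp only [cellWeight, cond_false, cond_true] <;> positivity

theorem cellWeight_le (lap : Bool) {N : ℕ} (hN : 1 ≤ N) (j : ℕ) :
    ((cellWeight lap N j : ℚ) : ℝ) ≤ stdDensity lap (j / N) / N := by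
  have hN' : (1 : ℝ) ≤ N := by exact_mod_cast hN
  cases lap
  · simp only [cellWeight, stdDensity, cond_false]
    push_cast
    have h3 : (1 : ℝ) / (2 * N ^ 3) ≤ 1 := by
      rw [div_le_one (by positivity)]; have := one_le_pow₀ hN' (n := 3); linarith
    have := one_sub_pow_le_exp h3 (j ^ 2 * N)
    refine div_le_div_of_nonneg_right (mul_le_mul (gaussConst_le N) (this.trans ?_) ?_ ?_) ?_
    · refine Real.exp_le_exp.2 (le_of_eq ?_)
      push_cast; field_simp
    · exact pow_nonneg (sub_nonneg.2 h3) _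
    · positivity
    · positivity
  · simp only [cellWeight, stdDensity, cond_true]
    push_cast
    have h3 : (1 : ℝ) / (N ^ 2) ≤ 1 := by
      rw [div_le_one (by positivity)]; exact one_le_pow₀ hN'
    have := one_sub_pow_le_exp h3 (j * N)
    refine div_le_div_of_nonneg_right (mul_le_mul le_rfl (this.trans ?_) ?_ ?_) ?_
    · refine Real.exp_le_exp.2 (le_of_eq ?_)
      push_cast; field_simp
    · exact pow_nonneg (sub_nonneg.2 h3) _
    · positivity
    · positivity

/-- The ratio of the constants used by `cellWeight` and `stdDensity`. -/
noncomputable def constRatio (lap : Bool) (N : ℕ) : ℝ :=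
  cond lap 1 ((gaussConst N : ℚ) * √(2 * Real.pi))

theorem tendsto_constRatio (lap : Bool) : Tendsto (constRatio lap) atTop (𝓝 1) := by
  cases lap
  · have := tendsto_gaussConst.mul_const (√(2 * Real.pi))
    rw [inv_mul_cancel₀ (by have := Real.pi_pos; positivity)] at this
    exact this
  · exact tendsto_const_nhds

theorem constRatio_nonneg (lap : Bool) (N : ℕ) : 0 ≤ constRatio lap N := by
  have : (0 : ℝ) ≤ (gaussConst N : ℚ) := mod_cast gaussConst_nonneg N
  cases lap <;> simp only [constRatio, cond_false, cond_true] <;> positivity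

/-- The only losses are in the constant and in the exponent. Replacing `x` by `x / (1 - x)`
increases the exponent by an amount that, for `j ≤ N ^ 2`, is at most `2 / N`; hence the loss is
uniform over all cells. -/
theorem le_cellWeight (lap : Bool) {N : ℕ} (hN : 2 ≤ N) {j : ℕ} (hj : j ≤ N ^ 2) :
    constRatio lap N * Real.exp (-2 / N) * (stdDensity lap (j / N) / N) ≤
      ((cellWeight lap N j : ℚ) : ℝ) := by
  have hN' : (2 : ℝ) ≤ N := by exact_mod_cast hN
  have hj' : (j : ℝ) ≤ N ^ 2 := by exact_mod_cast hj
  have hj0 : (0 : ℝ) ≤ j := by positivity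
  have hg : (0 : ℝ) ≤ (gaussConst N : ℚ) := mod_cast gaussConst_nonneg N
  have hpi := Real.pi_pos
  cases lap
  · have h3 : (1 : ℝ) / (2 * N ^ 3) < 1 := by
      rw [div_lt_one (by positivity)]
      have := one_le_pow₀ (by linarith : (1 : ℝ) ≤ N) (n := 3); linarith
    have key := exp_le_one_sub_pow h3 (j ^ 2 * N)
    simp only [cellWeight, stdDensity, constRatio, cond_false]
    push_cast at key ⊢
    have e : Real.exp (-2 / N) * Real.exp (-(j / N : ℝ) ^ 2 / 2) ≤
        (1 - 1 / (2 * (N : ℝ) ^ 3)) ^ (j ^ 2 * N) := by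
      refine le_trans ?_ key
      rw [← Real.exp_add]
      refine Real.exp_le_exp.2 ?_
      have hpos : (0 : ℝ) < 2 * N ^ 3 - 1 := by
        have := one_le_pow₀ (by linarith : (1 : ℝ) ≤ N) (n := 3); linarith
      have hx : (1 : ℝ) / (2 * N ^ 3) / (1 - 1 / (2 * N ^ 3)) = 1 / (2 * N ^ 3 - 1) := by
        field_simp
      rw [hx]
      have hj2 : (j : ℝ) ^ 2 ≤ (N ^ 2) ^ 2 := by gcongr
      have h4 : (j : ℝ) ^ 2 * N * (1 / (2 * N ^ 3 - 1)) - (j / N : ℝ) ^ 2 / 2 =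
          j ^ 2 * (1 / (2 * N ^ 2 * (2 * N ^ 3 - 1))) := by
        obtain ⟨a, ha⟩ : ∃ a : ℝ, a = 2 * N ^ 3 - 1 := ⟨_, rfl⟩
        have hN3 : (N : ℝ) * N ^ 2 = (a + 1) / 2 := by rw [ha]; ring
        rw [← ha] at hpos ⊢
        field_simp
        linear_combination (2 * j ^ 2 : ℝ) * hN3
      have h5 : (j : ℝ) ^ 2 * (1 / (2 * N ^ 2 * (2 * N ^ 3 - 1))) ≤
          (N ^ 2) ^ 2 * (1 / (2 * N ^ 2 * (2 * N ^ 3 - 1))) := by gcongr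
      have h6 : ((N : ℝ) ^ 2) ^ 2 * (1 / (2 * N ^ 2 * (2 * N ^ 3 - 1))) ≤ 2 / N := by
        rw [mul_one_div, div_le_div_iff₀ (by positivity) (by positivity)]
        nlinarith [pow_pos (by linarith : (0 : ℝ) < N) 5, pow_pos (by linarith : (0 : ℝ) < N) 2,
          one_le_pow₀ (by linarith : (1 : ℝ) ≤ N) (n := 3)]
      rw [neg_div, neg_div]
      linarith
    calc _ = (gaussConst N : ℚ) * (Real.exp (-2 / N) * Real.exp (-(j / N : ℝ) ^ 2 / 2)) / N := by
            field_simp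
      _ ≤ _ := by gcongr
  · have h3 : (1 : ℝ) / (N ^ 2) < 1 := by
      rw [div_lt_one (by positivity)]; nlinarith
    have key := exp_le_one_sub_pow h3 (j * N)
    simp only [cellWeight, stdDensity, constRatio, cond_true]
    push_cast at key ⊢
    have e : Real.exp (-2 / N) * Real.exp (-(j / N : ℝ)) ≤
        (1 - 1 / ((N : ℝ) ^ 2)) ^ (j * N) := by
      refine le_trans ?_ key
      rw [← Real.exp_add]
      refine Real.exp_le_exp.2 ?_
      have hpos : (0 : ℝ) < N ^ 2 - 1 := by nlinarith
      have hx : (1 : ℝ) / (N ^ 2) / (1 - 1 / (N ^ 2)) = 1 / (N ^ 2 - 1) := by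
        field_simp
      rw [hx]
      have h4 : (j : ℝ) * N * (1 / (N ^ 2 - 1)) - (j / N : ℝ) =
          j * (1 / (N * (N ^ 2 - 1))) := by
        field_simp; ring
      have h5 : (j : ℝ) * (1 / (N * (N ^ 2 - 1))) ≤ N ^ 2 * (1 / (N * (N ^ 2 - 1))) := by gcongr
      have h6 : (N : ℝ) ^ 2 * (1 / (N * (N ^ 2 - 1))) ≤ 2 / N := by
        rw [mul_one_div, div_le_div_iff₀ (by positivity) (by positivity)]
        nlinarith [pow_pos (by linarith : (0 : ℝ) < N) 3]
      rw [neg_div]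
      linarith
    calc _ = 1 / 2 * (Real.exp (-2 / N) * Real.exp (-(j / N : ℝ))) / N := by
            field_simp
      _ ≤ _ := by gcongr

end DiPGauss

/-! ### Total weight, disjointness and probability of the cells. -/

namespace DiPGauss

open MeasureTheory Filter Topology

theorem sum_map_range {M : Type*} [AddCommMonoid M] (n : ℕ) (f : ℕ → M) :
    ((List.range n).map f).sum = ∑ i ∈ Finset.range n, f i := by
  induction n with
  | zero => simp
  | succ n ih => simp [List.range_succ, Finset.sum_range_succ, ih]

theorem sum_map_cells {M : Type*} [AddCommMonoid M] (N : ℕ) (e : Bool × ℚ × ℚ)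
    (f : ℚ × ℚ × ℚ → M) :
    ((cells N e).map f).sum = ∑ j ∈ Finset.range (N ^ 2),
      (f (cellWeight e.1 N (j + 1), e.2.1 + e.2.2 * j / N, e.2.2 / N) +
        f (cellWeight e.1 N (j + 1), e.2.1 - e.2.2 * (j + 1 : ℕ) / N, e.2.2 / N)) := by
  rw [← sum_map_range, cells, List.map_flatMap]
  induction List.range (N ^ 2) with
  | nil => simp
  | cons j l ih =>
    rw [List.flatMap_cons, List.sum_append, ih]
    simp only [List.map_cons, List.map_nil, List.sum_cons, List.sum_nil, add_zero]

theorem integral_stdDensity (lap : Bool) :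
    IntegrableOn (stdDensity lap) (Set.Ioi 0) ∧ ∫ t in Set.Ioi (0 : ℝ), stdDensity lap t = 1 / 2 := by
  have hpi := Real.pi_pos
  cases lap
  · have h1 : IntegrableOn (fun x : ℝ => Real.exp (-(1 / 2) * x ^ 2)) (Set.Ioi 0) :=
      (integrable_exp_neg_mul_sq (by norm_num)).integrableOn
    have h2 := integral_gaussian_Ioi (1 / 2)
    have e : stdDensity false = fun t =>
        (√(2 * Real.pi))⁻¹ * Real.exp (-(1 / 2) * t ^ 2) := by
      ext t
      simp only [stdDensity, cond_false]
      congr 2; ring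
    rw [e]
    refine ⟨h1.const_mul _, ?_⟩
    rw [integral_const_mul, h2, show Real.pi / (1 / 2) = 2 * Real.pi by ring]
    field_simp
  · have h1 := integrableOn_exp_neg_Ioi 0
    have h2 := integral_exp_neg_Ioi_zero
    exact ⟨h1.const_mul _, by simp only [stdDensity, cond_true]; rw [integral_const_mul, h2, mul_one]⟩

theorem stdDensity_zero_le (lap : Bool) : stdDensity lap 0 ≤ 1 := by
  cases lap
  · simp only [stdDensity, cond_false]
    have : 1 ≤ √(2 * Real.pi) := by
      rw [Real.one_le_sqrt]; have := Real.pi_gt_three; linarith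
    have := inv_le_one_of_one_le₀ this
    simpa using this
  · simp only [stdDensity, cond_true]
    norm_num

/-- For a decreasing function the sum over left end points dominates the integral. Passing to right
end points loses the term at `0`, which is at most `1 / N`. -/
theorem integral_le_sum_stdDensity (lap : Bool) {N : ℕ} (hN : 1 ≤ N) :
    (∫ t in (0 : ℝ)..N, stdDensity lap t) - 1 / N ≤
      ∑ j ∈ Finset.range (N ^ 2), stdDensity lap ((j + 1 : ℕ) / N) / N := by
  have hN' : (0 : ℝ) < N := by exact_mod_cast hN
  have h := AntitoneOn.integral_le_sum (x₀ := 0) (a := N ^ 2)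
    (f := fun y => stdDensity lap (y / N) / N) (fun x hx y hy hxy => by
      have := stdDensity_anti lap (s := x / N) (t := y / N) (by have := hx.1; positivity)
        (by gcongr)
      simp only
      gcongr)
  rw [intervalIntegral.integral_div, intervalIntegral.integral_comp_div _ hN'.ne'] at h
  simp only [zero_add, zero_div, smul_eq_mul] at h
  rw [mul_div_cancel_left₀ _ hN'.ne', show ((N ^ 2 : ℕ) : ℝ) / N = N by
    push_cast; field_simp] at h
  have h2 := Finset.sum_range_succ' (fun j : ℕ => stdDensity lap (j / N) / N) (N ^ 2)
  rw [Finset.sum_range_succ] at h2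
  have h3 : stdDensity lap ((0 : ℕ) / N) / N ≤ 1 / N := by
    have := stdDensity_zero_le lap
    simp only [Nat.cast_zero, zero_div]
    gcongr
  have h4 : 0 ≤ stdDensity lap ((N ^ 2 : ℕ) / N) / N :=
    div_nonneg (stdDensity_nonneg _ _) hN'.le
  linarith

/-- The weights do not depend on mean and scale. Both half-lines contribute a Riemann sum of the
density, whose integral over a half-line is `1 / 2`; the factors from `le_cellWeight` tend to one.
-/
theorem exists_tendsto_le_sum_cellWeight (lap : Bool) :
    ∃ l : ℕ → ℝ, Tendsto l atTop (𝓝 1) ∧ ∀ μ σ : ℚ, ∀ᶠ N in atTop,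
      l N ≤ ((cells N (lap, μ, σ)).map fun c => ((c.1 : ℚ) : ℝ)).sum := by
  refine ⟨fun N => constRatio lap N * Real.exp (-2 / N) *
    (2 * ((∫ t in (0 : ℝ)..N, stdDensity lap t) - 1 / N)), ?_, fun μ σ => ?_⟩
  · have h1 : Tendsto (fun N : ℕ => Real.exp (-2 / N)) atTop (𝓝 1) := by
      have := (tendsto_const_div_atTop_nhds_zero_nat (-2 : ℝ)).rexp
      rwa [Real.exp_zero] at this
    obtain ⟨hi, hv⟩ := integral_stdDensity lap
    have h2 := intervalIntegral_tendsto_integral_Ioi 0 hi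
      (tendsto_natCast_atTop_atTop (R := ℝ))
    rw [hv] at h2
    have h3 := ((tendsto_constRatio lap).mul h1).mul
      ((h2.sub (tendsto_const_div_atTop_nhds_zero_nat (1 : ℝ))).const_mul 2)
    norm_num at h3
    simpa using h3
  · filter_upwards [eventually_ge_atTop 2] with N hN
    rw [sum_map_cells]
    have h := integral_le_sum_stdDensity lap (N := N) (by omega)
    have hc : 0 ≤ constRatio lap N * Real.exp (-2 / N) :=
      mul_nonneg (constRatio_nonneg _ _) (Real.exp_nonneg _)
    calc _ ≤ constRatio lap N * Real.exp (-2 / N) *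
          (2 * ∑ j ∈ Finset.range (N ^ 2), stdDensity lap ((j + 1 : ℕ) / N) / N) := by gcongr
      _ ≤ _ := by
        rw [Finset.mul_sum, Finset.mul_sum]
        refine Finset.sum_le_sum fun j hj => ?_
        have := le_cellWeight lap hN (j := j + 1) (by simpa using hj)
        linarith

/-- The interval of a cell. -/
def cellSet (c : ℚ × ℚ) : Set ℝ := Set.Ico (c.1 : ℝ) ((c.1 : ℝ) + (c.2 : ℝ))

theorem measurableSet_cellSet (c : ℚ × ℚ) : MeasurableSet (cellSet c) := measurableSet_Ico

/-- Cells are disjoint: in the coordinate `y`, where they have length one and integer ends, the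
floor of `y` identifies the only cell that can contain the point. -/
theorem sum_indicator_cells_le {N : ℕ} (hN : 1 ≤ N) (e : Bool × ℚ × ℚ) (he : 0 < e.2.2) (x : ℝ) :
    ((cells N e).map fun c => (cellSet c.2).indicator (1 : ℝ → ℝ) x).sum ≤ 1 := by
  have hN' : (0 : ℝ) < N := by exact_mod_cast hN
  have he' : (0 : ℝ) < e.2.2 := by exact_mod_cast he
  rw [sum_map_cells]
  set y : ℝ := (x - e.2.1) / e.2.2 * N with hy
  have hx : x = e.2.1 + e.2.2 * y / N := by rw [hy]; field_simp; ring
  have h1 (j : ℕ) : x ∈ cellSet (e.2.1 + e.2.2 * j / N, e.2.2 / N) ↔ ⌊y⌋ = (j : ℤ) := by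
    rw [Int.floor_eq_iff, cellSet, Set.mem_Ico, hx]
    push_cast
    have hp : (0 : ℝ) < e.2.2 / N := by positivity
    rw [show (e.2.1 : ℝ) + e.2.2 * y / N = e.2.1 + e.2.2 / N * y by ring,
      show (e.2.1 : ℝ) + e.2.2 * j / N = e.2.1 + e.2.2 / N * j by ring, add_assoc,
      add_le_add_iff_left, add_lt_add_iff_left, mul_le_mul_iff_right₀ hp,
      show (e.2.2 : ℝ) / N * j + e.2.2 / N = e.2.2 / N * (j + 1) by ring, mul_lt_mul_iff_right₀ hp]
  have h2 (j : ℕ) : x ∈ cellSet (e.2.1 - e.2.2 * (j + 1 : ℕ) / N, e.2.2 / N) ↔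
      ⌊y⌋ = -((j : ℤ) + 1) := by
    rw [Int.floor_eq_iff, cellSet, Set.mem_Ico, hx]
    push_cast
    have hp : (0 : ℝ) < e.2.2 / N := by positivity
    rw [show (e.2.1 : ℝ) + e.2.2 * y / N = e.2.1 + e.2.2 / N * y by ring,
      show (e.2.1 : ℝ) - e.2.2 * (j + 1) / N = e.2.1 + e.2.2 / N * (-(j + 1)) by ring, add_assoc,
      add_le_add_iff_left, add_lt_add_iff_left, mul_le_mul_iff_right₀ hp,
      show (e.2.2 : ℝ) / N * (-(j + 1)) + e.2.2 / N = e.2.2 / N * (-(j + 1) + 1) by ring,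
      mul_lt_mul_iff_right₀ hp]
  -- The `j`-th cell to the right of the mean has floor `j`, the `j`-th one to the left has floor
  -- `-(j + 1)`, so every floor value belongs to exactly one index.
  set k : ℕ := if 0 ≤ ⌊y⌋ then ⌊y⌋.toNat else (-⌊y⌋ - 1).toNat with hk
  have h3 (j : ℕ) : (cellSet (e.2.1 + e.2.2 * j / N, e.2.2 / N)).indicator (1 : ℝ → ℝ) x +
      (cellSet (e.2.1 - e.2.2 * (j + 1 : ℕ) / N, e.2.2 / N)).indicator (1 : ℝ → ℝ) x =
        if k = j then 1 else 0 := by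
    classical
    simp only [Set.indicator_apply, h1, h2, Pi.one_apply]
    by_cases hz : 0 ≤ ⌊y⌋
    · rw [if_pos hz] at hk
      have : ¬ ⌊y⌋ = -((j : ℤ) + 1) := by omega
      rw [if_neg this, add_zero]
      exact if_congr (by omega) rfl rfl
    · rw [if_neg hz] at hk
      have : ¬ ⌊y⌋ = (j : ℤ) := by omega
      rw [if_neg this, zero_add]
      exact if_congr (by omega) rfl rfl
  simp only [h3]
  rw [Finset.sum_ite_eq]
  split_ifs <;> norm_num

/-- The entry of a sampled variable in a symbolic state. -/
def Distr.entry (d : Distr) : Bool × ℚ × ℚ :=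
  (match d.kind with
    | .gaussian => false
    | .laplace => true, d.mean, d.scale.1)

/-- Both families become one rescaled density of the standardised distance from the mean, so the
estimates of the cells treat them together. -/
theorem Distr.law_eq (d : Distr) : d.law = volume.withDensity fun x : ℝ =>
    ENNReal.ofReal (stdDensity d.entry.1 (|x - d.mean| / (d.scale.1 : ℝ)) / (d.scale.1 : ℝ)) := by
  obtain ⟨k, m, b, hb⟩ := d
  have hb' : (0 : ℝ) < b := by exact_mod_cast hb
  cases k
  · have hv : Real.toNNReal ((b : ℝ) ^ 2) ≠ 0 := by
      rw [ne_eq, Real.toNNReal_eq_zero, not_le]; positivity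
    simp only [Distr.law, Distr.entry]
    rw [ProbabilityTheory.gaussianReal_of_var_ne_zero _ hv]
    congr 1
    ext x
    rw [ProbabilityTheory.gaussianPDF, ProbabilityTheory.gaussianPDFReal]
    congr 1
    rw [Real.coe_toNNReal _ (by positivity)]
    simp only [stdDensity, cond_false]
    rw [Real.sqrt_mul (by have := Real.pi_pos; positivity), Real.sqrt_sq hb'.le, div_pow, sq_abs]
    field_simp
  · simp only [Distr.law, Distr.entry, laplaceReal, stdDensity, cond_true]
    congr 1
    ext x
    congr 1
    rw [neg_div]
    field_simp

theorem cellWeight_le_law {N : ℕ} (hN : 1 ≤ N) (d : Distr) {c : ℚ × ℚ × ℚ}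
    (hc : c ∈ cells N d.entry) : ((c.1 : ℚ) : ℝ) ≤ d.law.real (cellSet c.2) := by
  have hN' : (0 : ℝ) < N := by exact_mod_cast hN
  have hs : (0 : ℝ) < d.scale.1 := by exact_mod_cast d.scale.2
  -- On a cell the standardised distance is at most `(j + 1) / N`, so by monotonicity the density is
  -- at least its value there; integrating this constant gives the bound.
  have key (lo : ℝ) (j : ℕ) (h : ∀ x ∈ Set.Ico lo (lo + (d.scale.1 : ℝ) / N),
      |x - d.mean| / (d.scale.1 : ℝ) ≤ ((j + 1 : ℕ) : ℝ) / N) :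
      ((cellWeight d.entry.1 N (j + 1) : ℚ) : ℝ) ≤
        d.law.real (Set.Ico lo (lo + (d.scale.1 : ℝ) / N)) := by
    refine (cellWeight_le _ hN _).trans ?_
    rw [Measure.real, ← ENNReal.ofReal_le_iff_le_toReal (measure_ne_top _ _)]
    rw [Distr.law_eq, withDensity_apply _ measurableSet_Ico]
    calc _ = ∫⁻ x in Set.Ico lo (lo + (d.scale.1 : ℝ) / N), ENNReal.ofReal
          (stdDensity d.entry.1 (((j + 1 : ℕ) : ℝ) / N) / (d.scale.1 : ℝ)) := by
          rw [setLIntegral_const, Real.volume_Ico, ← ENNReal.ofReal_mul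
            (div_nonneg (stdDensity_nonneg _ _) hs.le)]
          congr 1
          field_simp
          ring
      _ ≤ _ := by
          refine setLIntegral_mono' measurableSet_Ico fun x hx => ENNReal.ofReal_le_ofReal ?_
          have := stdDensity_anti d.entry.1 (by positivity) (h x hx)
          gcongr
  simp only [cells, List.mem_flatMap, List.mem_range, List.mem_cons, List.not_mem_nil,
    or_false] at hc
  obtain ⟨j, -, rfl | rfl⟩ := hc
  · have := key ((d.mean : ℝ) + d.scale.1 * j / N) j fun x hx => by
      rw [div_le_div_iff₀ hs hN', abs_of_nonneg (by
        have := hx.1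
        have : (0 : ℝ) ≤ d.scale.1 * j / N := by positivity
        linarith)]
      have := hx.2
      have : x - d.mean < ((j + 1 : ℕ) : ℝ) * d.scale.1 / N := by
        push_cast
        rw [show ((j : ℝ) + 1) * d.scale.1 / N = d.scale.1 * j / N + d.scale.1 / N by ring]
        linarith
      rw [lt_div_iff₀ hN'] at this
      exact this.le
    convert this using 2
    simp [cellSet, Distr.entry]
  · have := key ((d.mean : ℝ) - d.scale.1 * (j + 1 : ℕ) / N) j fun x hx => by
      rw [div_le_div_iff₀ hs hN', abs_of_nonpos (by
        have := hx.2
        have h2 : (0 : ℝ) ≤ d.scale.1 * j / N := by positivity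
        have h3 : (d.scale.1 : ℝ) * (j + 1 : ℕ) / N = d.scale.1 * j / N + d.scale.1 / N := by
          push_cast; ring
        linarith)]
      have := hx.1
      have : -(x - d.mean) ≤ ((j + 1 : ℕ) : ℝ) * d.scale.1 / N := by
        rw [mul_comm (((j + 1 : ℕ) : ℝ))]
        linarith
      rwa [le_div_iff₀ hN'] at this
    convert this using 2
    simp [cellSet, Distr.entry]

end DiPGauss

namespace DiPGauss

/-! ### Control paths -/

/-- The instructions on a control path. -/
inductive Instr (D : Finset ℚ) where
  | skip
  | assign (x : ℕ) (d : D)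
  | sample (k : DistrKind) (r x : ℕ) (a : {a : ℚ // 0 < a})
  | real (r : ℕ) (R : RExp)
  | assume (B : BExp) (b : Bool)

variable {D : Finset ℚ}

/-- The guard that is assumed when the branch `b` of a conditional on `B` is taken. -/
def BExp.branch (B : BExp) (b : Bool) : BExp := cond b B B.neg

def Stmt.paths : Stmt D → List (List (Instr D))
  | .skip => [[.skip]]
  | .assign x d => [[.assign x d]]
  | .gauss r x a => [[.sample .gaussian r x a]]
  | .lap r x a => [[.sample .laplace r x a]]
  | .real r R => [[.real r R]]
  | .ite B S₁ S₂ => (S₁.paths.map fun p => .assume B true :: p) ++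
      S₂.paths.map fun p => .assume B false :: p
  | .seq S₁ S₂ => S₁.paths.flatMap fun p => S₂.paths.map fun q => p ++ q

noncomputable def Instr.run (ε : {ε : ℚ // 0 < ε}) (st : State D) : Instr D → Option (State D)
  | .skip => some st
  | .assign x d => some (st.setDom x d)
  | .sample k r x a =>
      (st.α x).map fun d => st.setReal r (.inl ⟨k, d, ⟨a / ε, div_pos a.2 ε.2⟩⟩)
  | .real r R => some (st.setReal r (.inr (R.subst st.β)))
  | .assume B b => some (st.assume (B.branch b))

noncomputable def runPath (ε : {ε : ℚ // 0 < ε}) : List (Instr D) → State D → Option (State D)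
  | [], st => some st
  | i :: p, st => (i.run ε st).bind (runPath ε p)

theorem runPath_append (ε : {ε : ℚ // 0 < ε}) (p q : List (Instr D)) (st : State D) :
    runPath ε (p ++ q) st = (runPath ε p st).bind (runPath ε q) := by
  induction p generalizing st with
  | nil => rfl
  | cons i p ih =>
    simp only [List.cons_append, runPath, Option.bind_assoc]
    congr 1
    funext s
    exact ih s

theorem mem_finalStates (ε : {ε : ℚ // 0 < ε}) (S : Stmt D) (st τ : State D) :
    τ ∈ S.finalStates ε st ↔ ∃ p ∈ S.paths, runPath ε p st = some τ := by
  induction S generalizing st τ with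
  | skip => simp [Stmt.finalStates, Stmt.paths, runPath, Instr.run, eq_comm]
  | assign x d => simp [Stmt.finalStates, Stmt.paths, runPath, Instr.run, eq_comm]
  | gauss r x a =>
    simp only [Stmt.finalStates, State.sample, Stmt.paths, List.mem_singleton, exists_eq_left,
      runPath, Instr.run]
    cases st.α x <;> simp [eq_comm]
  | lap r x a =>
    simp only [Stmt.finalStates, State.sample, Stmt.paths, List.mem_singleton, exists_eq_left,
      runPath, Instr.run]
    cases st.α x <;> simp [eq_comm]
  | real r R => simp [Stmt.finalStates, Stmt.paths, runPath, Instr.run, eq_comm]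
  | ite B S₁ S₂ ih₁ ih₂ =>
    simp only [Stmt.finalStates, Finset.mem_union, ih₁, ih₂, Stmt.paths, List.mem_append,
      List.mem_map]
    constructor
    · rintro (⟨p, hp, h⟩ | ⟨p, hp, h⟩)
      · exact ⟨_, .inl ⟨p, hp, rfl⟩, h⟩
      · exact ⟨_, .inr ⟨p, hp, rfl⟩, h⟩
    · rintro ⟨_, ⟨p, hp, rfl⟩ | ⟨p, hp, rfl⟩, h⟩
      · exact .inl ⟨p, hp, h⟩
      · exact .inr ⟨p, hp, h⟩
  | seq S₁ S₂ ih₁ ih₂ =>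
    simp only [Stmt.finalStates, Finset.mem_biUnion, ih₁, ih₂, Stmt.paths, List.mem_flatMap,
      List.mem_map]
    constructor
    · rintro ⟨s, ⟨p, hp, h⟩, q, hq, h'⟩
      exact ⟨_, ⟨p, hp, q, hq, rfl⟩, by rw [runPath_append, h]; exact h'⟩
    · rintro ⟨_, ⟨p, hp, q, hq, rfl⟩, h⟩
      rw [runPath_append, Option.bind_eq_some_iff] at h
      obtain ⟨s, hs, h⟩ := h
      exact ⟨s, ⟨p, hp, hs⟩, q, hq, h⟩

/-- The guards assumed on a path. -/
def assumptions (p : List (Instr D)) : List (BExp × Bool) :=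
  p.filterMap fun
    | .assume B b => some (B, b)
    | _ => none

theorem mem_guards {ε : {ε : ℚ // 0 < ε}} {p : List (Instr D)} {st τ : State D}
    (h : runPath ε p st = some τ) (B : BExp) :
    B ∈ τ.G ↔ B ∈ st.G ∨ ∃ g ∈ assumptions p, B = g.1.branch g.2 := by
  induction p generalizing st with
  | nil =>
    cases h
    simp [assumptions]
  | cons i p ih =>
    rw [runPath, Option.bind_eq_some_iff] at h
    obtain ⟨s, hs, h⟩ := h
    rw [ih h]
    cases i with
    | skip => cases hs; simp [assumptions]
    | assign x d => cases hs; simp [assumptions, State.setDom]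
    | sample k r x a =>
      simp only [Instr.run, Option.map_eq_some_iff] at hs
      obtain ⟨d, -, rfl⟩ := hs
      simp [assumptions, State.setReal]
    | real r R => cases hs; simp [assumptions, State.setReal]
    | assume B' b =>
      cases hs
      simp only [State.assume, Finset.mem_insert, assumptions, List.filterMap_cons,
        List.mem_cons, exists_eq_or_imp]
      tauto

theorem guards_mono {ε : {ε : ℚ // 0 < ε}} {p : List (Instr D)} {st τ : State D}
    (h : runPath ε p st = some τ) {B : BExp} (hB : B ∈ st.G) : B ∈ τ.G :=
  (mem_guards h B).2 (.inl hB)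

/-- Different paths make contradictory assumptions. -/
theorem paths_pairwise (ε : {ε : ℚ // 0 < ε}) (S : Stmt D) :
    S.paths.Pairwise fun p q => ∀ st τ τ' : State D, runPath ε p st = some τ →
      runPath ε q st = some τ' → ∃ B, B ∈ τ.G ∧ B.neg ∈ τ'.G := by
  induction S with
  | skip => simp [Stmt.paths]
  | assign x d => simp [Stmt.paths]
  | gauss r x a => simp [Stmt.paths]
  | lap r x a => simp [Stmt.paths]
  | real r R => simp [Stmt.paths]
  | ite B S₁ S₂ ih₁ ih₂ =>
    simp only [Stmt.paths, List.pairwise_append, List.pairwise_map, List.mem_map]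
    refine ⟨ih₁.imp fun h st τ τ' h1 h2 => h (st.assume B) _ _ h1 h2,
      ih₂.imp fun h st τ τ' h1 h2 => h (st.assume B.neg) _ _ h1 h2, ?_⟩
    rintro _ ⟨p, -, rfl⟩ _ ⟨q, -, rfl⟩ st τ τ' h1 h2
    refine ⟨B, guards_mono (st := st.assume B) h1 ?_, guards_mono (st := st.assume B.neg) h2 ?_⟩ <;>
    simp [State.assume]
  | seq S₁ S₂ ih₁ ih₂ =>
    simp only [Stmt.paths, List.pairwise_flatMap, List.pairwise_map, List.mem_map]
    -- With a common first half, both second halves run from the same state. With different first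
    -- halves the contradiction already exists in the intermediate states, and guards are never
    -- removed.
    refine ⟨fun p _ => ih₂.imp fun h st τ τ' h1 h2 => ?_, ih₁.imp fun {p q} h => ?_⟩
    · rw [runPath_append, Option.bind_eq_some_iff] at h1 h2
      obtain ⟨s, hs, h1⟩ := h1
      obtain ⟨s', hs', h2⟩ := h2
      rw [hs] at hs'
      cases hs'
      exact h _ _ _ h1 h2
    · rintro _ ⟨p', -, rfl⟩ _ ⟨q', -, rfl⟩ st τ τ' h1 h2
      rw [runPath_append, Option.bind_eq_some_iff] at h1 h2
      obtain ⟨s, hs, h1⟩ := h1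
      obtain ⟨s', hs', h2⟩ := h2
      obtain ⟨B, hB, hB'⟩ := h _ _ _ hs hs'
      exact ⟨B, guards_mono h1 hB, guards_mono h2 hB'⟩

/-! ### Guards as conditions on differences -/

def BExp.cmp : BExp → Cmp
  | .realReal c _ _ => c
  | .realDom c _ _ => c
  | .domDom c _ _ => c

/-- The difference of the two sides of a comparison. -/
noncomputable def BExp.diff (α : ℕ → Option D) (v : ℕ → ℝ) : BExp → Option ℝ
  | .realReal _ R₁ R₂ => some (R₁.eval v - R₂.eval v)
  | .realDom _ R x => (α x).map fun d : D => R.eval v - ((d : ℚ) : ℝ)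
  | .domDom _ x₁ x₂ => (α x₁).bind fun d₁ : D => (α x₂).map fun d₂ : D => ((d₁ : ℚ) : ℝ) - ((d₂ : ℚ) : ℝ)

/-- The comparison holds. -/
def BExp.Holds (α : ℕ → Option D) (v : ℕ → ℝ) (B : BExp) : Prop :=
  ∃ a, B.diff α v = some a ∧ B.cmp.holds a 0

theorem BExp.diff_branch (α : ℕ → Option D) (v : ℕ → ℝ) (B : BExp) (b : Bool) :
    (B.branch b).diff α v = B.diff α v := by
  cases b <;> cases B <;> rfl

theorem BExp.cmp_branch (B : BExp) (b : Bool) :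
    (B.branch b).cmp = cond b B.cmp B.cmp.neg := by
  cases b <;> cases B <;> rfl

theorem Cmp.holds_sub (c : Cmp) (x y : ℝ) : c.holds (x - y) 0 ↔ c.holds x y := by
  cases c <;> simp [Cmp.holds, sub_eq_zero]

theorem Cmp.holds_neg (c : Cmp) (x y : ℝ) : c.neg.holds x y ↔ ¬ c.holds x y := by
  cases c <;> simp [Cmp.holds, Cmp.neg]

theorem BExp.not_holds_neg {α : ℕ → Option D} {v : ℕ → ℝ} {B : BExp} (h : B.Holds α v) :
    ¬ B.neg.Holds α v := by
  rintro ⟨a, ha, ha'⟩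
  obtain ⟨a', h, h'⟩ := h
  rw [show B.neg = B.branch false from rfl, BExp.diff_branch, h] at ha
  cases ha
  rw [show B.neg = B.branch false from rfl, BExp.cmp_branch] at ha'
  exact (Cmp.holds_neg _ _ _).1 ha' h'

/-- The separate conditions on domain guards and on random guards become one condition on
differences, the form in which the algorithm treats guards. -/
theorem State.evalConst_and_evalRand (τ : State D) (ω : ℕ → ℝ) :
    τ.evalConst ∧ τ.evalRand ω ↔ ∀ B ∈ τ.G, B.Holds τ.α (τ.rand ω) := by
  constructor
  · rintro ⟨hc, hr, hd⟩ B hB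
    cases B with
    | realReal c R₁ R₂ => exact ⟨_, rfl, (Cmp.holds_sub _ _ _).2 (hr _ _ _ hB)⟩
    | realDom c R x =>
      obtain ⟨d, h, h'⟩ := hd _ _ _ hB
      exact ⟨_, by simp [BExp.diff, h], (Cmp.holds_sub _ _ _).2 h'⟩
    | domDom c x₁ x₂ =>
      obtain ⟨d₁, d₂, h₁, h₂, h'⟩ := hc _ _ _ hB
      exact ⟨_, by simp [BExp.diff, h₁, h₂], (Cmp.holds_sub _ _ _).2 h'⟩
  · intro h
    refine ⟨fun c x₁ x₂ hB => ?_, fun c R₁ R₂ hB => ?_, fun c R x hB => ?_⟩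
    · obtain ⟨a, ha, ha'⟩ := h _ hB
      simp only [BExp.diff, Option.bind_eq_some_iff, Option.map_eq_some_iff] at ha
      obtain ⟨d₁, h₁, d₂, h₂, rfl⟩ := ha
      exact ⟨d₁, d₂, h₁, h₂, (Cmp.holds_sub _ _ _).1 ha'⟩
    · obtain ⟨a, ha, ha'⟩ := h _ hB
      cases ha
      exact (Cmp.holds_sub _ _ _).1 ha'
    · obtain ⟨a, ha, ha'⟩ := h _ hB
      simp only [BExp.diff, Option.map_eq_some_iff] at ha
      obtain ⟨d, h₁, rfl⟩ := ha
      exact ⟨d, h₁, (Cmp.holds_sub _ _ _).1 ha'⟩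

theorem State.prob_eq (τ : State D) :
    τ.prob = (MeasureTheory.Measure.infinitePi τ.law).real
      {ω | ∀ B ∈ τ.G, B.Holds τ.α (τ.rand ω)} := by
  simp only [← State.evalConst_and_evalRand, State.prob]
  split_ifs with h <;> simp [h]

theorem State.prob_eq_zero {τ : State D} {B : BExp} (h : B ∈ τ.G) (h' : B.neg ∈ τ.G) :
    τ.prob = 0 := by
  have : {ω : ℕ → ℝ | ∀ B ∈ τ.G, B.Holds τ.α (τ.rand ω)} = ∅ :=
    Set.eq_empty_of_forall_notMem fun ω hω => BExp.not_holds_neg (hω _ h) (hω _ h')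
  rw [State.prob_eq, this, MeasureTheory.measureReal_empty]

/-- Forgetting multiplicities does not change the sum because repeated elements contribute zero. -/
theorem sum_toFinset_of_pairwise {α : Type*} [DecidableEq α] {f : α → ℝ} {l : List α}
    (h : l.Pairwise fun a b => a = b → f a = 0) : ∑ a ∈ l.toFinset, f a = (l.map f).sum := by
  induction l with
  | nil => simp
  | cons a l ih =>
    rw [List.pairwise_cons] at h
    rw [List.toFinset_cons, List.map_cons, List.sum_cons, ← ih h.2]
    by_cases ha : a ∈ l
    · rw [Finset.insert_eq_of_mem (by simpa using ha), h.1 a ha rfl, zero_add]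
    · rw [Finset.sum_insert (by simpa using ha)]

open Classical in
/-- The contribution of a path to the probability of an output. -/
noncomputable def pathProb (ε : {ε : ℚ // 0 < ε}) (P : Program D) (u : P.inputs → D)
    (o : P.outputs → D) (p : List (Instr D)) : ℝ :=
  ((runPath ε p (P.initState u)).map fun τ =>
    if ∀ y : P.outputs, τ.α y = some (o y) then τ.prob else 0).getD 0

open Classical in
theorem Program.prob_eq_sum (P : Program D) (ε : {ε : ℚ // 0 < ε}) (u : P.inputs → D)
    (o : P.outputs → D) : P.prob ε u o = (P.body.paths.map (pathProb ε P u o)).sum := by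
  set f : State D → ℝ := fun τ => if ∀ y : P.outputs, τ.α y = some (o y) then τ.prob else 0
  have h1 : P.body.finalStates ε (P.initState u) =
      (P.body.paths.filterMap fun p => runPath ε p (P.initState u)).toFinset := by
    ext τ
    rw [mem_finalStates, List.mem_toFinset, List.mem_filterMap]
  rw [Program.prob, Program.runs, Finset.sum_filter, h1, sum_toFinset_of_pairwise]
  · induction P.body.paths with
    | nil => simp
    | cons p l ih =>
      rw [List.map_cons, List.sum_cons, ← ih, pathProb, List.filterMap_cons]
      cases runPath ε p (P.initState u) <;> simp
  · rw [List.pairwise_filterMap]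
    -- If two paths end in the same state, its guards contain a comparison and its negation.
    refine (paths_pairwise ε P.body).imp fun {p q} h τ hτ τ' hτ' e => ?_
    subst e
    obtain ⟨B, hB, hB'⟩ := h _ _ _ hτ hτ'
    rw [State.prob_eq_zero hB hB', ite_self]

end DiPGauss

namespace DiPGauss

open MeasureTheory Filter Topology

/-! ### Boxes -/

theorem boxes_cons (N : ℕ) (e : ℕ × Bool × ℚ × ℚ) (V : List (ℕ × Bool × ℚ × ℚ)) :
    boxes N (e :: V) = (boxes N V).flatMap fun wb =>
      (cells N e.2).map fun c => (wb.1 * c.1, (e.1, c.2) :: wb.2) := rfl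

theorem sum_map_flatMap {α β : Type*} (l : List α) (g : α → List β) (f : β → ℝ) :
    ((l.flatMap g).map f).sum = (l.map fun a => ((g a).map f).sum).sum := by
  induction l with
  | nil => simp
  | cons a l ih => simp [ih]

/-- The sum over all boxes of a product over the variables. -/
theorem sum_boxes_eq_prod (N : ℕ) (f : ℚ × Box → ℝ) (g : ℕ → ℚ × ℚ × ℚ → ℝ) (h1 : f (1, []) = 1)
    (hf : ∀ w b r c, f (w * c.1, (r, c.2) :: b) = f (w, b) * g r c)
    (V : List (ℕ × Bool × ℚ × ℚ)) :
    ((boxes N V).map f).sum = (V.map fun e => ((cells N e.2).map (g e.1)).sum).prod := by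
  induction V with
  | nil => simp [boxes, h1]
  | cons e V ih =>
    rw [boxes_cons, sum_map_flatMap, List.map_cons, List.prod_cons, ← ih, mul_comm,
      ← List.sum_map_mul_right]
    congr 1
    refine List.map_congr_left fun wb _ => ?_
    rw [List.map_map, ← List.sum_map_mul_left]
    congr 1
    exact List.map_congr_left fun c _ => hf _ _ _ _

/-- The points whose coordinates lie in the intervals of a box. -/
def boxSet (b : Box) : Set (ℕ → ℝ) := {ω | ∀ e ∈ b, ω e.1 ∈ cellSet e.2}

theorem measurableSet_boxSet (b : Box) : MeasurableSet (boxSet b) := by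
  have : boxSet b = ⋂ e ∈ b, (fun ω : ℕ → ℝ => ω e.1) ⁻¹' cellSet e.2 := by
    ext ω; simp [boxSet]
  rw [this]
  exact MeasurableSet.biInter (List.finite_toSet b).countable fun e _ =>
    measurable_pi_apply e.1 (measurableSet_cellSet _)

theorem indicator_boxSet_cons (r : ℕ) (c : ℚ × ℚ) (b : Box) (ω : ℕ → ℝ) :
    (boxSet ((r, c) :: b)).indicator (1 : (ℕ → ℝ) → ℝ) ω =
      (boxSet b).indicator (1 : (ℕ → ℝ) → ℝ) ω * (cellSet c).indicator (1 : ℝ → ℝ) (ω r) := by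
  classical
  have : ω ∈ boxSet ((r, c) :: b) ↔ ω r ∈ cellSet c ∧ ω ∈ boxSet b := by
    simp [boxSet]
  simp only [Set.indicator_apply, this, Pi.one_apply]
  by_cases h1 : ω r ∈ cellSet c <;> by_cases h2 : ω ∈ boxSet b <;> simp [h1, h2]

/-- The indicator of a box is a product over its variables, so the sum over all boxes factors into
sums over cells, each at most one. -/
theorem sum_indicator_boxes_le {N : ℕ} (hN : 1 ≤ N) {V : List (ℕ × Bool × ℚ × ℚ)}
    (hV : ∀ e ∈ V, 0 < e.2.2.2) (ω : ℕ → ℝ) :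
    ((boxes N V).map fun wb => (boxSet wb.2).indicator (1 : (ℕ → ℝ) → ℝ) ω).sum ≤ 1 := by
  rw [sum_boxes_eq_prod N _ (fun r c => (cellSet c.2).indicator (1 : ℝ → ℝ) (ω r))
    (by simp [boxSet]) (fun w b r c => indicator_boxSet_cons r c.2 b ω)]
  induction V with
  | nil => simp
  | cons e V ih =>
    rw [List.forall_mem_cons] at hV
    rw [List.map_cons, List.prod_cons]
    refine mul_le_one₀ (sum_indicator_cells_le hN e.2 hV.1 _) ?_ (ih hV.2)
    refine List.prod_nonneg fun x hx => ?_
    obtain ⟨e', -, rfl⟩ := List.mem_map.1 hx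
    refine List.sum_nonneg fun x hx => ?_
    obtain ⟨c, -, rfl⟩ := List.mem_map.1 hx
    exact Set.indicator_nonneg (by simp) _

/-- All boxes of one precision have the same variables and side lengths; therefore the slack of an
affine function is the same on all of them. -/
theorem keys_of_mem_boxes {N : ℕ} {V : List (ℕ × Bool × ℚ × ℚ)} {wb : ℚ × Box}
    (h : wb ∈ boxes N V) :
    wb.2.map (fun e => (e.1, e.2.2)) = V.map fun e => (e.1, e.2.2.2 / (N : ℚ)) := by
  induction V generalizing wb with
  | nil =>
    simp only [boxes, List.foldr_nil, List.mem_singleton] at h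
    simp [h]
  | cons e V ih =>
    rw [boxes_cons, List.mem_flatMap] at h
    obtain ⟨wb', hwb', h⟩ := h
    obtain ⟨c, hc, rfl⟩ := List.mem_map.1 h
    simp only [List.map_cons, ih hwb', List.cons.injEq, Prod.mk.injEq, true_and, and_true]
    simp only [cells, List.mem_flatMap, List.mem_range, List.mem_cons, List.not_mem_nil,
      or_false] at hc
    obtain ⟨j, -, rfl | rfl⟩ := hc <;> rfl

/-! ### Boxes under the product measure. -/

variable {ν : ℕ → Measure ℝ} [∀ r, IsProbabilityMeasure (ν r)]

theorem infinitePi_boxSet {b : Box} (hb : (b.map Prod.fst).Nodup) :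
    (Measure.infinitePi ν).real (boxSet b) =
      (b.map fun e => (ν e.1).real (cellSet e.2)).prod := by
  -- A box is written as a product set over its finite set of keys; the factor at `r` collects all
  -- entries with key `r`, of which there is only one.
  have h1 : boxSet b = Set.pi ((b.map Prod.fst).toFinset : Set ℕ)
      fun r => {x | ∀ e ∈ b, e.1 = r → x ∈ cellSet e.2} := by
    ext ω
    simp only [boxSet, Set.mem_ofPred_eq, Set.mem_pi, List.coe_toFinset, List.mem_map]
    exact ⟨fun h r _ e he her => her ▸ h e he, fun h e he => h e.1 ⟨e, he, rfl⟩ e he rfl⟩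
  have hm (r : ℕ) : MeasurableSet {x : ℝ | ∀ e ∈ b, e.1 = r → x ∈ cellSet e.2} := by
    have : {x : ℝ | ∀ e ∈ b, e.1 = r → x ∈ cellSet e.2} =
        ⋂ e ∈ b, ⋂ _ : e.1 = r, cellSet e.2 := by
      ext x; simp
    rw [this]
    exact MeasurableSet.biInter (List.finite_toSet b).countable fun e _ =>
      MeasurableSet.iInter fun _ => measurableSet_cellSet _
  rw [h1, Measure.real, Measure.infinitePi_pi ν fun r _ => hm r, ENNReal.toReal_prod]
  clear h1 hm
  induction b with
  | nil => simp
  | cons e b ih =>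
    rw [List.map_cons, List.nodup_cons] at hb
    rw [List.map_cons, List.toFinset_cons, Finset.prod_insert (by simpa using hb.1), List.map_cons,
      List.prod_cons, ← ih hb.2]
    congr 1
    · rw [Measure.real]
      congr 2
      ext x
      simp only [List.mem_cons, Set.mem_ofPred_eq, forall_eq_or_imp, true_implies, and_iff_left_iff_imp]
      intro _ e' he' h
      exact absurd (List.mem_map.2 ⟨e', he', h⟩) hb.1
    · refine Finset.prod_congr rfl fun r hr => ?_
      have hne : e.1 ≠ r := by
        rintro rfl
        exact hb.1 (by simpa using hr)
      simp [hne]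

/-- The entries of a list of sampled variables describe the laws of the variables. -/
structure Describes (V : List (ℕ × Bool × ℚ × ℚ)) (ν : ℕ → Measure ℝ) : Prop where
  nodup : (V.map Prod.fst).Nodup
  law : ∀ e ∈ V, ∃ d : Distr, e.2 = d.entry ∧ ν e.1 = d.law

theorem Describes.scale_pos {V : List (ℕ × Bool × ℚ × ℚ)} {ν : ℕ → Measure ℝ}
    (h : Describes V ν) : ∀ e ∈ V, 0 < e.2.2.2 := by
  intro e he
  obtain ⟨d, hd, -⟩ := h.law e he
  rw [hd]
  exact d.scale.2

theorem Describes.nodup_box {V : List (ℕ × Bool × ℚ × ℚ)} {ν : ℕ → Measure ℝ}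
    (h : Describes V ν) {N : ℕ} {wb : ℚ × Box} (hwb : wb ∈ boxes N V) :
    (wb.2.map Prod.fst).Nodup := by
  have := congrArg (List.map (Prod.fst : ℕ × ℚ → ℕ)) (keys_of_mem_boxes hwb)
  rw [List.map_map, List.map_map] at this
  exact (show wb.2.map Prod.fst = V.map Prod.fst from this) ▸ h.nodup

theorem weight_nonneg {V : List (ℕ × Bool × ℚ × ℚ)} {N : ℕ} (hN : 1 ≤ N) {wb : ℚ × Box}
    (hwb : wb ∈ boxes N V) : 0 ≤ wb.1 := by
  induction V generalizing wb with
  | nil =>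
    simp only [boxes, List.foldr_nil, List.mem_singleton] at hwb
    simp [hwb]
  | cons e V ih =>
    rw [boxes_cons, List.mem_flatMap] at hwb
    obtain ⟨wb', hwb', h⟩ := hwb
    obtain ⟨c, hc, rfl⟩ := List.mem_map.1 h
    refine mul_nonneg (ih hwb') ?_
    simp only [cells, List.mem_flatMap, List.mem_range, List.mem_cons, List.not_mem_nil,
      or_false] at hc
    obtain ⟨j, -, rfl | rfl⟩ := hc <;> exact cellWeight_nonneg _ hN _

theorem weight_le {V : List (ℕ × Bool × ℚ × ℚ)} (hV : Describes V ν) {N : ℕ} (hN : 1 ≤ N)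
    {wb : ℚ × Box} (hwb : wb ∈ boxes N V) :
    ((wb.1 : ℚ) : ℝ) ≤ (Measure.infinitePi ν).real (boxSet wb.2) := by
  rw [infinitePi_boxSet (hV.nodup_box hwb)]
  replace hV := hV.law
  induction V generalizing wb with
  | nil =>
    simp only [boxes, List.foldr_nil, List.mem_singleton] at hwb
    simp [hwb]
  | cons e V ih =>
    rw [boxes_cons, List.mem_flatMap] at hwb
    obtain ⟨wb', hwb', h⟩ := hwb
    obtain ⟨c, hc, rfl⟩ := List.mem_map.1 h
    rw [List.forall_mem_cons] at hV
    obtain ⟨d, hd, hl⟩ := hV.1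
    rw [hd] at hc
    have h0 := weight_nonneg hN hwb'
    rw [List.map_cons, List.prod_cons, mul_comm wb'.1]
    push_cast
    refine mul_le_mul ?_ (ih hwb' hV.2) (by exact_mod_cast h0) measureReal_nonneg
    rw [hl]
    exact cellWeight_le_law hN d hc

/-- The union of the boxes with a given property. -/
def unionSet (N : ℕ) (V : List (ℕ × Bool × ℚ × ℚ)) (p : Box → Bool) : Set (ℕ → ℝ) :=
  {ω | ∃ wb ∈ boxes N V, p wb.2 = true ∧ ω ∈ boxSet wb.2}

theorem measurableSet_unionSet (N : ℕ) (V : List (ℕ × Bool × ℚ × ℚ)) (p : Box → Bool) :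
    MeasurableSet (unionSet N V p) := by
  have : unionSet N V p = ⋃ wb ∈ boxes N V, ⋃ _ : p wb.2 = true, boxSet wb.2 := by
    ext ω; simp only [unionSet, Set.mem_ofPred_eq, Set.mem_iUnion, exists_prop]
  rw [this]
  exact MeasurableSet.biUnion (List.finite_toSet _).countable fun wb _ =>
    MeasurableSet.iUnion fun _ => measurableSet_boxSet _

theorem integral_sum_map {α β : Type*} [MeasurableSpace β] {μ : Measure β} (l : List α)
    (f : α → β → ℝ) (hf : ∀ a ∈ l, Integrable (f a) μ) :
    Integrable (fun ω => (l.map fun a => f a ω).sum) μ ∧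
      ∫ ω, (l.map fun a => f a ω).sum ∂μ = (l.map fun a => ∫ ω, f a ω ∂μ).sum := by
  induction l with
  | nil => simp
  | cons a l ih =>
    rw [List.forall_mem_cons] at hf
    obtain ⟨h1, h2⟩ := ih hf.2
    simp only [List.map_cons, List.sum_cons]
    exact ⟨hf.1.add h1, by rw [integral_add hf.1 h1, h2]⟩

/-- Weights are bounded by probabilities of boxes, and integrating the sum of the disjoint
indicators bounds the total by the probability of the union. -/
theorem sum_weight_le {V : List (ℕ × Bool × ℚ × ℚ)} (hV : Describes V ν) {N : ℕ} (hN : 1 ≤ N)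
    (p : Box → Bool) :
    ((((boxes N V).map fun wb => cond (p wb.2) wb.1 0).sum : ℚ) : ℝ) ≤
      (Measure.infinitePi ν).real (unionSet N V p) := by
  set μ := Measure.infinitePi ν
  have hi (b : Box) : Integrable (fun ω => cond (p b)
      ((boxSet b).indicator (1 : (ℕ → ℝ) → ℝ) ω) 0) μ := by
    cases p b
    · exact integrable_zero _ _ _
    · exact (integrable_const (1 : ℝ)).indicator (measurableSet_boxSet b)
  have hsum := integral_sum_map (μ := μ) (boxes N V) (fun wb ω => cond (p wb.2)
      ((boxSet wb.2).indicator (1 : (ℕ → ℝ) → ℝ) ω) 0) fun wb _ => hi wb.2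
  calc _ = ((boxes N V).map fun wb => cond (p wb.2) ((wb.1 : ℚ) : ℝ) 0).sum := by
        rw [← Rat.coe_castHom, map_list_sum, List.map_map]
        congr 1
        refine List.map_congr_left fun wb _ => ?_
        cases h : p wb.2 <;> simp [h]
    _ ≤ ((boxes N V).map fun wb => ∫ ω, cond (p wb.2)
          ((boxSet wb.2).indicator (1 : (ℕ → ℝ) → ℝ) ω) 0 ∂μ).sum := by
        refine List.sum_le_sum fun wb hwb => ?_
        cases p wb.2
        · simp
        · simp only [cond_true]
          rw [integral_indicator_one (measurableSet_boxSet _)]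
          exact weight_le hV hN hwb
    _ = _ := hsum.2.symm
    _ ≤ ∫ ω, (unionSet N V p).indicator (1 : (ℕ → ℝ) → ℝ) ω ∂μ := by
        refine integral_mono hsum.1 ((integrable_const (1 : ℝ)).indicator
          (measurableSet_unionSet N V p)) fun ω => ?_
        by_cases hω : ω ∈ unionSet N V p
        · rw [Set.indicator_of_mem hω]
          refine le_trans (List.sum_le_sum fun wb _ => ?_)
            (sum_indicator_boxes_le hN hV.scale_pos ω)
          cases p wb.2
          · exact Set.indicator_nonneg (by simp) _
          · exact le_rfl
        · rw [Set.indicator_of_notMem hω]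
          refine (List.sum_eq_zero fun x hx => ?_).le
          obtain ⟨wb, hwb, rfl⟩ := List.mem_map.1 hx
          cases h : p wb.2
          · rfl
          · exact Set.indicator_of_notMem (fun hb => hω ⟨wb, hwb, h, hb⟩) _
    _ = _ := integral_indicator_one (measurableSet_unionSet N V p)

theorem tendsto_sum_cells (d : Distr) :
    Tendsto (fun N => ((cells N d.entry).map fun c => ((c.1 : ℚ) : ℝ)).sum) atTop (𝓝 1) := by
  obtain ⟨l, hl, hle⟩ := exists_tendsto_le_sum_cellWeight d.entry.1
  refine tendsto_of_tendsto_of_tendsto_of_le_of_le' hl tendsto_const_nhds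
    (hle d.entry.2.1 d.entry.2.2) ?_
  filter_upwards [eventually_ge_atTop 1] with N hN
  have hV : Describes [(0, d.entry)] fun _ => d.law :=
    ⟨by simp, fun e he => ⟨d, by simp at he; simp [he]⟩⟩
  -- The upper bound is the case of a single variable with all boxes selected.
  have h := (sum_weight_le hV hN fun _ => true).trans measureReal_le_one
  have h2 := sum_boxes_eq_prod N (fun wb => ((wb.1 : ℚ) : ℝ)) (fun _ c => ((c.1 : ℚ) : ℝ))
    (by simp) (by simp) [(0, d.entry)]
  simp only [List.map_cons, List.map_nil, List.prod_cons, List.prod_nil, mul_one] at h2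
  rw [← h2]
  refine le_trans (le_of_eq ?_) h
  rw [← Rat.coe_castHom, map_list_sum, List.map_map]
  rfl

/-- If almost every point lies only in boxes with the property `p N` when `N` is large, then the
weights of these boxes sum up to a number close to `1`. -/
theorem exists_tendsto_le_sum_weight {V : List (ℕ × Bool × ℚ × ℚ)} (hV : Describes V ν)
    (p : ℕ → Box → Bool)
    (hp : ∀ᵐ ω ∂Measure.infinitePi ν, ∀ᶠ N in atTop, ∀ wb ∈ boxes N V,
      ω ∈ boxSet wb.2 → p N wb.2 = true) :
    ∃ l : ℕ → ℝ, Tendsto l atTop (𝓝 1) ∧ ∀ᶠ N in atTop,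
      l N ≤ (((boxes N V).map fun wb => cond (p N wb.2) wb.1 0).sum : ℚ) := by
  set μ := Measure.infinitePi ν
  have h1 : Tendsto (fun N => (V.map fun e =>
      ((cells N e.2).map fun c => ((c.1 : ℚ) : ℝ)).sum).prod) atTop (𝓝 1) := by
    have := tendsto_list_prod (f := fun (e : ℕ × Bool × ℚ × ℚ) N =>
      ((cells N e.2).map fun c => ((c.1 : ℚ) : ℝ)).sum) (x := atTop) (a := fun _ => 1) V
      (fun e he => by
        obtain ⟨d, hd, -⟩ := hV.law e he
        simp only [hd]
        exact tendsto_sum_cells d)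
    simpa using this
  -- The indicators of the unions of boxes without the property tend to zero almost everywhere,
  -- hence so do the measures, as the total measure is finite.
  have h2 : Tendsto (fun N => μ.real (unionSet N V fun b => !p N b)) atTop (𝓝 0) := by
    have := tendsto_measure_of_ae_tendsto_indicator_of_isFiniteMeasure (μ := μ) atTop
      (A := ∅) (As := fun N => unionSet N V fun b => !p N b) MeasurableSet.empty
      (fun N => measurableSet_unionSet _ _ _) (by
        filter_upwards [hp] with ω hω
        filter_upwards [hω] with N hN
        simp only [Set.mem_empty_iff_false, iff_false]
        rintro ⟨wb, hwb, h, hb⟩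
        simp [hN wb hwb hb] at h)
    rw [measure_empty] at this
    exact (ENNReal.tendsto_toReal ENNReal.zero_ne_top).comp this
  refine ⟨_, by simpa using h1.sub h2, ?_⟩
  filter_upwards [eventually_ge_atTop 1] with N hN
  have h3 := sum_boxes_eq_prod N (fun wb => ((wb.1 : ℚ) : ℝ)) (fun _ c => ((c.1 : ℚ) : ℝ))
    (by simp) (by simp) V
  rw [← h3]
  -- The total weight tends to one, and the part lost to boxes without the property is at most the
  -- measure of their union.
  have h4 := sum_weight_le hV hN fun b => !p N b
  have h5 : ((boxes N V).map fun wb => ((wb.1 : ℚ) : ℝ)).sum =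
      ((((boxes N V).map fun wb => cond (p N wb.2) wb.1 0).sum : ℚ) : ℝ) +
      ((((boxes N V).map fun wb => cond (!p N wb.2) wb.1 0).sum : ℚ) : ℝ) := by
    rw [← Rat.cast_add, ← List.sum_map_add, ← Rat.coe_castHom, map_list_sum, List.map_map]
    congr 1
    refine List.map_congr_left fun wb _ => ?_
    cases h : p N wb.2 <;> simp [h]
  linarith

end DiPGauss

namespace DiPGauss

open MeasureTheory Filter Topology ProbabilityTheory

/-! ### Affine functions of the sampled variables -/

/-- `A` is the affine function with linear part `L`. -/
def HasLinearPart (A : (ℕ → ℝ) → ℝ) (L : (ℕ → ℝ) →ₗ[ℝ] ℝ) : Prop := ∃ b, ∀ ω, A ω = L ω + b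

def IsAffineFun (A : (ℕ → ℝ) → ℝ) : Prop := ∃ L, HasLinearPart A L

theorem IsAffineFun.const (c : ℝ) : IsAffineFun fun _ => c := ⟨0, c, by simp⟩

theorem IsAffineFun.apply (r : ℕ) : IsAffineFun fun ω => ω r :=
  ⟨LinearMap.proj r, 0, by simp⟩

theorem IsAffineFun.add {A B : (ℕ → ℝ) → ℝ} (hA : IsAffineFun A) (hB : IsAffineFun B) :
    IsAffineFun fun ω => A ω + B ω := by
  obtain ⟨L, b, h⟩ := hA
  obtain ⟨L', b', h'⟩ := hB
  exact ⟨L + L', b + b', fun ω => by simp only [h, h', LinearMap.add_apply]; ring⟩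

theorem IsAffineFun.const_mul {A : (ℕ → ℝ) → ℝ} (q : ℝ) (hA : IsAffineFun A) :
    IsAffineFun fun ω => q * A ω := by
  obtain ⟨L, b, h⟩ := hA
  exact ⟨q • L, q * b, fun ω => by
    simp only [h, LinearMap.smul_apply, smul_eq_mul]; ring⟩

theorem IsAffineFun.sub {A B : (ℕ → ℝ) → ℝ} (hA : IsAffineFun A) (hB : IsAffineFun B) :
    IsAffineFun fun ω => A ω - B ω := by
  have := hA.add (hB.const_mul (-1))
  simpa [← sub_eq_add_neg] using this

theorem IsAffineFun.eval {v : (ℕ → ℝ) → ℕ → ℝ} (hv : ∀ r, IsAffineFun fun ω => v ω r) (R : RExp) :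
    IsAffineFun fun ω => R.eval (v ω) := by
  induction R with
  | var r => exact hv r
  | smul q R ih => exact ih.const_mul _
  | add R₁ R₂ ih₁ ih₂ => exact ih₁.add ih₂
  | addConst R q ih => exact ih.add (.const _)

/-- A linear functional on all sequences need not be determined by its values on unit vectors, but
on points of finite support it is. For this reason the almost sure vanishing of the coordinates that
are not sampled is carried along below. -/
theorem linear_eq_sum (L : (ℕ → ℝ) →ₗ[ℝ] ℝ) {s : Finset ℕ} {ω : ℕ → ℝ} (h : ∀ r, r ∉ s → ω r = 0) :
    L ω = ∑ r ∈ s, ω r * L (Pi.single r 1) := by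
  have : ω = ∑ r ∈ s, ω r • (Pi.single r 1 : ℕ → ℝ) := by
    ext r
    rw [Finset.sum_apply]
    simp only [Pi.smul_apply, Pi.single_apply, smul_eq_mul, mul_ite, mul_one, mul_zero]
    rw [Finset.sum_ite_eq]
    split_ifs with hr
    · rfl
    · exact h r hr
  conv_lhs => rw [this]
  simp

theorem law_singleton (d : Distr) (x : ℝ) : d.law {x} = 0 := by
  rw [Distr.law_eq]
  exact withDensity_absolutelyContinuous _ _ Real.volume_singleton

variable {ν : ℕ → Measure ℝ} [∀ r, IsProbabilityMeasure (ν r)]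

theorem ae_eq_zero_of_dirac {s : Set ℕ} (h : ∀ r ∈ s, ν r = Measure.dirac 0) :
    ∀ᵐ ω ∂Measure.infinitePi ν, ∀ r ∈ s, ω r = 0 := by
  rw [ae_all_iff]
  intro r
  by_cases hr : r ∈ s
  · have h1 : ∀ᵐ x ∂(ν r), x = 0 := by
      rw [h r hr]
      exact (ae_dirac_iff (p := fun x => x = 0) (measurableSet_singleton (0 : ℝ))).2 rfl
    have := (measurePreserving_eval_infinitePi ν r).quasiMeasurePreserving.ae h1
    filter_upwards [this] with ω hω _ using hω
  · exact Eventually.of_forall fun ω h => absurd h hr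

/-- A hyperplane that is not parallel to the axis of a sampled variable has probability zero. -/
theorem ae_ne_zero {V : List (ℕ × Bool × ℚ × ℚ)} (hV : Describes V ν)
    (h0 : ∀ᵐ ω ∂Measure.infinitePi ν, ∀ r ∉ V.map Prod.fst, ω r = 0) {A : (ℕ → ℝ) → ℝ}
    {L : (ℕ → ℝ) →ₗ[ℝ] ℝ} (hA : HasLinearPart A L) {e : ℕ × Bool × ℚ × ℚ} (he : e ∈ V)
    (hL : L (Pi.single e.1 1) ≠ 0) : ∀ᵐ ω ∂Measure.infinitePi ν, A ω ≠ 0 := by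
  obtain ⟨b, hA⟩ := hA
  obtain ⟨d, -, hd⟩ := hV.law e he
  set μ := Measure.infinitePi ν
  set a : ℕ → ℝ := fun r => L (Pi.single r 1)
  set X : ℕ → (ℕ → ℝ) → ℝ := fun r ω => ω r * a r with hX
  have hXm (r : ℕ) : Measurable (X r) := (measurable_pi_apply r).mul_const _
  have hind : iIndepFun X μ := iIndepFun_infinitePi (P := ν) (X := fun r x => x * a r)
    fun r => measurable_id.mul_const _
  set s := (V.map Prod.fst).toFinset.erase e.1
  have hi := hind.indepFun_finsetSum_of_notMem hXm (s := s) (i := e.1) (by simp [s])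
  have hSm : Measurable (∑ j ∈ s, X j) := by
    have := Finset.measurable_sum s fun j _ => hXm j
    simpa only [← Finset.sum_fn] using this
  rw [indepFun_iff_map_prod_eq_prod_map_map hSm.aemeasurable (hXm _).aemeasurable] at hi
  set T : Set (ℝ × ℝ) := {p | p.1 + p.2 + b = 0} with hT
  have hTm : MeasurableSet T :=
    measurableSet_eq_fun ((measurable_fst.add measurable_snd).add_const b) measurable_const
  have hnull : μ.map (fun ω => ((∑ j ∈ s, X j) ω, X e.1 ω)) T = 0 := by
    have : IsProbabilityMeasure (μ.map (X e.1)) :=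
      Measure.isProbabilityMeasure_map (hXm _).aemeasurable
    rw [hi, Measure.measure_prod_null hTm]
    refine Eventually.of_forall fun x => ?_
    have hm : MeasurableSet (Prod.mk x ⁻¹' T) := measurable_prodMk_left hTm
    change μ.map (X e.1) _ = 0
    rw [Measure.map_apply (hXm _) hm]
    -- By independence the other terms may be fixed. Their sum `x` then leaves a single possible
    -- value for this coordinate, and its law has no atoms.
    have hsub : X e.1 ⁻¹' (Prod.mk x ⁻¹' T) ⊆ Function.eval e.1 ⁻¹' {-(x + b) / a e.1} := by
      intro ω hω
      have h1 : x + ω e.1 * a e.1 + b = 0 := hω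
      simp only [Set.mem_preimage, Function.eval, Set.mem_singleton_iff]
      rw [eq_div_iff hL]
      linarith
    refine measure_mono_null hsub ?_
    rw [(measurePreserving_eval_infinitePi ν e.1).measure_preimage
      (measurableSet_singleton _).nullMeasurableSet, hd, law_singleton]
  rw [Measure.map_apply (hSm.prodMk (hXm _)) hTm] at hnull
  have hae : ∀ᵐ ω ∂μ, ω ∉ (fun ω => ((∑ j ∈ s, X j) ω, X e.1 ω)) ⁻¹' T :=
    measure_eq_zero_iff_ae_notMem.1 hnull
  filter_upwards [h0, hae] with ω h1 h2 h3
  refine h2 ?_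
  change (∑ j ∈ s, X j) ω + X e.1 ω + b = 0
  rw [Finset.sum_apply, Finset.sum_erase_add _ _ 
    (List.mem_toFinset.2 (List.mem_map_of_mem he)), ← h3, hA,
    linear_eq_sum L (s := (V.map Prod.fst).toFinset) fun r hr => h1 r (by simpa using hr)]

/-! ### The variation of an affine function over a box -/

theorem valueAt_cons (r r' : ℕ) (x : ℚ) (v : List (ℕ × ℚ)) :
    valueAt ((r, x) :: v) r' = if r' = r then x else valueAt v r' := by
  rw [valueAt, List.lookup_cons]
  by_cases h : r' = r
  · simp [h]
  · have : (r' == r) = false := by simpa using h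
    simp [h, this, valueAt]

theorem valueAt_corner {b : Box} (hb : (b.map Prod.fst).Nodup) {e : ℕ × ℚ × ℚ} (he : e ∈ b) :
    valueAt (corner b) e.1 = e.2.1 := by
  induction b with
  | nil => simp at he
  | cons e' b ih =>
    rw [List.map_cons, List.nodup_cons] at hb
    rw [corner, List.map_cons, valueAt_cons]
    rcases List.mem_cons.1 he with rfl | he'
    · simp
    · rw [if_neg, ← ih hb.2 he']
      · rfl
      · rintro h
        exact hb.1 (h ▸ List.mem_map_of_mem he')

theorem valueAt_corner_of_notMem {b : Box} {r : ℕ} (hr : r ∉ b.map Prod.fst) :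
    valueAt (corner b) r = 0 := by
  induction b with
  | nil => rfl
  | cons e' b ih =>
    rw [List.map_cons, List.mem_cons, not_or] at hr
    rw [corner, List.map_cons, valueAt_cons, if_neg hr.1]
    exact ih hr.2

/-- The rational function `g` computes the real function `A`. -/
def Computes (g : List (ℕ × ℚ) → ℚ) (A : (ℕ → ℝ) → ℝ) : Prop :=
  ∀ z, ((g z : ℚ) : ℝ) = A fun r => ((valueAt z r : ℚ) : ℝ)

/-- The sum of the variations of `g` along the edges of a box. -/
def boxSlack (g : List (ℕ × ℚ) → ℚ) (b : Box) : ℚ :=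
  (b.map fun e => |g ((e.1, e.2.1 + e.2.2) :: corner b) - g (corner b)|).sum

/-- Moving one coordinate along an edge changes an affine function by the side length times the
coefficient. The new pair at the head of the list overrides the entry from the corner. -/
theorem boxSlack_eq {g : List (ℕ × ℚ) → ℚ} {A : (ℕ → ℝ) → ℝ} {L : (ℕ → ℝ) →ₗ[ℝ] ℝ}
    (hg : Computes g A) (hA : HasLinearPart A L) {b : Box} (hb : (b.map Prod.fst).Nodup) :
    ((boxSlack g b : ℚ) : ℝ) =
      (b.map fun e => |((e.2.2 : ℚ) : ℝ)| * |L (Pi.single e.1 1)|).sum := by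
  obtain ⟨b₀, hA⟩ := hA
  rw [boxSlack, ← Rat.coe_castHom, map_list_sum, List.map_map]
  congr 1
  refine List.map_congr_left fun e he => ?_
  simp only [Function.comp_apply, Rat.coe_castHom, Rat.cast_abs, Rat.cast_sub]
  rw [hg, hg, hA, hA, add_sub_add_right_eq_sub, ← map_sub, ← abs_mul, ← smul_eq_mul, ← map_smul]
  congr 2
  ext r
  simp only [Pi.sub_apply, Pi.smul_apply, Pi.single_apply, valueAt_cons]
  by_cases h : r = e.1
  · subst h
    rw [valueAt_corner hb he]
    simp
  · simp [h]

/-- Each coordinate of a point of the box differs from the corner by at most the side length;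
coordinates outside the box vanish on both sides. -/
theorem abs_sub_le_boxSlack {g : List (ℕ × ℚ) → ℚ} {A : (ℕ → ℝ) → ℝ} (hg : Computes g A)
    (hA : IsAffineFun A) {b : Box} (hb : (b.map Prod.fst).Nodup) {ω : ℕ → ℝ} (hω : ω ∈ boxSet b)
    (h0 : ∀ r ∉ b.map Prod.fst, ω r = 0) :
    |A ω - (g (corner b) : ℚ)| ≤ (boxSlack g b : ℚ) := by
  obtain ⟨L, hA⟩ := hA
  rw [boxSlack_eq hg hA hb]
  obtain ⟨b₀, hA⟩ := hA
  rw [hg, hA, hA, add_sub_add_right_eq_sub, ← map_sub,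
    linear_eq_sum L (s := (b.map Prod.fst).toFinset) fun r hr => by
      have hr' : r ∉ b.map Prod.fst := by simpa using hr
      rw [Pi.sub_apply, h0 r hr', valueAt_corner_of_notMem hr']
      simp]
  rw [List.sum_toFinset _ hb, List.map_map]
  have h1 : ∀ e ∈ b, |(ω e.1 - ((valueAt (corner b) e.1 : ℚ) : ℝ)) * L (Pi.single e.1 1)| ≤
      |((e.2.2 : ℚ) : ℝ)| * |L (Pi.single e.1 1)| := by
    intro e he
    obtain ⟨h1, h2⟩ := hω e he
    rw [valueAt_corner hb he, abs_mul]
    refine mul_le_mul_of_nonneg_right ?_ (abs_nonneg _)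
    rw [abs_of_nonneg (by linarith)]
    exact le_trans (by linarith) (le_abs_self _)
  clear hω h0 hb
  generalize valueAt (corner b) = c at h1 ⊢
  induction b with
  | nil => simp
  | cons e b ih =>
    rw [List.forall_mem_cons] at h1
    simp only [List.map_cons, List.sum_cons]
    exact (abs_add_le _ _).trans (add_le_add h1.1 (ih h1.2))

theorem boxSlack_of_mem_boxes {g : List (ℕ × ℚ) → ℚ} {A : (ℕ → ℝ) → ℝ} {L : (ℕ → ℝ) →ₗ[ℝ] ℝ}
    (hg : Computes g A) (hA : HasLinearPart A L) {V : List (ℕ × Bool × ℚ × ℚ)}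
    {κ : ℕ → Measure ℝ} (hV : Describes V κ) {N : ℕ} {wb : ℚ × Box} (hwb : wb ∈ boxes N V) :
    ((boxSlack g wb.2 : ℚ) : ℝ) =
      (V.map fun e => |((e.2.2.2 : ℚ) : ℝ)| * |L (Pi.single e.1 1)|).sum / N := by
  rw [boxSlack_eq hg hA (hV.nodup_box hwb)]
  have h := congrArg (List.map fun p : ℕ × ℚ => |((p.2 : ℚ) : ℝ)| * |L (Pi.single p.1 1)|)
    (keys_of_mem_boxes hwb)
  rw [List.map_map, List.map_map] at h
  change wb.2.map (fun e => |((e.2.2 : ℚ) : ℝ)| * |L (Pi.single e.1 1)|) = _ at h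
  rw [h, div_eq_mul_inv, ← List.sum_map_mul_right]
  congr 1
  refine List.map_congr_left fun e _ => ?_
  simp only [Function.comp_apply]
  push_cast
  rw [abs_div, Nat.abs_cast]
  ring

theorem mem_keys_iff {V : List (ℕ × Bool × ℚ × ℚ)} {N : ℕ} {wb : ℚ × Box}
    (hwb : wb ∈ boxes N V) (r : ℕ) : r ∈ wb.2.map Prod.fst ↔ r ∈ V.map Prod.fst := by
  have := congrArg (List.map (Prod.fst : ℕ × ℚ → ℕ)) (keys_of_mem_boxes hwb)
  rw [List.map_map, List.map_map] at this
  rw [show wb.2.map Prod.fst = V.map Prod.fst from this]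

/-- Almost surely, the sign of an affine function is determined on all small boxes. -/
theorem ae_eventually_slack {g : List (ℕ × ℚ) → ℚ} {A : (ℕ → ℝ) → ℝ} (hg : Computes g A)
    (hA : IsAffineFun A) {V : List (ℕ × Bool × ℚ × ℚ)} (hV : Describes V ν)
    (h0 : ∀ᵐ ω ∂Measure.infinitePi ν, ∀ r ∉ V.map Prod.fst, ω r = 0) :
    ∀ᵐ ω ∂Measure.infinitePi ν, ∀ᶠ N in atTop, ∀ wb ∈ boxes N V, ω ∈ boxSet wb.2 →
      boxSlack g wb.2 = 0 ∨ boxSlack g wb.2 < |g (corner wb.2)| := by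
  obtain ⟨L, hL⟩ := hA
  set C := (V.map fun e => |((e.2.2.2 : ℚ) : ℝ)| * |L (Pi.single e.1 1)|).sum
  -- Either some sampled variable really occurs in the affine function, or all its relevant
  -- coefficients vanish and the slack is exactly zero.
  by_cases hC : ∃ e ∈ V, L (Pi.single e.1 1) ≠ 0
  · obtain ⟨e, he, hne⟩ := hC
    filter_upwards [h0, ae_ne_zero hV h0 hL he hne] with ω h1 h2
    have hlim := tendsto_const_div_atTop_nhds_zero_nat (2 * C)
    filter_upwards [hlim.eventually (gt_mem_nhds (abs_pos.2 h2))] with N hN wb hwb hω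
    right
    have h3 := abs_sub_le_boxSlack hg ⟨L, hL⟩ (hV.nodup_box hwb) hω fun r hr =>
      h1 r fun h => hr ((mem_keys_iff hwb r).2 h)
    have h4 := boxSlack_of_mem_boxes hg hL hV hwb
    -- One `C / N` accounts for the distance of `A ω` from the value at the corner, the other for
    -- the slack that this value has to exceed.
    rw [show 2 * C / N = C / N + C / N by ring, ← h4] at hN
    have h5 := abs_sub_abs_le_abs_sub (A ω) (g (corner wb.2) : ℚ)
    have : ((boxSlack g wb.2 : ℚ) : ℝ) < |((g (corner wb.2) : ℚ) : ℝ)| := by linarith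
    exact_mod_cast this
  · push Not at hC
    refine Eventually.of_forall fun ω => Eventually.of_forall fun N wb hwb _ => .inl ?_
    have h4 := boxSlack_of_mem_boxes hg hL hV hwb
    rw [List.sum_eq_zero (fun x hx => by
      obtain ⟨e, he, rfl⟩ := List.mem_map.1 hx
      simp [hC e he]), zero_div] at h4
    exact_mod_cast h4

/-! ### Decided comparisons -/

theorem surely_holds {c : Cmp} {v s : ℚ} (h : surely c.code v s = true) {x : ℝ}
    (hx : |x - v| ≤ s) : c.holds x 0 := by
  rw [abs_le] at hx
  cases c <;> simp only [surely, Cmp.code, Cmp.holds] at h ⊢ <;> simp at h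
  · obtain ⟨rfl, rfl⟩ := h
    simp only [Rat.cast_zero] at hx
    linarith
  · have : (v : ℝ) + s ≤ 0 := by exact_mod_cast h
    linarith
  · have : (v : ℝ) + s < 0 := by exact_mod_cast h
    linarith
  · have : (s : ℝ) ≤ v := by exact_mod_cast h
    linarith
  · have : (s : ℝ) < v := by exact_mod_cast h
    linarith
  · rcases h with h | h
    · have : (v : ℝ) + s < 0 := by exact_mod_cast h
      exact (by linarith : x < 0).ne
    · have : (s : ℝ) < v := by exact_mod_cast h
      exact (by linarith : 0 < x).ne'

theorem Cmp.code_neg (c : Cmp) : c.neg.code = 5 - c.code := by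
  cases c <;> rfl

/-- With zero slack the value is exact and every comparison is decided. Otherwise the sign is
constant and nonzero on the box, which also decides equality and inequality. -/
theorem surely_or_surely_neg (c : Cmp) {v s : ℚ} (h : s = 0 ∨ s < |v|) :
    surely c.code v s = true ∨ surely c.neg.code v s = true := by
  have h' : s = 0 ∨ s < v ∨ v + s < 0 := by
    rcases h with h | h
    · exact .inl h
    · rw [lt_abs] at h
      rcases h with h | h
      · exact .inr (.inl h)
      · exact .inr (.inr (by linarith))
  rcases h' with rfl | h' | h'
  · cases c <;> simp [surely, Cmp.code, Cmp.neg] <;> grind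
  · by_cases hs : s = 0
    · subst hs
      cases c <;> simp [surely, Cmp.code, Cmp.neg] <;> grind
    · cases c <;> simp [surely, Cmp.code, Cmp.neg] <;> grind
  · cases c <;> simp [surely, Cmp.code, Cmp.neg] <;> grind

end DiPGauss

namespace DiPGauss

open MeasureTheory Filter Topology Encodable

/-! ### Codes -/

variable {D : Finset ℚ}

theorem ratOfPair_ratCode (q : ℚ) : ratOfPair (ratCode q) = q := by
  simp [ratOfPair, ratCode, Rat.num_div_den]

theorem decodeRat_encode (q : ℚ) : decodeRat (encode (ratCode q)) = q := by
  rw [decodeRat, encodek]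
  exact ratOfPair_ratCode q

/-- Components of a composite expression or statement have smaller codes because its tag is
positive; this justifies the lookups in course-of-values recursion. -/
theorem lt_pair {t m : ℕ} (ht : 0 < t) : m < Nat.pair t m := by
  have := Nat.add_le_pair t m
  omega

theorem getD_map_range {σ : Type*} (f : ℕ → σ) {i n : ℕ} (h : i < n) (d : σ) :
    ((List.range n).map f).getD i d = f i := by
  simp [List.getD, h]

theorem evalCode_var (v : List (ℕ × ℚ)) (r : ℕ) : evalCode v (Nat.pair 0 r) = valueAt v r := by
  rw [evalCode, courseOfValues_eq]
  simp [evalStep]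

theorem evalCode_smul (v : List (ℕ × ℚ)) (q R : ℕ) :
    evalCode v (Nat.pair 1 (Nat.pair q R)) = decodeRat q * evalCode v R := by
  rw [evalCode, courseOfValues_eq, evalStep]
  simp only [List.length_map, List.length_range, Nat.unpair_pair]
  rw [getD_map_range _ ((Nat.right_le_pair q R).trans_lt (lt_pair one_pos))]
  rfl

theorem evalCode_add (v : List (ℕ × ℚ)) (R₁ R₂ : ℕ) :
    evalCode v (Nat.pair 2 (Nat.pair R₁ R₂)) = evalCode v R₁ + evalCode v R₂ := by
  rw [evalCode, courseOfValues_eq, evalStep]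
  simp only [List.length_map, List.length_range, Nat.unpair_pair]
  rw [getD_map_range _ ((Nat.right_le_pair R₁ R₂).trans_lt (lt_pair two_pos)),
    getD_map_range _ ((Nat.left_le_pair R₁ R₂).trans_lt (lt_pair two_pos))]
  rfl

theorem evalCode_addConst (v : List (ℕ × ℚ)) (q R : ℕ) :
    evalCode v (Nat.pair 3 (Nat.pair q R)) = evalCode v R + decodeRat q := by
  rw [evalCode, courseOfValues_eq, evalStep]
  simp only [List.length_map, List.length_range, Nat.unpair_pair]
  rw [getD_map_range _ ((Nat.right_le_pair q R).trans_lt (lt_pair three_pos))]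
  rfl

theorem cast_evalCode {v : List (ℕ × ℚ)} {w : ℕ → ℝ} (h : ∀ r, ((valueAt v r : ℚ) : ℝ) = w r)
    (R : RExp) : ((evalCode v R.code : ℚ) : ℝ) = R.eval w := by
  induction R with
  | var r => rw [RExp.code, evalCode_var, h, RExp.eval]
  | smul q R ih => rw [RExp.code, evalCode_smul, decodeRat_encode, Rat.cast_mul, ih, RExp.eval]
  | add R₁ R₂ ih₁ ih₂ => rw [RExp.code, evalCode_add, Rat.cast_add, ih₁, ih₂, RExp.eval]
  | addConst R q ih =>
    rw [RExp.code, evalCode_addConst, decodeRat_encode, Rat.cast_add, ih, RExp.eval]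

def Instr.code : Instr D → ℕ
  | .skip => Nat.pair 0 0
  | .assign x d => Nat.pair 1 (Nat.pair x (encode (ratCode d)))
  | .sample .gaussian r x a => Nat.pair 2 (Nat.pair r (Nat.pair x (encode (ratCode a))))
  | .sample .laplace r x a => Nat.pair 3 (Nat.pair r (Nat.pair x (encode (ratCode a))))
  | .real r R => Nat.pair 4 (Nat.pair r R.code)
  | .assume B b => Nat.pair (cond b 7 8) B.code

theorem pathsCode_atom {t m : ℕ} (h5 : t ≠ 5) (h6 : t ≠ 6) :
    pathsCode (Nat.pair t m) = [[Nat.pair t m]] := by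
  rw [pathsCode, courseOfValues_eq, pathsStep]
  simp [h5, h6]

theorem pathsCode_ite (B S₁ S₂ : ℕ) :
    pathsCode (Nat.pair 5 (Nat.pair B (Nat.pair S₁ S₂))) =
      (pathsCode S₁).map (fun p => Nat.pair 7 B :: p) ++
        (pathsCode S₂).map fun p => Nat.pair 8 B :: p := by
  rw [pathsCode, courseOfValues_eq, pathsStep]
  simp only [List.length_map, List.length_range, Nat.unpair_pair]
  rw [getD_map_range _ ((Nat.left_le_pair S₁ S₂).trans_lt
      ((Nat.right_le_pair B _).trans_lt (lt_pair (by norm_num)))),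
    getD_map_range _ ((Nat.right_le_pair S₁ S₂).trans_lt
      ((Nat.right_le_pair B _).trans_lt (lt_pair (by norm_num))))]
  rfl

theorem pathsCode_seq (S₁ S₂ : ℕ) :
    pathsCode (Nat.pair 6 (Nat.pair S₁ S₂)) =
      (pathsCode S₁).flatMap fun p => (pathsCode S₂).map fun q => p ++ q := by
  rw [pathsCode, courseOfValues_eq, pathsStep]
  simp only [List.length_map, List.length_range, Nat.unpair_pair]
  rw [getD_map_range _ ((Nat.left_le_pair S₁ S₂).trans_lt (lt_pair (by norm_num))),
    getD_map_range _ ((Nat.right_le_pair S₁ S₂).trans_lt (lt_pair (by norm_num)))]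
  rfl

theorem pathsCode_code (S : Stmt D) : pathsCode S.code = S.paths.map (List.map Instr.code) := by
  induction S with
  | skip => exact pathsCode_atom (by norm_num) (by norm_num)
  | assign x d => exact pathsCode_atom (by norm_num) (by norm_num)
  | gauss r x a => exact pathsCode_atom (by norm_num) (by norm_num)
  | lap r x a => exact pathsCode_atom (by norm_num) (by norm_num)
  | real r R => exact pathsCode_atom (by norm_num) (by norm_num)
  | ite B S₁ S₂ ih₁ ih₂ =>
    rw [Stmt.code, pathsCode_ite, ih₁, ih₂, Stmt.paths, List.map_append]
    simp only [List.map_map]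
    rfl
  | seq S₁ S₂ ih₁ ih₂ =>
    rw [Stmt.code, pathsCode_seq, ih₁, ih₂, Stmt.paths, List.map_flatMap, List.flatMap_map]
    congr 1
    funext p
    rw [List.map_map, List.map_map]
    refine List.map_congr_left fun q _ => ?_
    simp

/-! ### Symbolic execution -/

/-- A symbolic state represents the domain variables and the sampled variables of a state. -/
structure Represents (st : SymState) (τ : State D) : Prop where
  lookup : ∀ x, st.1.lookup x = (τ.α x).map fun d : D => (d : ℚ)
  nodup : (st.2.map Prod.fst).Nodup
  sampled : ∀ e ∈ st.2, ∃ d, τ.β e.1 = some (.inl d) ∧ e.2 = d.entry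
  mem : ∀ r d, τ.β r = some (.inl d) → r ∈ st.2.map Prod.fst

theorem Represents.filter {st : SymState} {τ : State D} (h : Represents st τ) (r : ℕ) :
    ((st.2.filter fun e => !decide (e.1 = r)).map Prod.fst).Nodup ∧
      r ∉ (st.2.filter fun e => !decide (e.1 = r)).map Prod.fst := by
  refine ⟨h.nodup.sublist (List.filter_sublist.map _), ?_⟩
  simp

theorem Represents.sample {st : SymState} {τ : State D} (h : Represents st τ) (r : ℕ) (d : Distr) :
    Represents (st.1, (r, d.entry) :: st.2.filter fun e => !decide (e.1 = r))
      (τ.setReal r (.inl d)) where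
  lookup := h.lookup
  nodup := by
    rw [List.map_cons, List.nodup_cons]
    exact ⟨(h.filter r).2, (h.filter r).1⟩
  sampled e he := by
    rcases List.mem_cons.1 he with rfl | he
    · exact ⟨d, by simp [State.setReal], rfl⟩
    · rw [List.mem_filter] at he
      have hne : e.1 ≠ r := by simpa using he.2
      obtain ⟨d', h1, h2⟩ := h.sampled e he.1
      exact ⟨d', by simpa [State.setReal, hne] using h1, h2⟩
  mem r' d' hd := by
    by_cases hr : r' = r
    · simp [hr]
    · have := h.mem r' d' (by simpa [State.setReal, hr] using hd)
      simp only [List.map_cons, List.mem_cons, List.mem_map, List.mem_filter] at this ⊢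
      obtain ⟨e, he, rfl⟩ := this
      exact .inr ⟨e, ⟨he, by simpa using hr⟩, rfl⟩

theorem Represents.real {st : SymState} {τ : State D} (h : Represents st τ) (r : ℕ) (R : RExp) :
    Represents (st.1, st.2.filter fun e => !decide (e.1 = r)) (τ.setReal r (.inr R)) where
  lookup := h.lookup
  nodup := (h.filter r).1
  sampled e he := by
    rw [List.mem_filter] at he
    have hne : e.1 ≠ r := by simpa using he.2
    obtain ⟨d', h1, h2⟩ := h.sampled e he.1
    exact ⟨d', by simpa [State.setReal, hne] using h1, h2⟩
  mem r' d' hd := by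
    by_cases hr : r' = r
    · simp [State.setReal, hr] at hd
    · have := h.mem r' d' (by simpa [State.setReal, hr] using hd)
      simp only [List.mem_map, List.mem_filter] at this ⊢
      obtain ⟨e, he, rfl⟩ := this
      exact ⟨e, ⟨he, by simpa using hr⟩, rfl⟩

theorem Represents.setDom {st : SymState} {τ : State D} (h : Represents st τ) (x : ℕ) (d : D) :
    Represents ((x, (d : ℚ)) :: st.1, st.2) (τ.setDom x d) where
  lookup y := by
    simp only [State.setDom, List.lookup_cons]
    by_cases hy : y = x
    · simp [hy]
    · have : (y == x) = false := by simpa using hy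
      simp [this, hy, h.lookup]
  nodup := h.nodup
  sampled := h.sampled
  mem := h.mem

/-- `Option.Rel` makes the simulation two-sided: symbolic and actual execution fail together, so
impossible paths are recognised. -/
theorem Represents.step {st : SymState} {τ : State D} (h : Represents st τ) (ε : {ε : ℚ // 0 < ε})
    (i : Instr D) : Option.Rel (fun st' τ' => Represents st' τ') (symStep ε st i.code) (i.run ε τ) := by
  cases i with
  | skip =>
    simp only [symStep, Instr.code, Nat.unpair_pair, Instr.run]
    exact .some h
  | assign x d =>
    simp only [symStep, Instr.code, Nat.unpair_pair, Instr.run]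
    rw [decodeRat_encode]
    exact .some (h.setDom x d)
  | sample k r x a =>
    cases k
    · simp only [symStep, Instr.code, Nat.unpair_pair, Instr.run]
      simp only [decodeRat_encode, h.lookup]
      cases τ.α x with
      | none => exact .none
      | some d => exact .some (h.sample r ⟨.gaussian, d, ⟨a / ε, div_pos a.2 ε.2⟩⟩)
    · simp only [symStep, Instr.code, Nat.unpair_pair, Instr.run]
      simp only [decodeRat_encode, h.lookup]
      cases τ.α x with
      | none => exact .none
      | some d => exact .some (h.sample r ⟨.laplace, d, ⟨a / ε, div_pos a.2 ε.2⟩⟩)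
  | real r R =>
    simp only [symStep, Instr.code, Nat.unpair_pair, Instr.run]
    exact .some (h.real r _)
  | assume B b =>
    cases b <;>
    · simp only [symStep, Instr.code, Nat.unpair_pair, Instr.run]
      exact .some ⟨h.lookup, h.nodup, h.sampled, h.mem⟩

theorem symExec_none (ε : ℚ) (p : List ℕ) :
    p.foldl (fun o i => o.bind fun s => symStep ε s i) none = none := by
  induction p with
  | nil => rfl
  | cons i p ih => exact ih

theorem Represents.exec {st : SymState} {τ : State D} (h : Represents st τ)
    (ε : {ε : ℚ // 0 < ε}) (p : List (Instr D)) :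
    Option.Rel (fun st' τ' => Represents st' τ') (symExec ε st (p.map Instr.code))
      (runPath ε p τ) := by
  induction p generalizing st τ with
  | nil => exact .some h
  | cons i p ih =>
    have hs := h.step ε i
    rw [symExec, List.map_cons, List.foldl_cons, Option.bind_some, runPath]
    generalize symStep ε st i.code = o at hs
    generalize i.run ε τ = o' at hs
    cases hs with
    | none =>
      rw [symExec_none]
      exact .none
    | some h' => exact ih h'

/-! ### Values of the real variables -/

/-- The value of the real variable `r` if unassigned variables are treated as sampled. -/
noncomputable def realValue (β : ℕ → Option (Distr ⊕ RExp)) (ω : ℕ → ℝ) (r : ℕ) : ℝ :=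
  match β r with
  | some (.inr R) => R.eval ω
  | _ => ω r

theorem RExp.eval_subst (β : ℕ → Option (Distr ⊕ RExp)) (ω : ℕ → ℝ) (R : RExp) :
    (R.subst β).eval ω = R.eval (realValue β ω) := by
  induction R with
  | var r =>
    simp only [RExp.subst, RExp.eval, realValue]
    rcases β r with _ | _ | _ <;> rfl
  | smul q R ih => simp [RExp.subst, RExp.eval, ih]
  | add R₁ R₂ ih₁ ih₂ => simp [RExp.subst, RExp.eval, ih₁, ih₂]
  | addConst R q ih => simp [RExp.subst, RExp.eval, ih]

theorem realValue_update (β : ℕ → Option (Distr ⊕ RExp)) (ω : ℕ → ℝ) (r r' : ℕ)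
    (x : Distr ⊕ RExp) : realValue (Function.update β r (some x)) ω r' =
      if r' = r then Sum.elim (fun _ => ω r) (fun R => R.eval ω) x else realValue β ω r' := by
  by_cases h : r' = r
  · subst h
    cases x <;> simp [realValue]
  · simp [realValue, h]

/-- The invariant along the path is that the list `v` holds the values `realValue`. For a dependent
variable, evaluating at current values agrees with evaluating the substituted expression. -/
theorem valueAt_foldl {z : List (ℕ × ℚ)} {ω : ℕ → ℝ} (hz : ∀ r, ((valueAt z r : ℚ) : ℝ) = ω r)
    {ε : {ε : ℚ // 0 < ε}} {p : List (Instr D)} {st τ : State D} (h : runPath ε p st = some τ)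
    {v : List (ℕ × ℚ)} (hv : ∀ r, ((valueAt v r : ℚ) : ℝ) = realValue st.β ω r) (r : ℕ) :
    ((valueAt ((p.map Instr.code).foldl (valueStep z) v) r : ℚ) : ℝ) = realValue τ.β ω r := by
  induction p generalizing st v with
  | nil => cases h; exact hv r
  | cons i p ih =>
    rw [runPath, Option.bind_eq_some_iff] at h
    obtain ⟨s, hs, h⟩ := h
    rw [List.map_cons, List.foldl_cons]
    refine ih h fun r' => ?_
    cases i with
    | skip =>
      cases hs
      simp only [valueStep, Instr.code, Nat.unpair_pair]
      exact hv r'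
    | assign x d =>
      cases hs
      simp only [valueStep, Instr.code, Nat.unpair_pair]
      exact hv r'
    | sample k r x a =>
      simp only [Instr.run, Option.map_eq_some_iff] at hs
      obtain ⟨d, -, rfl⟩ := hs
      simp only [State.setReal, realValue_update, Sum.elim_inl]
      cases k <;>
      · simp only [valueStep, Instr.code, Nat.unpair_pair]
        change ((valueAt ((r, valueAt z r) :: v) r' : ℚ) : ℝ) = _
        rw [valueAt_cons, apply_ite (Rat.cast : ℚ → ℝ), hz, hv]
    | real r R =>
      cases hs
      simp only [State.setReal, realValue_update, Sum.elim_inr]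
      simp only [valueStep, Instr.code, Nat.unpair_pair]
      change ((valueAt ((r, evalCode v R.code) :: v) r' : ℚ) : ℝ) = _
      rw [valueAt_cons, apply_ite (Rat.cast : ℚ → ℝ), cast_evalCode hv, hv, RExp.eval_subst]
    | assume B b =>
      cases hs
      cases b <;>
      · simp only [valueStep, Instr.code, Nat.unpair_pair]
        exact hv r'

/-! ### Guards -/

theorem BExp.code_cmp (B : BExp) : B.code.unpair.2.unpair.1 = B.cmp.code := by
  cases B <;> simp [BExp.code, BExp.cmp]

theorem pathGuards_code (p : List (Instr D)) : pathGuards (p.map Instr.code) =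
    (assumptions p).map fun g => ((g.1.branch g.2).cmp.code, g.1.code) := by
  induction p with
  | nil => rfl
  | cons i p ih =>
    rw [pathGuards] at ih ⊢
    rw [List.map_cons, List.filterMap_cons, ih]
    cases i with
    | skip => simp [Instr.code, assumptions]
    | assign x d => simp [Instr.code, assumptions]
    | sample k r x a => cases k <;> simp [Instr.code, assumptions]
    | real r R => simp [Instr.code, assumptions]
    | assume B b =>
      cases b <;>
      simp [Instr.code, assumptions, BExp.cmp_branch, BExp.code_cmp, Cmp.code_neg]

theorem guardValue_code {st : SymState} {τ : State D} (h : Represents st τ)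
    {v : List (ℕ × ℚ)} {w : ℕ → ℝ} (hv : ∀ r, ((valueAt v r : ℚ) : ℝ) = w r) (B : BExp) :
    (guardValue st.1 v B.code).map (fun q : ℚ => (q : ℝ)) = B.diff τ.α w := by
  cases B with
  | realReal c R₁ R₂ =>
    simp [guardValue, BExp.code, BExp.diff, cast_evalCode hv]
  | realDom c R x =>
    simp only [guardValue, BExp.code, Nat.unpair_pair, BExp.diff, h.lookup]
    cases τ.α x <;> simp [cast_evalCode hv]
  | domDom c x₁ x₂ =>
    simp only [guardValue, BExp.code, Nat.unpair_pair, BExp.diff, h.lookup]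
    cases τ.α x₁ <;> cases τ.α x₂ <;> simp

/-- Only missing domain variables make a comparison undefined, so definedness can be tested at the
corner of a box. -/
theorem BExp.isSome_diff (α : ℕ → Option D) (v w : ℕ → ℝ) (B : BExp) :
    (B.diff α v).isSome = (B.diff α w).isSome := by
  cases B with
  | realReal c R₁ R₂ => rfl
  | realDom c R x => simp [BExp.diff]
  | domDom c x₁ x₂ => rfl

theorem isAffineFun_realValue (β : ℕ → Option (Distr ⊕ RExp)) (r : ℕ) :
    IsAffineFun fun ω => realValue β ω r := by
  simp only [realValue]
  split
  · exact IsAffineFun.eval IsAffineFun.apply _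
  · exact IsAffineFun.apply r

theorem BExp.isAffineFun_diff (τ : State D) (B : BExp) :
    IsAffineFun fun ω => (B.diff τ.α (realValue τ.β ω)).getD 0 := by
  have hR (R : RExp) : IsAffineFun fun ω => R.eval (realValue τ.β ω) :=
    IsAffineFun.eval (isAffineFun_realValue τ.β) R
  cases B with
  | realReal c R₁ R₂ => exact (hR R₁).sub (hR R₂)
  | realDom c R x =>
    simp only [BExp.diff]
    cases τ.α x with
    | none => exact .const 0
    | some d => exact (hR R).sub (.const _)
  | domDom c x₁ x₂ => exact .const ((BExp.diff τ.α 0 (.domDom c x₁ x₂)).getD 0)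

/-- The two differ only at unassigned variables, where `rand` is zero and `realValue` is the
coordinate; such coordinates are not sampled, hence zero by `h0`. -/
theorem State.rand_eq {st : SymState} {τ : State D} (h : Represents st τ) {ω : ℕ → ℝ}
    (h0 : ∀ r ∉ st.2.map Prod.fst, ω r = 0) : τ.rand ω = realValue τ.β ω := by
  funext r
  rw [State.rand, realValue]
  split
  · rename_i d hd
    simp [hd]
  · rename_i R hR
    simp [hR]
  · rename_i hn
    simp only [hn]
    refine (h0 r fun hr => ?_).symm
    obtain ⟨e, he, rfl⟩ := List.mem_map.1 hr
    obtain ⟨d, hd, -⟩ := h.sampled e he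
    simp [hn] at hd

theorem Represents.describes {st : SymState} {τ : State D} (h : Represents st τ) :
    Describes st.2 τ.law where
  nodup := h.nodup
  law e he := by
    obtain ⟨d, hd, he⟩ := h.sampled e he
    exact ⟨d, he, by simp [State.law, hd]⟩

theorem Represents.ae_zero {st : SymState} {τ : State D} (h : Represents st τ) :
    ∀ᵐ ω ∂Measure.infinitePi τ.law, ∀ r ∉ st.2.map Prod.fst, ω r = 0 := by
  refine ae_eq_zero_of_dirac (s := {r | r ∉ st.2.map Prod.fst}) fun r hr => ?_
  rw [State.law]
  split
  · rename_i d hd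
    exact absurd (h.mem r d hd) hr
  · rfl

end DiPGauss

namespace DiPGauss

open MeasureTheory Filter Topology Encodable

/-! ### Correctness of the algorithm -/

variable {D : Finset ℚ}

/-- The situation at the end of a path. -/
structure PathEnd (ε : {ε : ℚ // 0 < ε}) (p : List (Instr D)) (st₀ : State D) (st : SymState)
    (τ : State D) : Prop where
  run : runPath ε p st₀ = some τ
  initial_real : ∀ r, st₀.β r = none
  initial_guards : st₀.G = ∅
  represents : Represents st τ

namespace PathEnd

variable {ε : {ε : ℚ // 0 < ε}} {p : List (Instr D)} {st₀ : State D} {st : SymState}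
  {τ : State D}

theorem valueAt_pathValues (h : PathEnd ε p st₀ st τ) (z : List (ℕ × ℚ)) (r : ℕ) :
    ((valueAt (pathValues (p.map Instr.code) z) r : ℚ) : ℝ) =
      realValue τ.β (fun r => ((valueAt z r : ℚ) : ℝ)) r :=
  valueAt_foldl (fun _ => rfl) h.run (fun r => by simp [realValue, h.initial_real]) r

theorem isSome_guardValue (h : PathEnd ε p st₀ st τ) (z : List (ℕ × ℚ)) (B : BExp)
    (w : ℕ → ℝ) : (guardValue st.1 (pathValues (p.map Instr.code) z) B.code).isSome =
      (B.diff τ.α w).isSome := by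
  rw [B.isSome_diff τ.α w, ← guardValue_code h.represents (h.valueAt_pathValues z),
    Option.isSome_map]

theorem computes (h : PathEnd ε p st₀ st τ) (B : BExp) :
    Computes (guardValueD (p.map Instr.code) st.1 B.code)
      fun ω => (B.diff τ.α (realValue τ.β ω)).getD 0 := by
  intro z
  have := guardValue_code h.represents (h.valueAt_pathValues z) B
  rw [guardValueD]
  beta_reduce
  rw [show realValue τ.β (fun r => ((valueAt z r : ℚ) : ℝ)) =
    fun r => realValue τ.β (fun r => ((valueAt z r : ℚ) : ℝ)) r from rfl, ← this]
  cases guardValue st.1 (pathValues (p.map Instr.code) z) B.code <;> simp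

/-- The event that the output matches and all guards hold. -/
def event (τ : State D) (p : List (Instr D)) (out : Bool) : Set (ℕ → ℝ) :=
  {ω | out = true ∧ ∀ g ∈ assumptions p, (g.1.branch g.2).Holds τ.α (τ.rand ω)}

theorem prob_eq (h : PathEnd ε p st₀ st τ) (out : Bool) :
    (if out = true then τ.prob else 0) = (Measure.infinitePi τ.law).real (event τ p out) := by
  cases out
  · simp [event]
  · rw [if_pos rfl, State.prob_eq]
    congr 1
    ext ω
    simp only [event, Set.mem_ofPred_eq, true_and, mem_guards h.run, h.initial_guards,
      Finset.notMem_empty, false_or]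
    exact ⟨fun h g hg => h _ ⟨g, hg, rfl⟩, by rintro h _ ⟨g, hg, rfl⟩; exact h g hg⟩

theorem abs_sub_le (h : PathEnd ε p st₀ st τ) {N : ℕ} {wb : ℚ × Box} (hwb : wb ∈ boxes N st.2)
    {ω : ℕ → ℝ} (h0 : ∀ r ∉ st.2.map Prod.fst, ω r = 0) (hω : ω ∈ boxSet wb.2) (B : BExp) :
    |(B.diff τ.α (realValue τ.β ω)).getD 0 -
        (guardValueD (p.map Instr.code) st.1 B.code (corner wb.2) : ℚ)| ≤
      (guardSlack (p.map Instr.code) st.1 B.code wb.2 : ℚ) :=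
  abs_sub_le_boxSlack (h.computes B) (B.isAffineFun_diff τ)
    (h.represents.describes.nodup_box hwb) hω fun r hr =>
      h0 r fun hr' => hr ((mem_keys_iff hwb r).2 hr')

theorem mem_event_of_surelyTrue (h : PathEnd ε p st₀ st τ) {out : Bool} {N : ℕ} {wb : ℚ × Box}
    (hwb : wb ∈ boxes N st.2) {ω : ℕ → ℝ} (h0 : ∀ r ∉ st.2.map Prod.fst, ω r = 0)
    (hω : ω ∈ boxSet wb.2) (hs : surelyTrue (p.map Instr.code) st.1 out wb.2 = true) :
    ω ∈ event τ p out := by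
  rw [surelyTrue, Bool.and_eq_true, pathGuards_code, List.all_map, List.all_eq_true] at hs
  refine ⟨hs.1, fun g hg => ?_⟩
  have h1 := hs.2 g hg
  simp only [Function.comp_apply, Bool.and_eq_true] at h1
  rw [h.isSome_guardValue _ _ (realValue τ.β ω), Option.isSome_iff_exists] at h1
  obtain ⟨⟨a, ha⟩, h1⟩ := h1
  have h2 := h.abs_sub_le hwb h0 hω g.1
  rw [State.rand_eq h.represents h0]
  refine ⟨a, by rw [BExp.diff_branch, ha], ?_⟩
  rw [ha] at h2
  exact surely_holds h1 h2

theorem notMem_event_of_surelyFalse (h : PathEnd ε p st₀ st τ) {out : Bool} {N : ℕ}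
    {wb : ℚ × Box} (hwb : wb ∈ boxes N st.2) {ω : ℕ → ℝ}
    (h0 : ∀ r ∉ st.2.map Prod.fst, ω r = 0) (hω : ω ∈ boxSet wb.2)
    (hs : surelyFalse (p.map Instr.code) st.1 out wb.2 = true) : ω ∉ event τ p out := by
  rintro ⟨hout, hg⟩
  rw [surelyFalse, hout, Bool.not_true, Bool.false_or, pathGuards_code, List.any_map,
    List.any_eq_true] at hs
  obtain ⟨g, hgm, hs⟩ := hs
  obtain ⟨a, ha, hc⟩ := hg g hgm
  rw [State.rand_eq h.represents h0, BExp.diff_branch] at ha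
  simp only [Function.comp_apply, Bool.or_eq_true] at hs
  rw [h.isSome_guardValue _ _ (realValue τ.β ω), ha, ← Cmp.code_neg] at hs
  have h2 := h.abs_sub_le hwb h0 hω g.1
  rw [ha] at h2
  rcases hs with hs | hs
  · simp at hs
  · exact (Cmp.holds_neg _ _ _).1 (surely_holds hs h2) hc

/-- There are finitely many guards, so almost surely all of them are decided from some precision on.
Then all hold on the box, or one fails on it. -/
theorem ae_eventually_decided (h : PathEnd ε p st₀ st τ) (out : Bool) :
    ∀ᵐ ω ∂Measure.infinitePi τ.law, ∀ᶠ N in atTop, ∀ wb ∈ boxes N st.2, ω ∈ boxSet wb.2 →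
      (surelyTrue (p.map Instr.code) st.1 out wb.2 ||
        surelyFalse (p.map Instr.code) st.1 out wb.2) = true := by
  have hfin : {g | g ∈ assumptions p}.Finite := List.finite_toSet _
  have h1 := (ae_ball_iff hfin.countable).2 fun g _ =>
    ae_eventually_slack (h.computes g.1) (g.1.isAffineFun_diff τ) h.represents.describes
      h.represents.ae_zero
  filter_upwards [h1] with ω hω
  filter_upwards [(Filter.eventually_all_finite hfin).2 hω] with N hN wb hwb hb
  rw [Bool.or_eq_true]
  by_contra hcon
  rw [not_or] at hcon
  obtain ⟨hT, hF⟩ := hcon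
  rw [surelyFalse, pathGuards_code, List.any_map, Bool.or_eq_true, not_or, List.any_eq_true] at hF
  rw [surelyTrue, pathGuards_code, List.all_map, Bool.and_eq_true, List.all_eq_true] at hT
  refine hT ⟨by simpa using hF.1, fun g hg => ?_⟩
  have h3 := fun hx => hF.2 ⟨g, hg, hx⟩
  simp only [Function.comp_apply, Bool.or_eq_true, Bool.and_eq_true] at h3 ⊢
  refine ⟨by_contra fun hn => h3 (.inl (by simpa using hn)), ?_⟩
  rcases surely_or_surely_neg (g.1.branch g.2).cmp (hN g hg wb hwb hb) with hs | hs
  · exact hs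
  · rw [Cmp.code_neg] at hs
    exact absurd (.inr hs) h3

/-- Lower and upper bound for the probability of the event. -/
theorem bounds (h : PathEnd ε p st₀ st τ) (out : Bool) {N : ℕ} (hN : 1 ≤ N) :
    ((((boxes N st.2).map fun wb =>
        cond (surelyTrue (p.map Instr.code) st.1 out wb.2) wb.1 0).sum : ℚ) : ℝ) ≤
      (Measure.infinitePi τ.law).real (event τ p out) ∧
    (Measure.infinitePi τ.law).real (event τ p out) ≤ ((1 - ((boxes N st.2).map fun wb =>
        cond (surelyFalse (p.map Instr.code) st.1 out wb.2) wb.1 0).sum : ℚ) : ℝ) := by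
  set μ := Measure.infinitePi τ.law
  have hd := h.represents.describes
  constructor
  · refine (sum_weight_le hd hN _).trans (ENNReal.toReal_mono (measure_ne_top _ _) ?_)
    refine measure_mono_ae ?_
    filter_upwards [h.represents.ae_zero] with ω h0
    rintro ⟨wb, hwb, hs, hb⟩
    exact h.mem_event_of_surelyTrue hwb h0 hb hs
  · have h1 := sum_weight_le hd hN fun b => surelyFalse (p.map Instr.code) st.1 out b
    set U := unionSet N st.2 fun b => surelyFalse (p.map Instr.code) st.1 out b
    have h2 : μ.real (event τ p out) ≤ μ.real Uᶜ := by
      refine ENNReal.toReal_mono (measure_ne_top _ _) (measure_mono_ae ?_)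
      filter_upwards [h.represents.ae_zero] with ω h0
      rintro he ⟨wb, hwb, hs, hb⟩
      exact h.notMem_event_of_surelyFalse hwb h0 hb hs he
    rw [probReal_compl_eq_one_sub (measurableSet_unionSet _ _ _)] at h2
    push_cast at h1 ⊢
    linarith

theorem exists_tendsto_bounds (h : PathEnd ε p st₀ st τ) (out : Bool) :
    ∃ l : ℕ → ℝ, Tendsto l atTop (𝓝 0) ∧ ∀ᶠ N in atTop,
      ((1 - ((boxes N st.2).map fun wb =>
        cond (surelyFalse (p.map Instr.code) st.1 out wb.2) wb.1 0).sum : ℚ) : ℝ) -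
      ((((boxes N st.2).map fun wb =>
        cond (surelyTrue (p.map Instr.code) st.1 out wb.2) wb.1 0).sum : ℚ) : ℝ) ≤ l N := by
  obtain ⟨l, hl, hle⟩ := exists_tendsto_le_sum_weight h.represents.describes
    (fun _ b => surelyTrue (p.map Instr.code) st.1 out b ||
        surelyFalse (p.map Instr.code) st.1 out b) (h.ae_eventually_decided out)
  refine ⟨fun N => 1 - l N, by
    simpa using (tendsto_const_nhds (x := (1 : ℝ))).sub hl, ?_⟩
  filter_upwards [hle, eventually_ge_atTop 1] with N hN h1
  -- The gap between the bounds is one minus the weights of both kinds of boxes, hence at most one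
  -- minus the weight of the decided boxes; nonnegative weights make an overlap harmless.
  have key : ((boxes N st.2).map fun wb =>
        cond (surelyTrue (p.map Instr.code) st.1 out wb.2 ||
          surelyFalse (p.map Instr.code) st.1 out wb.2) wb.1 0).sum ≤
      ((boxes N st.2).map fun wb =>
        cond (surelyTrue (p.map Instr.code) st.1 out wb.2) wb.1 0).sum +
      ((boxes N st.2).map fun wb =>
        cond (surelyFalse (p.map Instr.code) st.1 out wb.2) wb.1 0).sum := by
    rw [← List.sum_map_add]
    refine List.sum_le_sum fun wb hwb => ?_
    have := weight_nonneg h1 hwb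
    cases surelyTrue (p.map Instr.code) st.1 out wb.2 <;>
    cases surelyFalse (p.map Instr.code) st.1 out wb.2 <;> simp [this]
  have key' := (Rat.cast_le (K := ℝ)).2 key
  push_cast at key' hN ⊢
  linarith

end PathEnd

/-! ### Decoding inputs and outputs, and assembling the bounds of all paths. -/

theorem lookup_map_of_notMem {κ : Type*} {l : List κ} (k : κ → ℕ) (f : κ → ℚ) {x : ℕ}
    (hx : ∀ y ∈ l, k y ≠ x) : (l.map fun y => (k y, f y)).lookup x = none := by
  induction l with
  | nil => rfl
  | cons y l ih =>
    rw [List.forall_mem_cons] at hx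
    have : (x == k y) = false := by simpa using hx.1.symm
    rw [List.map_cons, List.lookup_cons]
    simp [this, ih hx.2]

theorem lookup_map_of_mem {κ : Type*} {l : List κ} {k : κ → ℕ} (hk : k.Injective) (f : κ → ℚ)
    {y : κ} (hy : y ∈ l) : (l.map fun y => (k y, f y)).lookup (k y) = some (f y) := by
  induction l with
  | nil => simp at hy
  | cons y' l ih =>
    rw [List.map_cons, List.lookup_cons]
    by_cases h : y = y'
    · simp [h]
    · have h1 : (k y == k y') = false := by simpa using fun h' => h (hk h')
      have h2 : y ∈ l := (List.mem_cons.1 hy).resolve_left h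
      simp [h1, ih h2]

theorem decodeVal_valCode (s : Finset ℕ) (u : s → D) : decodeVal (valCode s u) =
    (s.sort (· ≤ ·)).attach.map fun x =>
      (x.1, ((u ⟨x.1, (Finset.mem_sort (· ≤ ·)).1 x.2⟩ : D) : ℚ)) := by
  rw [decodeVal, valCode, List.map_map]
  refine List.map_congr_left fun x _ => ?_
  simp only [Function.comp_apply, ratOfPair_ratCode]

theorem represents_initState (P : Program D) (u : P.inputs → D) :
    Represents (decodeVal (valCode P.inputs u), []) (P.initState u) where
  lookup x := by
    rw [decodeVal_valCode]
    by_cases hx : x ∈ P.inputs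
    · have hx' : x ∈ P.inputs.sort (· ≤ ·) := (Finset.mem_sort _).2 hx
      have := lookup_map_of_mem (k := fun x : {x // x ∈ P.inputs.sort (· ≤ ·)} => x.1)
        Subtype.val_injective
        (fun x => ((u ⟨x.1, (Finset.mem_sort (· ≤ ·)).1 x.2⟩ : D) : ℚ))
        (List.mem_attach _ ⟨x, hx'⟩)
      rw [this]
      simp [Program.initState, hx]
    · rw [lookup_map_of_notMem (k := fun x : {x // x ∈ P.inputs.sort (· ≤ ·)} => x.1)]
      · simp [Program.initState, hx]
      · rintro y - rfl
        exact hx ((Finset.mem_sort _).1 y.2)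
  nodup := by simp
  sampled := by simp
  mem r d h := by simp [Program.initState] at h

theorem outputMatches_iff {st : SymState} {τ : State D} (h : Represents st τ) (s : Finset ℕ)
    (o : s → D) : outputMatches (decodeVal (valCode s o)) st.1 = true ↔
      ∀ y : s, τ.α y = some (o y) := by
  have hinj (y : ℕ) (d : D) : (τ.α y).map (fun d : D => (d : ℚ)) = some (d : ℚ) ↔
      τ.α y = some d := by
    rw [← Option.map_some (f := fun d : D => (d : ℚ))]
    exact (Option.map_injective Subtype.val_injective).eq_iff
  rw [outputMatches, decodeVal_valCode, List.all_map, List.all_eq_true]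
  simp only [Function.comp_apply, decide_eq_true_eq, h.lookup, hinj]
  exact ⟨fun h y => h ⟨y.1, (Finset.mem_sort _).2 y.2⟩ (List.mem_attach _ _),
    fun h x _ => h ⟨x.1, (Finset.mem_sort _).1 x.2⟩⟩

theorem pathBounds_spec (P : Program D) (ε : {ε : ℚ // 0 < ε}) (u : P.inputs → D)
    (o : P.outputs → D) (p : List (Instr D)) :
    let b := fun N => pathBounds (N + 1) ε (decodeVal (valCode P.inputs u))
      (decodeVal (valCode P.outputs o)) (p.map Instr.code)
    (∀ N, (((b N).1 : ℚ) : ℝ) ≤ pathProb ε P u o p ∧ pathProb ε P u o p ≤ ((b N).2 : ℚ)) ∧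
    ∃ l : ℕ → ℝ, Tendsto l atTop (𝓝 0) ∧
      ∀ᶠ N in atTop, (((b N).2 : ℚ) : ℝ) - ((b N).1 : ℚ) ≤ l N := by
  intro b
  have hrel := (represents_initState P u).exec ε p
  simp only [b, pathBounds, pathProb]
  generalize hs : symExec ε (decodeVal (valCode P.inputs u), []) (p.map Instr.code) = x at hrel
  generalize hr : runPath ε p (P.initState u) = y at hrel
  cases hrel with
  -- A path without a final state contributes zero, and its bounds are both zero by default.
  | none => exact ⟨fun N => by simp, fun _ => 0, tendsto_const_nhds, by simp⟩
  | @some st τ h =>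
    have he : PathEnd ε p (P.initState u) st τ := ⟨hr, fun _ => rfl, rfl, h⟩
    have hout := outputMatches_iff h P.outputs o
    simp only [Option.map_some, Option.getD_some, ← hout]
    refine ⟨fun N => ?_, ?_⟩
    · rw [he.prob_eq]
      exact he.bounds _ (Nat.le_add_left 1 N)
    · obtain ⟨l, hl, hle⟩ := he.exists_tendsto_bounds
        (outputMatches (decodeVal (valCode P.outputs o)) st.1)
      exact ⟨fun N => l (N + 1), hl.comp (tendsto_add_atTop_nat 1),
        (tendsto_add_atTop_nat 1).eventually hle⟩

theorem sum_bounds_spec {κ : Type*} (l : List κ) (b : ℕ → κ → ℚ × ℚ) (f : κ → ℝ)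
    (h : ∀ a, (∀ N, (((b N a).1 : ℚ) : ℝ) ≤ f a ∧ f a ≤ ((b N a).2 : ℚ)) ∧
      ∃ l : ℕ → ℝ, Tendsto l atTop (𝓝 0) ∧
        ∀ᶠ N in atTop, (((b N a).2 : ℚ) : ℝ) - ((b N a).1 : ℚ) ≤ l N) :
    (∀ N, (((l.map fun a => (b N a).1).sum : ℚ) : ℝ) ≤ (l.map f).sum ∧
      (l.map f).sum ≤ ((l.map fun a => (b N a).2).sum : ℚ)) ∧
    ∃ d : ℕ → ℝ, Tendsto d atTop (𝓝 0) ∧ ∀ᶠ N in atTop,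
      (((l.map fun a => (b N a).2).sum : ℚ) : ℝ) - ((l.map fun a => (b N a).1).sum : ℚ) ≤ d N := by
  induction l with
  | nil => exact ⟨fun N => by simp, fun _ => 0, tendsto_const_nhds, by simp⟩
  | cons a l ih =>
    obtain ⟨h1, d, hd, hdl⟩ := ih
    obtain ⟨h2, d', hd', hdl'⟩ := h a
    simp only [List.map_cons, List.sum_cons, Rat.cast_add]
    refine ⟨fun N => ⟨add_le_add (h2 N).1 (h1 N).1, add_le_add (h2 N).2 (h1 N).2⟩,
      fun N => d' N + d N, by simpa using hd'.add hd, ?_⟩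
    filter_upwards [hdl, hdl'] with N h3 h4
    linarith

/-- The input of the algorithm. -/
def algInput (P : Program D) (ρ : ℕ) (ε : {ε : ℚ // 0 < ε}) (u : P.inputs → D)
    (o : P.outputs → D) : AlgInput :=
  (ρ, ratCode ε, valCode P.inputs u, valCode P.outputs o, P.code)

theorem bounds_spec (P : Program D) (ρ : ℕ) (ε : {ε : ℚ // 0 < ε}) (u : P.inputs → D)
    (o : P.outputs → D) :
    (∀ N, ((lowerBound (algInput P ρ ε u o) N : ℚ) : ℝ) ≤ P.prob ε u o ∧
      P.prob ε u o ≤ (upperBound (algInput P ρ ε u o) N : ℚ)) ∧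
    ∃ N, accurate (algInput P ρ ε u o) N = true := by
  have hall (N : ℕ) : allPathBounds (algInput P ρ ε u o) N = P.body.paths.map fun p =>
      pathBounds (N + 1) ε (decodeVal (valCode P.inputs u)) (decodeVal (valCode P.outputs o))
        (p.map Instr.code) := by
    simp only [allPathBounds, algInput, Program.code, pathsCode_code, ratOfPair_ratCode,
      List.map_map]
    rfl
  obtain ⟨h1, d, hd, hle⟩ := sum_bounds_spec P.body.paths _ _ (pathBounds_spec P ε u o)
  have hlow (N : ℕ) : lowerBound (algInput P ρ ε u o) N = (P.body.paths.map fun p =>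
      (pathBounds (N + 1) ε (decodeVal (valCode P.inputs u)) (decodeVal (valCode P.outputs o))
        (p.map Instr.code)).1).sum := by
    rw [lowerBound, hall, List.map_map]; rfl
  have hup (N : ℕ) : upperBound (algInput P ρ ε u o) N = (P.body.paths.map fun p =>
      (pathBounds (N + 1) ε (decodeVal (valCode P.inputs u)) (decodeVal (valCode P.outputs o))
        (p.map Instr.code)).2).sum := by
    rw [upperBound, hall, List.map_map]; rfl
  refine ⟨fun N => ?_, ?_⟩
  · rw [hlow, hup, Program.prob_eq_sum]
    exact h1 N
  · have hpos : (0 : ℝ) < 1 / 2 ^ ρ := by positivity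
    obtain ⟨N, hN, hN'⟩ := (hle.and (hd.eventually (gt_mem_nhds hpos))).exists
    refine ⟨N, ?_⟩
    rw [accurate, decide_eq_true_eq, hlow, hup, ← Rat.cast_le (K := ℝ)]
    simp only [algInput]
    push_cast at hN ⊢
    linarith

/-- The bounds are correct at every precision, so the answer is correct wherever the search stops;
convergence is needed only for termination. -/
theorem search_spec (P : Program D) (ρ : ℕ) (ε : {ε : ℚ // 0 < ε}) (u : P.inputs → D)
    (o : P.outputs → D) :
    ∃ L U : ℚ, (ratCode L, ratCode U) ∈ search (algInput P ρ ε u o) ∧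
      (L : ℝ) ≤ P.prob ε u o ∧ P.prob ε u o ≤ (U : ℝ) ∧ (U : ℝ) - (L : ℝ) ≤ 1 / 2 ^ ρ := by
  obtain ⟨h, M, hM⟩ := bounds_spec P ρ ε u o
  obtain ⟨N, hN, -⟩ := Nat.rfind_min' (p := accurate (algInput P ρ ε u o)) hM
  have hacc : accurate (algInput P ρ ε u o) N = true :=
    (Part.mem_some_iff.1 (Nat.rfind_spec hN)).symm
  refine ⟨_, _, Part.mem_map _ hN, (h N).1, (h N).2, ?_⟩
  rw [accurate, decide_eq_true_eq, ← Rat.cast_le (K := ℝ)] at hacc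
  simp only [algInput] at hacc ⊢
  push_cast at hacc
  exact hacc

end DiPGauss
open DiPGauss in
theorem mainTheorem2 :
    ∃ compute :
        ℕ × (ℤ × ℕ) × List (ℕ × (ℤ × ℕ)) × List (ℕ × (ℤ × ℕ)) × (List ℕ × List ℕ × ℕ) →.
          (ℤ × ℕ) × (ℤ × ℕ),
      Partrec compute ∧
      ∀ (D : Finset ℚ) (P : Program D), P.WellFormed →
        ∀ (ρ : ℕ) (ε : {ε : ℚ // 0 < ε}) (u : P.inputs → D) (o : P.outputs → D),
          ∃ L U : ℚ,
            (ratCode L, ratCode U) ∈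
              compute (ρ, ratCode ε, valCode P.inputs u, valCode P.outputs o, P.code) ∧
            (L : ℝ) ≤ P.prob ε u o ∧ P.prob ε u o ≤ (U : ℝ) ∧
            (U : ℝ) - (L : ℝ) ≤ 1 / 2 ^ ρ :=
  ⟨search, partrec_search, fun _ P _ ρ ε u o => search_spec P ρ ε u o⟩
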